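/- **Setting.** Let $0<q<1$, $N\ge 3$, $N=2n+1$ or $N=2n$, and $h=0$ for odd $N$, $h=1$ for even $N$. Space indices are $i=-n,\dots,n$ ($i\neq0$ if $N$ is even; then $p^0:=0$). Put $\rho_{-i}=-\rho_i$, $\rho_0=0$, and for $i>0$ $\rho_i=\frac12-i$ ($N$ odd), $\rho_i=1-i$ ($N$ even). Put $p_i=q^{-\rho_i}p^{-i}$, $[A,B]_a=AB-aBA$, $[A,B]=[A,B]_1$, $(p\cdot p)_j=\sum_{l=1}^{j}p^{-l}p_{-l}+\frac{p^0p_0}{1+q^{-1}}$ ($h\le j\le n$), $\mathbf k^0=1$, $\mathbf k^{-i}=(\mathbf k^i)^{-1}$. Call $(u,v)$ a simple pair if $h\le u=v-1\le n-1$, or if $N$ is even and $(u,v)=(-1,2)$. Two distinct simple pairs $(u,v),(u',v')$ are adjacent if $v=u'$ or $v'=u$. The $*$-algebra $u_q(e^N)$ has generators $p^i$, $(\mathbf k^i)^{\pm1}$ ($1\le i\le n$), $\Lambda^{\pm1}$, and $\mathbf L^{-u,v},\mathbf L^{-v,u}$ for simple pairs $(u,v)$ (positive and negative simple roots). Its relations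 are: * $p^ip^j=q\,p^jp^i$ for $i<j$, $i\ne-j$; $\sum_{l=-j}^{j}p^lp_l=(1+q^{-2\rho_j})(p\cdot p)_j$ for $1\le j\le n$; * the $\mathbf k^i$ commute; $\mathbf k^ip^l=q^{2(\delta_{li}-\delta_{l,-i})}p^l\mathbf k^i$; $\mathbf k^i\mathbf L^{-u,v}=q^{2w}\mathbf L^{-u,v}\mathbf k^i$, $\mathbf k^i\mathbf L^{-v,u}=q^{-2w}\mathbf L^{-v,u}\mathbf k^i$ with $w=\delta_{iv}-\delta_{iu}+\delta_{i,-u}$; * $[\mathbf L^{-u,v},\mathbf L^{-v,u}]_{q^2}=q^{1+2\rho_v}\frac{1-\mathbf k^{u}\mathbf k^{-v}}{q-q^{-1}}$ if $u\ne0$, and $[\mathbf L^{0,1},\mathbf L^{-1,0}]_q=q^{-1/2}\frac{1-\mathbf k^{-1}}{q-q^{-1}}$; for distinct simple pairs $[\mathbf L^{-u,v},\mathbf L^{-v',u'}]_{a}=0$ with $a=q^{-1}$ if they are adjacent, $a=1$ otherwise; * Serre relations. For distinct non-adjacent pairs, $[\mathbf L^{-u,v},\mathbf L^{-u',v'}]=0=[\mathbf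 L^{-v,u},\mathbf L^{-v',u'}]$. For simple pairs $(u,v),(v,w)$, with $Z=[\mathbf L^{-u,v},\mathbf L^{-v,w}]_q$ and $Z'=[\mathbf L^{-w,v},\mathbf L^{-v,u}]_q$: $[\mathbf L^{-v,w},Z]_q=0=[Z',\mathbf L^{-w,v}]_q$; if $u\neq0$, also $[\mathbf L^{-u,v},Z]_{q^{-1}}=0=[Z',\mathbf L^{-v,u}]_{q^{-1}}$; if $u=0$, also $[\mathbf L^{0,1},[Z,\mathbf L^{0,1}]]_{q^{-1}}=0=[[\mathbf L^{-1,0},Z'],\mathbf L^{-1,0}]_{q^{-1}}$; * $[\mathbf L^{-u,v},p^{u}]_q=-q^{\rho_v}p^v$ and $[\mathbf L^{-v,u},p^{-u}]_{q^{-1}}=q^{\rho_v}p^{-v}$ if $u\neq 0$; $[\mathbf L^{-u,v},p^{-v}]_q=q^{\rho_v}p^{-u}$; $[\mathbf L^{-v,u},p^{v}]_{q^{-1}}=-q^{\rho_v}p^{u}$; $[\mathbf L^{0,1},p^0]=-q^{-1}p^1$, $[\mathbf L^{-1,0},p^0]=p^{-1}$ ($N$ odd); for every other pair of a simple root $\mathbf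 L^{-u,v}$ or $\mathbf L^{-v,u}$ and a momentum $p^i$, the $q^b$-commutator vanishes, $b=\delta_{iu}-\delta_{i,-u}-\delta_{iv}+\delta_{i,-v}$; * $\Lambda p^i=q^{-1}p^i\Lambda$, and $\Lambda$ commutes with the $\mathbf k^i$ and the $\mathbf L$'s; * $(p^i)^*=q^{\rho_i}p^{-i}$, $(\mathbf k^i)^*=\mathbf k^i$, $(\mathbf L^{-u,v})^*=q^{-2}\mathbf L^{-v,u}$ ($u\ne0$), $(\mathbf L^{0,1})^*=q^{-3/2}\mathbf L^{-1,0}$, $\Lambda^*=q^{-N}\Lambda^{-1}$. Let $\mathcal H$ be a complex pre-Hilbert space carrying an irreducible $*$-representation of $u_q(e^N)$ (no invariant subspaces except $0\neq\mathcal H$ and $\mathcal H$), and suppose that $p_0$, $(p\cdot p)_h,\dots,(p\cdot p)_n$, $\mathbf k^1,\dots,\mathbf k^n$ have a common eigenvector on which $(p\cdot p)_n$ does not vanish and the eigenvalues of the $\mathbf k^i$ are positive. **Theorem.** All $(p\cdot p)_l$, $h\le l\le n$, are invertible on $\mathcal H$, so that the operators $$L^{-u,v}=\mathbf L^{-u,v}+\frac{q^{2\rho_v+2}}{1-q^2}(p\cdot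 p)_{v-1}^{-1}p^{-u}p^{v},\qquad L^{-v,u}=\mathbf L^{-v,u}+\frac{q^{2\rho_v+1}}{1-q^2}(p\cdot p)_{v-1}^{-1}p^{-v}p^{u}$$ are defined for all simple pairs. There are $M>0$, a sign $\pm$, constants $\lambda_1,\dots,\lambda_n\in(q^2,1]$, and an orthonormal basis of $\mathcal H$ consisting of vectors $|\vec\pi;\vec j,\alpha\rangle$ with $\vec\pi=(\pi_h,\dots,\pi_n)\in\mathbb N^{n-h}\times\mathbb Z$, $\vec j\in\mathbb Z^n$ and a degeneracy label $\alpha$ (every such $\vec\pi$ occurs; the set of occurring $(\vec j,\alpha)$ may depend on $\vec\pi$ and on the representation) such that, with unit vectors $\vec e_l$ ($h\le l\le n$) and $\vec y_i$ ($1\le i\le n$), $\vec y_0:=0$, $\vec y_{-1}:=-\vec y_1$, all of the following hold for every basis vector: * $(p\cdot p)_l|\vec\pi;\vec j,\alpha\rangle=M^2q^{2\sum_{k=l}^n(1+\pi_k)}|\vec\pi;\vec j,\alpha\rangle$ for $h\le l\le n$, and $\mathbf k^i|\vec\pi;\vec j,\alpha\rangle=\lambda_iq^{2j_i}|\vec\pi;\vec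 j,\alpha\rangle$ for $1\le i\le n$; * for $h<l\le n$ $$p^l|\vec\pi;\vec j,\alpha\rangle=M[1-q^{2(\pi_{l-1}+1)}]^{1/2}q^{\sum_{k=l}^n(1+\pi_k)}|\vec\pi+\vec e_{l-1};\vec j+\vec y_l,\alpha\rangle,$$ $$p^{-l}|\vec\pi;\vec j,\alpha\rangle=M[1-q^{2\pi_{l-1}}]^{1/2}q^{-\rho_l+\sum_{k=l}^n(1+\pi_k)}|\vec\pi-\vec e_{l-1};\vec j-\vec y_l,\alpha\rangle,$$ the last expression being $0$ if $\pi_{l-1}=0$; * if $N$ is odd, $p_0|\vec\pi;\vec j,\alpha\rangle=\pm M[1+q^{-1}]^{1/2}q^{\sum_{k=0}^n(1+\pi_k)}|\vec\pi;\vec j,\alpha\rangle$; if $N$ is even, $p^{\pm1}|\vec\pi;\vec j,\alpha\rangle=Mq^{\sum_{k=1}^n(1+\pi_k)}|\vec\pi;\vec j\pm\vec y_1,\alpha\rangle$; * for every simple pair, $L^{-u,v}|\vec\pi;\vec j,\alpha\rangle$ and $L^{-v,u}|\vec\pi;\vec j,\alpha\rangle$ are linear combinations of the basis vectors with labels $(\vec\pi;\vec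 j+\vec y_v-\vec y_u,\alpha')$ and $(\vec\pi;\vec j-\vec y_v+\vec y_u,\alpha')$ respectively, with $\alpha'$ arbitrary. All vectors named on the right-hand sides of the formulas for $p^{\pm l}$ (except the vanishing one) and for $p^{\pm 1}$ belong to the basis. If, moreover, for some $(\vec\pi,\vec j)$ the set of basis vectors $|\vec\pi;\vec j,\alpha\rangle$ is finite and non-empty, then $\lambda_1=\lambda_2=\dots=\lambda_n$ for odd $N$ and $\lambda_2=\dots=\lambda_n$ for even $N$. -/

import Mathlib

noncomputable section

namespace QEuclid

/-- `n`, where `N = 2n+1` or `N = 2n`. -/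
def rk (N : ℕ) : ℤ := ((N / 2 : ℕ) : ℤ)

/-- `h(N)`: `0` for odd `N`, `1` for even `N`. -/
def hh (N : ℕ) : ℤ := if Even N then 1 else 0

/-- The space indices: `-n, …, n`, with `0` left out if `N` is even. -/
def IsSpaceIndex (N : ℕ) (i : ℤ) : Prop :=
  -rk N ≤ i ∧ i ≤ rk N ∧ (Even N → i ≠ 0)

/-- `(ρ_{-n}, …, ρ_n) = (n-1/2, …, 1/2, 0, -1/2, …, 1/2-n)` for `N = 2n+1` and
`(n-1, …, 0, 0, …, 1-n)` for `N = 2n`. -/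
def rho (N : ℕ) (i : ℤ) : ℝ :=
  (if Even N then (1 : ℝ) else 1 / 2) * ((SignType.sign i : ℤ) : ℝ) - (i : ℝ)

/-- The real power `q ^ x`, as a complex scalar. -/
def qp (q x : ℝ) : ℂ := ((q ^ x : ℝ) : ℂ)

/-- The pairs `(u, v)` for which `𝐋^{-u,v}` is a positive simple root (a Chevalley generator), with
negative partner `𝐋^{-v,u}`: the pairs `(m-1, m)`, `h+1 ≤ m ≤ n`, and also `(-1, 2)` for even `N`
(the root `𝐋^{1,2}`). -/
def IsSimpleRoot (N : ℕ) (u v : ℤ) : Prop :=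
  (hh N ≤ u ∧ v = u + 1 ∧ v ≤ rk N) ∨ (Even N ∧ u = -1 ∧ v = 2)

/-- Kronecker delta. -/
def kd (i j : ℤ) : ℤ := if i = j then 1 else 0

/-- The exponent of `b`: `(𝐋^{-u,v}, p^i)` and `(𝐋^{-v,u}, p^i)` `q^{bexp}`-commute, except for the
pairs in which a further momentum is produced. -/
def bexp (u v i : ℤ) : ℤ := kd i u - kd i (-u) - kd i v + kd i (-v)

section Operators

variable {D : Type*} [NormedAddCommGroup D] [InnerProductSpace ℂ D]

/-- `[A, B]_a = A B - a B A`. -/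
def qcomm (a : ℂ) (A B : Module.End ℂ D) : Module.End ℂ D := A * B - a • (B * A)

/-- `B` is the formal adjoint of `A` on the domain `D`. -/
def IsAdj (A B : Module.End ℂ D) : Prop := ∀ x y : D, inner ℂ (A x) y = inner ℂ x (B y)

end Operators

/-- Operators on `D` that are to represent the generators `p^i`, `𝐋^{ij}` (only the simple roots are
used), `𝐤^i` (with `𝐤^{-i}` for the inverse of `𝐤^i`), `Λ`, `Λ⁻¹`. -/
structure Generators (D : Type*) [NormedAddCommGroup D] [InnerProductSpace ℂ D] where
  p : ℤ → Module.End ℂ D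
  L : ℤ → ℤ → Module.End ℂ D
  k : ℤ → Module.End ℂ D
  Lam : Module.End ℂ D
  LamInv : Module.End ℂ D

section Reps

variable {D : Type*} [NormedAddCommGroup D] [InnerProductSpace ℂ D]

/-- `p_i = C_{ij} p^j = q^{-ρ_i} p^{-i}`. -/
def Generators.lower (g : Generators D) (N : ℕ) (q : ℝ) (i : ℤ) : Module.End ℂ D :=
  qp q (-rho N i) • g.p (-i)

/-- `(p·p)_j = ∑_{l=1}^j p^{-l} p_{-l} + p^0 p_0 / (1 + q⁻¹)`, the last term for odd `N` only
(`p^0 = 0` by convention for even `N`). -/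
def Generators.dot (g : Generators D) (N : ℕ) (q : ℝ) (j : ℤ) : Module.End ℂ D :=
  ∑ l ∈ Finset.Icc 1 j, g.p (-l) * g.lower N q (-l)
    + (1 / (1 + qp q (-1))) • (g.p 0 * g.lower N q 0)

/-- The operators satisfy the defining relations of the algebra `u_q(e^N)` and its `*`-relations,
i.e. they define a `*`-representation of it on the pre-Hilbert space `D`. -/
structure IsStarRep (N : ℕ) (q : ℝ) (g : Generators D) : Prop where
  -- conventions
  p_zero : Even N → g.p 0 = 0
  k_zero : g.k 0 = 1
  -- momenta among themselves
  p_p : ∀ i j, IsSpaceIndex N i → IsSpaceIndex N j → i < j → i ≠ -j →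
    g.p i * g.p j = (q : ℂ) • (g.p j * g.p i)
  p_trace : ∀ j, 1 ≤ j → j ≤ rk N →
    ∑ l ∈ Finset.Icc (-j) j, g.p l * g.lower N q l = (1 + qp q (-2 * rho N j)) • g.dot N q j
  -- Cartan generators
  k_inv : ∀ i, 1 ≤ i → i ≤ rk N → g.k i * g.k (-i) = 1 ∧ g.k (-i) * g.k i = 1
  k_k : ∀ i j, 1 ≤ i → i ≤ rk N → 1 ≤ j → j ≤ rk N → g.k i * g.k j = g.k j * g.k i
  k_p : ∀ i l, 1 ≤ i → i ≤ rk N → IsSpaceIndex N l →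
    qcomm ((q : ℂ) ^ (2 * (kd l i - kd l (-i)))) (g.k i) (g.p l) = 0
  k_pos : ∀ i u v, 1 ≤ i → i ≤ rk N → IsSimpleRoot N u v →
    qcomm ((q : ℂ) ^ (2 * (kd i v - kd i u + kd i (-u)))) (g.k i) (g.L (-u) v) = 0
  k_neg : ∀ i u v, 1 ≤ i → i ≤ rk N → IsSimpleRoot N u v →
    qcomm ((q : ℂ) ^ (-(2 * (kd i v - kd i u + kd i (-u))))) (g.k i) (g.L (-v) u) = 0
  -- positive against negative simple roots
  pos_neg : ∀ u v, IsSimpleRoot N u v → u ≠ 0 →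
    qcomm ((q : ℂ) ^ 2) (g.L (-u) v) (g.L (-v) u)
      = (qp q (1 + 2 * rho N v) / ((q : ℂ) - (q : ℂ)⁻¹)) • (1 - g.k u * g.k (-v))
  pos_neg_zero : ¬ Even N →
    qcomm (q : ℂ) (g.L 0 1) (g.L (-1) 0)
      = (qp q (-(1 / 2)) / ((q : ℂ) - (q : ℂ)⁻¹)) • (1 - g.k (-1))
  pos_neg_adj : ∀ u v u' v', IsSimpleRoot N u v → IsSimpleRoot N u' v' → (v = u' ∨ v' = u) →
    qcomm (q : ℂ)⁻¹ (g.L (-u) v) (g.L (-v') u') = 0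
  pos_neg_far : ∀ u v u' v', IsSimpleRoot N u v → IsSimpleRoot N u' v' →
    (u, v) ≠ (u', v') → v ≠ u' → v' ≠ u →
    qcomm 1 (g.L (-u) v) (g.L (-v') u') = 0
  -- Serre relations
  serre_far : ∀ u v u' v', IsSimpleRoot N u v → IsSimpleRoot N u' v' →
    (u, v) ≠ (u', v') → v ≠ u' → v' ≠ u →
    qcomm 1 (g.L (-u) v) (g.L (-u') v') = 0 ∧ qcomm 1 (g.L (-v) u) (g.L (-v') u') = 0
  serre_right : ∀ u v w, IsSimpleRoot N u v → IsSimpleRoot N v w →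
    qcomm (q : ℂ) (g.L (-v) w) (qcomm (q : ℂ) (g.L (-u) v) (g.L (-v) w)) = 0 ∧
    qcomm (q : ℂ) (qcomm (q : ℂ) (g.L (-w) v) (g.L (-v) u)) (g.L (-w) v) = 0
  serre_left : ∀ u v w, IsSimpleRoot N u v → IsSimpleRoot N v w → u ≠ 0 →
    qcomm (q : ℂ)⁻¹ (g.L (-u) v) (qcomm (q : ℂ) (g.L (-u) v) (g.L (-v) w)) = 0 ∧
    qcomm (q : ℂ)⁻¹ (qcomm (q : ℂ) (g.L (-w) v) (g.L (-v) u)) (g.L (-v) u) = 0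
  serre_short : ¬ Even N → 2 ≤ rk N →
    qcomm (q : ℂ)⁻¹ (g.L 0 1) (qcomm 1 (qcomm (q : ℂ) (g.L 0 1) (g.L (-1) 2)) (g.L 0 1)) = 0 ∧
    qcomm (q : ℂ)⁻¹ (qcomm 1 (g.L (-1) 0) (qcomm (q : ℂ) (g.L (-2) 1) (g.L (-1) 0)))
      (g.L (-1) 0) = 0
  -- roots against momenta
  pos_p_u : ∀ u v, IsSimpleRoot N u v → u ≠ 0 →
    qcomm (q : ℂ) (g.L (-u) v) (g.p u) = -(qp q (rho N v) • g.p v)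
  pos_p_v : ∀ u v, IsSimpleRoot N u v →
    qcomm (q : ℂ) (g.L (-u) v) (g.p (-v)) = qp q (rho N v) • g.p (-u)
  neg_p_v : ∀ u v, IsSimpleRoot N u v →
    qcomm (q : ℂ)⁻¹ (g.L (-v) u) (g.p v) = -(qp q (rho N v) • g.p u)
  neg_p_u : ∀ u v, IsSimpleRoot N u v → u ≠ 0 →
    qcomm (q : ℂ)⁻¹ (g.L (-v) u) (g.p (-u)) = qp q (rho N v) • g.p (-v)
  pos_p_zero : ¬ Even N → qcomm 1 (g.L 0 1) (g.p 0) = -((q : ℂ)⁻¹ • g.p 1)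
  neg_p_zero : ¬ Even N → qcomm 1 (g.L (-1) 0) (g.p 0) = g.p (-1)
  pos_p : ∀ u v i, IsSimpleRoot N u v → IsSpaceIndex N i → i ≠ u → i ≠ -v →
    qcomm ((q : ℂ) ^ bexp u v i) (g.L (-u) v) (g.p i) = 0
  neg_p : ∀ u v i, IsSimpleRoot N u v → IsSpaceIndex N i → i ≠ v → i ≠ -u →
    qcomm ((q : ℂ) ^ bexp u v i) (g.L (-v) u) (g.p i) = 0
  -- dilatations
  lam_inv : g.Lam * g.LamInv = 1 ∧ g.LamInv * g.Lam = 1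
  lam_p : ∀ i, IsSpaceIndex N i → qcomm (q : ℂ)⁻¹ g.Lam (g.p i) = 0
  lam_k : ∀ i, 1 ≤ i → i ≤ rk N → qcomm 1 g.Lam (g.k i) = 0
  lam_L : ∀ u v, IsSimpleRoot N u v →
    qcomm 1 g.Lam (g.L (-u) v) = 0 ∧ qcomm 1 g.Lam (g.L (-v) u) = 0
  -- `*`-relations
  star_p : ∀ i, IsSpaceIndex N i → IsAdj (g.p i) (qp q (rho N i) • g.p (-i))
  star_k : ∀ i, 1 ≤ i → i ≤ rk N → IsAdj (g.k i) (g.k i)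
  star_L : ∀ u v, IsSimpleRoot N u v → u ≠ 0 →
    IsAdj (g.L (-u) v) (qp q (-2) • g.L (-v) u)
  star_L_zero : ¬ Even N → IsAdj (g.L 0 1) (qp q (-(3 / 2)) • g.L (-1) 0)
  star_lam : IsAdj g.Lam (qp q (-(N : ℝ)) • g.LamInv)

/-- Irreducibility: no invariant subspaces other than `0 ≠ D` and `D`. -/
def IsIrreducibleRep (N : ℕ) (g : Generators D) : Prop :=
  Nontrivial D ∧ ∀ W : Submodule ℂ D,
    (∀ i, IsSpaceIndex N i → ∀ x ∈ W, g.p i x ∈ W) →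
    (∀ u v, IsSimpleRoot N u v → ∀ x ∈ W, g.L (-u) v x ∈ W ∧ g.L (-v) u x ∈ W) →
    (∀ i, 1 ≤ i → i ≤ rk N → ∀ x ∈ W, g.k i x ∈ W ∧ g.k (-i) x ∈ W) →
    (∀ x ∈ W, g.Lam x ∈ W ∧ g.LamInv x ∈ W) →
    W = ⊥ ∨ W = ⊤

/-- `φ` is a common eigenvector of the commuting observables `p_0`, `(p·p)_l`, `𝐤^i`, on which
`(p·p)_n` does not vanish and the `𝐤^i` are positive. -/
def IsJointEigenvector (N : ℕ) (q : ℝ) (g : Generators D) (φ : D) : Prop :=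
  φ ≠ 0 ∧ (∃ c : ℂ, g.lower N q 0 φ = c • φ) ∧
  (∀ l, hh N ≤ l → l ≤ rk N → ∃ a : ℂ, g.dot N q l φ = a • φ) ∧
  g.dot N q (rk N) φ ≠ 0 ∧
  (∀ i, 1 ≤ i → i ≤ rk N → ∃ κ : ℝ, 0 < κ ∧ g.k i φ = (κ : ℂ) • φ)

/-- The improved positive root
`L^{-u,v} = 𝐋^{-u,v} + q^{2ρ_v+2} / ((1-q²) (p·p)_{v-1}) p^{-u} p^v`. -/
def Generators.newPos (g : Generators D) (N : ℕ) (q : ℝ) (u v : ℤ) : Module.End ℂ D :=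
  g.L (-u) v + (qp q (2 * rho N v + 2) / (1 - (q : ℂ) ^ 2)) •
    (Ring.inverse (g.dot N q (v - 1)) * g.p (-u) * g.p v)

/-- The improved negative root
`L^{-v,u} = 𝐋^{-v,u} + q^{2ρ_v+1} / ((1-q²) (p·p)_{v-1}) p^{-v} p^u`. -/
def Generators.newNeg (g : Generators D) (N : ℕ) (q : ℝ) (u v : ℤ) : Module.End ℂ D :=
  g.L (-v) u + (qp q (2 * rho N v + 1) / (1 - (q : ℂ) ^ 2)) •
    (Ring.inverse (g.dot N q (v - 1)) * g.p (-v) * g.p u)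

end Reps

/-- The labels `(π; j, α)` of basis vectors. The components `π_h, …, π_n` and `j_1, …, j_n` are
relevant; the others are kept zero by `IsLabel`. -/
structure KetLabel where
  π : ℤ → ℤ
  j : ℤ → ℤ
  α : ℕ

/-- `π ∈ ℕ^{n-h} × ℤ`, with components `π_h, …, π_{n-1} ∈ ℕ`, `π_n ∈ ℤ`. -/
def IsMomentumLabel (N : ℕ) (π : ℤ → ℤ) : Prop :=
  (∀ l, (l < hh N ∨ rk N < l) → π l = 0) ∧ ∀ l, hh N ≤ l → l < rk N → 0 ≤ π l

/-- `(π; j, α)` with `π ∈ ℕ^{n-h} × ℤ`, `j ∈ ℤ^n`. -/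
def IsLabel (N : ℕ) (s : KetLabel) : Prop :=
  IsMomentumLabel N s.π ∧ ∀ i, (i < 1 ∨ rk N < i) → s.j i = 0

/-- The unit vector `e_l`. -/
def ee (l : ℤ) : ℤ → ℤ := Pi.single l 1

/-- The unit vector `y_u` for `u > 0`; `y_0 = 0` and `y_{-u} = -y_u`. -/
def yy (u : ℤ) : ℤ → ℤ :=
  if 0 < u then Pi.single u 1 else if u < 0 then -Pi.single (-u) 1 else 0

/-- `∑_{k=l}^n (1 + π_k)`. -/
def expSum (N : ℕ) (π : ℤ → ℤ) (l : ℤ) : ℤ := ∑ k ∈ Finset.Icc l (rk N), (1 + π k)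

end QEuclid

end

/-! The momenta either commute with the invariants $(p\cdot p)_m$ or move past them with a factor
$q^{\pm2}$. A simple root $\mathbf L^{\mp}$ commutes with every $(p\cdot p)_m$ except $(p\cdot
p)_{v-1}$, where the defect is a multiple of $p^{-u}p^v$ or $p^{-v}p^u$ (`pos_dot_pred_apply`,
`neg_dot_pred_apply`). This product itself picks up $q^{\pm2}$ under $(p\cdot p)_{v-1}$, so a
multiple of it divided by $(p\cdot p)_{v-1}$ repairs the defect; that is the improved root. On a
joint eigenspace the repair needs only the eigenvalue (`pos_mem_jointSpace`, `neg_mem_jointSpace`),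
so the span of the joint eigenvectors is invariant under all generators and irreducibility makes it
everything (`isSpectral_of_mem`).

The spectrum comes from positivity. No $(p\cdot p)_l$ can annihilate the given eigenvector, since
the zero would propagate up to $(p\cdot p)_n$ (`dot_succ_eq_zero`). Repeated lowering by $p^{-l}$
would produce a negative norm unless it stops, which forces the ratio of the eigenvalues of $(p\cdot
p)_{l-1}$ and $(p\cdot p)_l$ to be $q^2,q^4,\dots$ (`exists_ratio`). All shifts of eigenvalues are
even powers of $q$, so $M$, the sign of $p_0$ and the $\lambda_i$ are the same for the whole
representation.

For the basis, $p^l$ is a positive number times an isometry `step l` on each joint eigenspace. The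
$q$ in $p^lp^{l'}=q\,p^{l'}p^l$ is absorbed by these numbers, so the isometries commute
(`commute_step`). Hence products of isometries carry a ground space, with $\pi_h=\dots=\pi_{n-1}=0$,
unambiguously onto every joint eigenspace above it (`transport`). Orthonormal bases chosen in the
ground spaces are transported, and momenta then act on the kets by the stated coefficients
(`transport_step`, `ket_step`).

In a finite-dimensional joint eigenspace the product of the two improved roots has an eigenvector.
The ladder through it must end in both directions, which makes $\lambda_u/\lambda_{u+1}$ an even
power of $q$ (`ladder_quantization`), and two numbers in $(q^2,1]$ with such a ratio are equal
(`lam_eq_succ`). -/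

noncomputable section

namespace QEuclid

/-! ### Powers of $q$, the numbers $\rho_i$, index bounds for simple roots. -/

section Arithmetic

lemma qp_ne_zero {q : ℝ} (hq : 0 < q) (x : ℝ) : qp q x ≠ 0 := by
  unfold qp; exact_mod_cast (Real.rpow_pos_of_pos hq x).ne'

lemma qp_zero (q : ℝ) : qp q 0 = 1 := by simp [qp]

lemma qp_add {q : ℝ} (hq : 0 < q) (x y : ℝ) : qp q (x + y) = qp q x * qp q y := by
  unfold qp; rw [Real.rpow_add hq]; push_cast; rfl

lemma qp_neg {q : ℝ} (hq : 0 < q) (x : ℝ) : qp q (-x) = (qp q x)⁻¹ := by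
  unfold qp; rw [Real.rpow_neg hq.le]; push_cast; rfl

lemma qp_one (q : ℝ) : qp q 1 = q := by simp [qp]

lemma qp_neg_one {q : ℝ} (hq : 0 < q) : qp q (-1) = (q : ℂ)⁻¹ := by
  rw [qp_neg hq, qp_one]

lemma qp_two_mul {q : ℝ} (hq : 0 < q) (x : ℝ) : qp q (2 * x) = qp q x ^ 2 := by
  rw [two_mul, qp_add hq, sq]

lemma qp_neg_two_mul {q : ℝ} (hq : 0 < q) (x : ℝ) : qp q (-2 * x) = (qp q x ^ 2)⁻¹ := by
  rw [show -2 * x = -(2 * x) by ring, qp_neg hq, qp_two_mul hq]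

lemma qp_two_mul_add_one {q : ℝ} (hq : 0 < q) (x : ℝ) : qp q (2 * x + 1) = qp q x ^ 2 * q := by
  rw [qp_add hq, qp_two_mul hq, qp_one]

lemma qp_two_mul_add_two {q : ℝ} (hq : 0 < q) (x : ℝ) :
    qp q (2 * x + 2) = qp q x ^ 2 * (q : ℂ) ^ 2 := by
  rw [show 2 * x + 2 = 2 * x + (1 + 1) by ring, qp_add hq, qp_two_mul hq, qp_add hq, qp_one, sq, sq]

lemma rho_neg (N : ℕ) (i : ℤ) : rho N (-i) = -rho N i := by
  unfold rho
  rw [Left.sign_neg]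
  push_cast
  ring

lemma rho_zero (N : ℕ) : rho N 0 = 0 := by simp [rho]

lemma rho_pred (N : ℕ) {l : ℤ} (hl : 2 ≤ l) : rho N (l - 1) = rho N l + 1 := by
  unfold rho
  rw [sign_pos (show (0 : ℤ) < l by omega), sign_pos (show (0 : ℤ) < l - 1 by omega)]
  push_cast
  ring

lemma qp_rho_neg {q : ℝ} (hq : 0 < q) (N : ℕ) (i : ℤ) :
    qp q (rho N (-i)) = (qp q (rho N i))⁻¹ := by
  rw [rho_neg, qp_neg hq]

lemma qp_rho_pred {q : ℝ} (hq : 0 < q) (N : ℕ) {l : ℤ} (hl : 2 ≤ l) :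
    qp q (rho N (l - 1)) = q * qp q (rho N l) := by
  rw [rho_pred N hl, qp_add hq, qp_one, mul_comm]

lemma qp_rho_one_even {N : ℕ} (hN : Even N) (q : ℝ) : qp q (rho N 1) = 1 := by
  rw [← qp_zero q]; congr 1; simp [rho, hN]

lemma qp_rho_one_odd {N : ℕ} (hN : ¬ Even N) {q : ℝ} (hq : 0 < q) :
    qp q (rho N 1) ^ 2 = (q : ℂ)⁻¹ := by
  rw [← qp_two_mul hq, ← qp_neg_one hq]; congr 1; simp [rho, hN]; norm_num

lemma hh_nonneg (N : ℕ) : 0 ≤ hh N := by unfold hh; split_ifs <;> simp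

lemma hh_le_one (N : ℕ) : hh N ≤ 1 := by unfold hh; split_ifs <;> simp

lemma hh_even {N : ℕ} (h : Even N) : hh N = 1 := by simp [hh, h]

lemma hh_odd {N : ℕ} (h : ¬ Even N) : hh N = 0 := by simp [hh, h]

lemma one_le_rk {N : ℕ} (hN : 3 ≤ N) : 1 ≤ rk N := by unfold rk; omega

lemma two_le_rk {N : ℕ} (hN : 3 ≤ N) (h : Even N) : 2 ≤ rk N := by
  obtain ⟨m, rfl⟩ := h; unfold rk; omega

lemma hh_le_rk {N : ℕ} (hN : 3 ≤ N) : hh N ≤ rk N := (hh_le_one N).trans (one_le_rk hN)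

lemma isSpaceIndex_pos {N : ℕ} {l : ℤ} (h1 : 1 ≤ l) (h2 : l ≤ rk N) : IsSpaceIndex N l :=
  ⟨by omega, h2, fun _ => by omega⟩

lemma IsSpaceIndex.neg {N : ℕ} {l : ℤ} (h : IsSpaceIndex N l) : IsSpaceIndex N (-l) := by
  obtain ⟨h1, h2, h3⟩ := h
  exact ⟨by omega, by omega, fun e => by have := h3 e; omega⟩

lemma isSpaceIndex_zero {N : ℕ} (h : ¬ Even N) : IsSpaceIndex N 0 :=
  ⟨by unfold rk; omega, by unfold rk; omega, fun e => absurd e h⟩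

/-- The lower end of a simple root is `0` or has absolute value `v - 1`. -/
lemma IsSimpleRoot.bounds {N : ℕ} (hN : 3 ≤ N) {u v : ℤ} (h : IsSimpleRoot N u v) :
    hh N < v ∧ 1 ≤ v ∧ v ≤ rk N ∧ |u| = v - 1 ∧ IsSpaceIndex N u ∧ (u = 0 → ¬ Even N ∧ v = 1) ∧
      (u ≠ 0 → 2 ≤ v) := by
  have h0 := hh_nonneg N
  rcases h with ⟨h1, h2, h3⟩ | ⟨h1, h2, h3⟩
  · refine ⟨by omega, by omega, by omega, ?_, ⟨by omega, by omega, ?_⟩, ?_, by omega⟩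
    · rw [abs_of_nonneg (by omega)]; omega
    · intro e; rw [hh_even e] at h1; omega
    · intro e; refine ⟨fun e' => ?_, by omega⟩
      rw [hh_even e'] at h1; omega
  · have := two_le_rk hN h1
    rw [hh_even h1]
    subst h2 h3
    refine ⟨by omega, by omega, by omega, by norm_num, ⟨by omega, by omega, by omega⟩, by omega,
      by omega⟩

end Arithmetic

section IccSums

lemma sum_Icc_one_step {R : Type*} [AddCommMonoid R] (f : ℤ → R) {l : ℤ} (hl : 1 ≤ l) :
    ∑ k ∈ Finset.Icc 1 l, f k = ∑ k ∈ Finset.Icc 1 (l - 1), f k + f l := by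
  have : Finset.Icc 1 l = insert l (Finset.Icc 1 (l - 1)) := by
    ext; simp only [Finset.mem_Icc, Finset.mem_insert]; omega
  rw [this, Finset.sum_insert (by simp), add_comm]

lemma sum_Icc_symm_step {R : Type*} [AddCommMonoid R] (f : ℤ → R) {l : ℤ} (hl : 1 ≤ l) :
    ∑ k ∈ Finset.Icc (-l) l, f k
      = ∑ k ∈ Finset.Icc (-(l - 1)) (l - 1), f k + (f l + f (-l)) := by
  have : Finset.Icc (-l) l = insert l (insert (-l) (Finset.Icc (-(l - 1)) (l - 1))) := by
    ext; simp only [Finset.mem_Icc, Finset.mem_insert]; omega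
  rw [this, Finset.sum_insert, Finset.sum_insert, ← add_assoc, add_comm]
  · simp
  · simp only [Finset.mem_Icc, Finset.mem_insert]; omega

end IccSums

/-! ### Calculus of $q$-commuting pairs. -/

section QCommutation

variable {R : Type*} [Ring R] [Algebra ℂ R]

/-- `A B = a B A`. -/
def QComm (a : ℂ) (A B : R) : Prop := A * B = a • (B * A)

lemma QComm.mul_right {a b : ℂ} {A B C : R} (h : QComm a A B) (h' : QComm b A C) :
    QComm (a * b) A (B * C) := by
  unfold QComm at *
  rw [← mul_assoc, h, smul_mul_assoc, mul_assoc, h', mul_smul_comm, smul_smul, mul_assoc]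

lemma QComm.mul_left {a b : ℂ} {A B C : R} (h : QComm a A C) (h' : QComm b B C) :
    QComm (a * b) (A * B) C := by
  unfold QComm at *
  rw [mul_assoc, h', mul_smul_comm, ← mul_assoc, h, smul_mul_assoc, smul_smul, mul_assoc,
    mul_comm a b]

lemma QComm.symm {a : ℂ} (ha : a ≠ 0) {A B : R} (h : QComm a A B) : QComm a⁻¹ B A := by
  unfold QComm at *
  rw [h, smul_smul, inv_mul_cancel₀ ha, one_smul]

lemma QComm.smul_left {a : ℂ} (c : ℂ) {A B : R} (h : QComm a A B) : QComm a (c • A) B := by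
  unfold QComm at *
  rw [smul_mul_assoc, h, mul_smul_comm, smul_comm]

lemma QComm.add_left {a : ℂ} {A B C : R} (h : QComm a A C) (h' : QComm a B C) :
    QComm a (A + B) C := by
  unfold QComm at *
  rw [add_mul, h, h', mul_add, smul_add]

lemma QComm.commute {a : ℂ} {A B : R} (h : QComm a A B) (ha : a = 1) : Commute A B := by
  subst ha; unfold QComm at h; rw [one_smul] at h; exact h

lemma QComm.congr {a b : ℂ} {A B : R} (h : QComm a A B) (ha : a = b) : QComm b A B := ha ▸ h

lemma QComm.of_commute {A B : R} (h : Commute A B) : QComm 1 A B := by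
  unfold QComm; rw [one_smul]; exact h

end QCommutation

/-! ### Momenta against the quadratic invariants. -/

section Relations

variable {D : Type*} [NormedAddCommGroup D] [InnerProductSpace ℂ D]
variable {N : ℕ} {q : ℝ} {g : Generators D}

lemma qcomm_eq_zero_iff {a : ℂ} {A B : Module.End ℂ D} : qcomm a A B = 0 ↔ QComm a A B := by
  unfold qcomm QComm; exact sub_eq_zero

lemma dot_step (g : Generators D) (N : ℕ) (q : ℝ) {l : ℤ} (hl : 1 ≤ l) :
    g.dot N q l = g.dot N q (l - 1) + qp q (rho N l) • (g.p (-l) * g.p l) := by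
  unfold Generators.dot
  rw [sum_Icc_one_step _ hl]
  simp only [Generators.lower, rho_neg, neg_neg, mul_smul_comm]
  abel

lemma dot_zero (g : Generators D) (N : ℕ) {q : ℝ} (hq : 0 < q) :
    g.dot N q 0 = (1 / (1 + (q : ℂ)⁻¹)) • (g.p 0 * g.p 0) := by
  unfold Generators.dot
  simp [Generators.lower, rho_zero, qp_zero, qp_neg_one hq]

lemma lower_zero (g : Generators D) (N : ℕ) (q : ℝ) : g.lower N q 0 = g.p 0 := by
  simp [Generators.lower, rho_zero, qp_zero]

lemma dot_zero_even (hrep : IsStarRep N q g) (hq : 0 < q) (hN : Even N) : g.dot N q 0 = 0 := by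
  rw [dot_zero g N hq, hrep.p_zero hN]; simp

/-- Subtracting the trace relation for $l-1$ from that for $l$ leaves $p^lp_l+p^{-l}p_{-l}$, and the
second term is $(p\cdot p)_l-(p\cdot p)_{l-1}$ by definition. The factor $q^{-2}$ comes from
$\rho_{l-1}=\rho_l+1$. -/
lemma p_mul_p_neg (hrep : IsStarRep N q g) (hq0 : 0 < q) {l : ℤ} (h1 : 1 ≤ l) (h2 : l ≤ rk N) :
    g.p l * g.p (-l)
      = (qp q (rho N l))⁻¹ • (g.dot N q l - ((q : ℂ) ^ 2)⁻¹ • g.dot N q (l - 1)) := by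
  have hqc : (q : ℂ) ≠ 0 := by exact_mod_cast hq0.ne'
  have hr := qp_ne_zero hq0 (rho N l)
  have T := hrep.p_trace l h1 h2
  rw [sum_Icc_symm_step _ h1] at T
  have hD := dot_step g N q h1
  have e1 : g.p l * g.lower N q l = (qp q (rho N l))⁻¹ • (g.p l * g.p (-l)) := by
    simp [Generators.lower, qp_neg hq0]
  have e2 : g.p (-l) * g.lower N q (-l) = g.dot N q l - g.dot N q (l - 1) := by
    rw [hD]; simp [Generators.lower, rho_neg]
  rw [e1, e2, qp_neg_two_mul hq0] at T
  -- At $l=1$ there is no trace relation for $l-1$. Its place is taken by $p^0p_0=(1+q^{-1})(p\cdot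
  -- p)_0$, and the parity of $N$ enters through $\rho_1$.
  rcases eq_or_lt_of_le h1 with rfl | h1'
  · have e3 : ∑ k ∈ Finset.Icc (-(1 - 1 : ℤ)) (1 - 1), g.p k * g.lower N q k
        = (1 + (q : ℂ)⁻¹) • g.dot N q 0 := by
      have hne : (1 + (q : ℂ)⁻¹) ≠ 0 := by
        have : (0 : ℝ) < 1 + q⁻¹ := by positivity
        exact_mod_cast this.ne'
      rw [dot_zero g N hq0, smul_smul]
      simp [lower_zero, hne]
    rw [e3] at T
    simp only [sub_self] at T ⊢
    by_cases hN : Even N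
    · rw [dot_zero_even hrep hq0 hN, qp_rho_one_even hN] at *
      simp only [smul_zero, sub_zero, one_pow, inv_one, zero_add, one_smul] at *
      have : g.p 1 * g.p (-1) = (1 + 1 : ℂ) • g.dot N q 1 - g.dot N q 1 := by rw [← T]; abel
      rw [this]; module
    · have hr2 := qp_rho_one_odd hN hq0
      rw [hr2] at T
      have hr3 : qp q (rho N 1) * qp q (rho N 1) = (q : ℂ)⁻¹ := by rw [← hr2, sq]
      have : (qp q (rho N 1))⁻¹ • (g.p 1 * g.p (-1)) = (q : ℂ) • g.dot N q 1
          - (q : ℂ)⁻¹ • g.dot N q 0 := by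
        simp only [inv_inv] at T
        linear_combination (norm := module) T
      have h4 := congrArg (fun X => qp q (rho N 1) • X) this
      simp only [smul_smul, mul_inv_cancel₀ hr, one_smul] at h4
      rw [h4, smul_sub, smul_sub, smul_smul, smul_smul, smul_smul]
      congr 2
      · field_simp
        linear_combination (q : ℂ) * hr3 + mul_inv_cancel₀ hqc
      · field_simp
        field_simp at hr3
        linear_combination hr3
  · have T' := hrep.p_trace (l - 1) (by omega) (by omega)
    rw [T', qp_neg_two_mul hq0, qp_rho_pred hq0 N h1'] at T
    have : (qp q (rho N l))⁻¹ • (g.p l * g.p (-l)) = (qp q (rho N l) ^ 2)⁻¹ • g.dot N q l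
          - ((q * qp q (rho N l)) ^ 2)⁻¹ • g.dot N q (l - 1) := by
      linear_combination (norm := module) T
    have h4 := congrArg (fun X => qp q (rho N l) • X) this
    simp only [smul_smul, mul_inv_cancel₀ hr, one_smul] at h4
    rw [h4, smul_sub, smul_sub, smul_smul, smul_smul, smul_smul]
    congr 2 <;> field_simp

lemma p_neg_mul_p (hq0 : 0 < q) {l : ℤ} (h1 : 1 ≤ l) :
    g.p (-l) * g.p l = (qp q (rho N l))⁻¹ • (g.dot N q l - g.dot N q (l - 1)) := by
  rw [dot_step g N q h1, add_sub_cancel_left, smul_smul, inv_mul_cancel₀ (qp_ne_zero hq0 _),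
    one_smul]

lemma commute_dot_of_le {X : Module.End ℂ D} {m₀ m : ℤ} (h0 : 0 ≤ m₀) (hm : m₀ ≤ m)
    (hbase : Commute X (g.dot N q m₀))
    (h : ∀ l, m₀ < l → l ≤ m → Commute X (g.p (-l) * g.p l)) : Commute X (g.dot N q m) := by
  induction m, hm using Int.leInduction with
  | base => exact hbase
  | succ k hk ih =>
    rw [dot_step g N q (by omega), add_sub_cancel_right]
    exact (ih fun l h1 h2 => h l h1 (by omega)).add_right
      ((h (k + 1) (by omega) le_rfl).smul_right _)

lemma commute_dot (hq : 0 < q) {X : Module.End ℂ D} {m : ℤ} (hm : 0 ≤ m)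
    (h0 : Commute X (g.p 0))
    (h : ∀ l, 1 ≤ l → l ≤ m → Commute X (g.p (-l) * g.p l)) : Commute X (g.dot N q m) := by
  refine commute_dot_of_le le_rfl hm ?_ fun l h1 h2 => h l (by omega) h2
  rw [dot_zero g N hq]
  exact (h0.mul_right h0).smul_right _

lemma p_swap (hrep : IsStarRep N q g) {i j : ℤ} (hi : IsSpaceIndex N i) (hj : IsSpaceIndex N j)
    (hij : i < j) (h : i ≠ -j) : QComm (q : ℂ) (g.p i) (g.p j) := hrep.p_p i j hi hj hij h

lemma p_swap' (hrep : IsStarRep N q g) (hq : 0 < q) {i j : ℤ} (hi : IsSpaceIndex N i)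
    (hj : IsSpaceIndex N j) (hij : i < j) (h : i ≠ -j) : QComm (q : ℂ)⁻¹ (g.p j) (g.p i) :=
  (p_swap hrep hi hj hij h).symm (by exact_mod_cast hq.ne')

/-- `q`-commutation with the quadratic invariant of the momenta of smaller index. -/
lemma dot_qcomm (hq : 0 < q) {a : ℂ} {X : Module.End ℂ D} {m : ℤ} (hm : 0 ≤ m)
    (h0 : QComm a (g.p 0 * g.p 0) X)
    (h : ∀ l, 1 ≤ l → l ≤ m → QComm a (g.p (-l) * g.p l) X) : QComm a (g.dot N q m) X := by
  induction m, hm using Int.leInduction with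
  | base => rw [dot_zero g N hq]; exact h0.smul_left _
  | succ k hk ih =>
    rw [dot_step g N q (by omega), add_sub_cancel_right]
    exact (ih fun l h1 h2 => h l h1 (by omega)).add_left
      ((h (k + 1) (by omega) le_rfl).smul_left _)

lemma p_zero_sq_qcomm (hrep : IsStarRep N q g) {a b : ℂ} {X : Module.End ℂ D}
    (h : ¬ Even N → QComm a (g.p 0) X) (hb : b = a * a) : QComm b (g.p 0 * g.p 0) X := by
  by_cases hN : Even N
  · rw [hrep.p_zero hN]; simp [QComm]
  · rw [hb]; exact (h hN).mul_left (h hN)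

lemma dot_p_of_lt (hrep : IsStarRep N q g) (hq : 0 < q) {m l : ℤ} (hm : 0 ≤ m) (hml : m < l)
    (hl : l ≤ rk N) : QComm ((q : ℂ) ^ 2) (g.dot N q m) (g.p l) := by
  have hl' := isSpaceIndex_pos (N := N) (l := l) (by omega) hl
  refine dot_qcomm hq hm (p_zero_sq_qcomm hrep (a := q) (fun hN => ?_) (sq _)) fun k h1 h2 => ?_
  · exact p_swap hrep (isSpaceIndex_zero hN) hl' (by omega) (by omega)
  · have hk := isSpaceIndex_pos (N := N) (l := k) h1 (by omega)
    rw [sq]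
    exact (p_swap hrep hk.neg hl' (by omega) (by omega)).mul_left
      (p_swap hrep hk hl' (by omega) (by omega))

lemma dot_p_neg_of_lt (hrep : IsStarRep N q g) (hq : 0 < q) {m l : ℤ} (hm : 0 ≤ m) (hml : m < l)
    (hl : l ≤ rk N) : QComm ((q : ℂ) ^ 2)⁻¹ (g.dot N q m) (g.p (-l)) := by
  have hl' := (isSpaceIndex_pos (N := N) (l := l) (by omega) hl).neg
  refine dot_qcomm hq hm (p_zero_sq_qcomm hrep (a := (q : ℂ)⁻¹) (fun hN => ?_)
    (by rw [sq, mul_inv])) fun k h1 h2 => ?_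
  · exact p_swap' hrep hq hl' (isSpaceIndex_zero hN) (by omega) (by omega)
  · have hk := isSpaceIndex_pos (N := N) (l := k) h1 (by omega)
    rw [sq, mul_inv]
    exact (p_swap' hrep hq hl' hk.neg (by omega) (by omega)).mul_left
      (p_swap' hrep hq hl' hk (by omega) (by omega))

/-- Since $-l<i<l$, passing $p^{-l}$ costs $q^{-1}$ and passing $p^l$ costs $q$. -/
lemma p_commute_pair (hrep : IsStarRep N q g) (hq : 0 < q) {i l : ℤ} (hi : IsSpaceIndex N i)
    (hil : |i| < l) (hl : l ≤ rk N) : Commute (g.p i) (g.p (-l) * g.p l) := by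
  obtain ⟨h1, h2⟩ := abs_lt.mp hil
  have hl' := isSpaceIndex_pos (N := N) (l := l) (by omega) hl
  exact ((p_swap' hrep hq hl'.neg hi (by omega) (by omega)).mul_right
    (p_swap hrep hi hl' (by omega) (by omega))).commute
    (inv_mul_cancel₀ (by exact_mod_cast hq.ne'))

/-- Associativity of $p^lp^{-l}p^l$, with either pair evaluated: the $q^{-2}$ in `p_mul_p_neg`
cancels the $q^2$ from moving $(p\cdot p)_{l-1}$ past $p^l$, so only the commutator with $(p\cdot
p)_l$ is left. The product $p^{-l}p^lp^{-l}$ serves in the same way. -/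
lemma p_commute_dot_self (hrep : IsStarRep N q g) (hq : 0 < q) {l : ℤ} (h1 : 1 ≤ l)
    (hl : l ≤ rk N) : Commute (g.p l) (g.dot N q l) ∧ Commute (g.p (-l)) (g.dot N q l) := by
  have hr := qp_ne_zero hq (rho N l)
  have hqc : (q : ℂ) ≠ 0 := by exact_mod_cast hq.ne'
  have A := p_mul_p_neg hrep hq h1 hl
  have B := p_neg_mul_p (g := g) (N := N) hq h1
  have C := dot_p_of_lt hrep hq (show 0 ≤ l - 1 by omega) (by omega) hl
  have C' := dot_p_neg_of_lt hrep hq (show 0 ≤ l - 1 by omega) (by omega) hl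
  unfold QComm at C C'
  constructor
  · have E : g.p l * (g.p (-l) * g.p l) = (g.p l * g.p (-l)) * g.p l := (mul_assoc _ _ _).symm
    rw [A, B, mul_smul_comm, smul_mul_assoc] at E
    have E := smul_right_injective _ (inv_ne_zero hr) E
    rw [mul_sub, sub_mul, smul_mul_assoc, C, smul_smul, inv_mul_cancel₀ (pow_ne_zero _ hqc),
      one_smul, sub_left_inj] at E
    exact E
  · have E : g.p (-l) * (g.p l * g.p (-l)) = (g.p (-l) * g.p l) * g.p (-l) :=
      (mul_assoc _ _ _).symm
    rw [A, B, mul_smul_comm, smul_mul_assoc] at E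
    have E := smul_right_injective _ (inv_ne_zero hr) E
    rw [mul_sub, sub_mul, mul_smul_comm, C', sub_left_inj] at E
    exact E

lemma p_commute_dot (hrep : IsStarRep N q g) (hq : 0 < q) {i m : ℤ} (hi : IsSpaceIndex N i)
    (him : |i| ≤ m) (hm : m ≤ rk N) : Commute (g.p i) (g.dot N q m) := by
  refine commute_dot_of_le (abs_nonneg i) him ?_
    fun l h1 h2 => p_commute_pair hrep hq hi h1 (by omega)
  rcases lt_trichotomy i 0 with h | rfl | h
  · rw [abs_of_neg h] at him ⊢
    have := (p_commute_dot_self hrep hq (l := -i) (by omega) (by omega)).2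
    rwa [neg_neg] at this
  · rw [abs_zero, dot_zero g N hq]
    exact ((Commute.refl _).mul_right (Commute.refl _)).smul_right _
  · rw [abs_of_pos h] at him ⊢
    exact (p_commute_dot_self hrep hq (l := i) (by omega) (by omega)).1

lemma k_qcomm_p (hrep : IsStarRep N q g) {i l : ℤ} (h1 : 1 ≤ i) (h2 : i ≤ rk N)
    (hl : IsSpaceIndex N l) :
    QComm ((q : ℂ) ^ (2 * (kd l i - kd l (-i)))) (g.k i) (g.p l) :=
  qcomm_eq_zero_iff.mp (hrep.k_p i l h1 h2 hl)

lemma lam_qcomm_dot (hrep : IsStarRep N q g) (hq : 0 < q) {m : ℤ}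
    (h0 : 0 ≤ m) (hm : m ≤ rk N) : QComm ((q : ℂ) ^ 2) (g.dot N q m) g.Lam := by
  have hqc : (q : ℂ) ≠ 0 := by exact_mod_cast hq.ne'
  have key : ∀ i, IsSpaceIndex N i → QComm (q : ℂ) (g.p i) g.Lam := fun i hi => by
    simpa using (qcomm_eq_zero_iff.mp (hrep.lam_p i hi)).symm (inv_ne_zero hqc)
  refine dot_qcomm hq h0 (p_zero_sq_qcomm hrep (a := q)
    (fun hN => key 0 (isSpaceIndex_zero hN)) (sq _)) fun l h1 h2 => ?_
  have hl := isSpaceIndex_pos (N := N) h1 (by omega)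
  rw [sq]
  exact (key _ hl.neg).mul_left (key _ hl)

end Relations

/-! ### Simple roots against the momenta and the quadratic invariants. -/

section Roots

variable {D : Type*} [NormedAddCommGroup D] [InnerProductSpace ℂ D]
variable {N : ℕ} {q : ℝ} {g : Generators D} {u v : ℤ}

lemma pos_qcomm (hrep : IsStarRep N q g) (h : IsSimpleRoot N u v) {i : ℤ} (hi : IsSpaceIndex N i)
    (h1 : i ≠ u) (h2 : i ≠ -v) : QComm ((q : ℂ) ^ bexp u v i) (g.L (-u) v) (g.p i) :=
  qcomm_eq_zero_iff.mp (hrep.pos_p u v i h hi h1 h2)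

lemma neg_qcomm (hrep : IsStarRep N q g) (h : IsSimpleRoot N u v) {i : ℤ} (hi : IsSpaceIndex N i)
    (h1 : i ≠ v) (h2 : i ≠ -u) : QComm ((q : ℂ) ^ bexp u v i) (g.L (-v) u) (g.p i) :=
  qcomm_eq_zero_iff.mp (hrep.neg_p u v i h hi h1 h2)

lemma bexp_eq_zero {i : ℤ} (h1 : i ≠ u) (h2 : i ≠ -u) (h3 : i ≠ v) (h4 : i ≠ -v) :
    bexp u v i = 0 := by simp [bexp, kd, h1, h2, h3, h4]

/-- Both roots commute with the momenta of index different from `±u`, `±v`. -/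
lemma roots_commute_p (hrep : IsStarRep N q g) (h : IsSimpleRoot N u v) {i : ℤ}
    (hi : IsSpaceIndex N i) (h1 : i ≠ u) (h2 : i ≠ -u) (h3 : i ≠ v) (h4 : i ≠ -v) :
    Commute (g.L (-u) v) (g.p i) ∧ Commute (g.L (-v) u) (g.p i) :=
  ⟨(pos_qcomm hrep h hi h1 h4).commute (by rw [bexp_eq_zero h1 h2 h3 h4, zpow_zero]),
    (neg_qcomm hrep h hi h3 h2).commute (by rw [bexp_eq_zero h1 h2 h3 h4, zpow_zero])⟩

lemma roots_commute_p_zero (hN : 3 ≤ N) (hrep : IsStarRep N q g) (h : IsSimpleRoot N u v)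
    (hu : u ≠ 0) : Commute (g.L (-u) v) (g.p 0) ∧ Commute (g.L (-v) u) (g.p 0) := by
  by_cases he : Even N
  · rw [hrep.p_zero he]; exact ⟨Commute.zero_right _, Commute.zero_right _⟩
  · obtain ⟨-, hv, -⟩ := h.bounds hN
    exact roots_commute_p hrep h (isSpaceIndex_zero he) hu.symm (by omega) (by omega) (by omega)

lemma roots_commute_dot_of_lt (hN : 3 ≤ N) (hrep : IsStarRep N q g) (hq : 0 < q)
    (h : IsSimpleRoot N u v) {m : ℤ} (hm : 0 ≤ m) (hmv : m < v - 1) :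
    Commute (g.L (-u) v) (g.dot N q m) ∧ Commute (g.L (-v) u) (g.dot N q m) := by
  obtain ⟨-, hv, hv2, hu, -, -, -⟩ := h.bounds hN
  have hu0 : u ≠ 0 := by rintro rfl; simp at hu; omega
  have hu' : u = v - 1 ∨ u = -(v - 1) := (abs_eq (by omega)).mp hu
  have hc : ∀ l, 1 ≤ l → l ≤ m →
      (Commute (g.L (-u) v) (g.p l) ∧ Commute (g.L (-v) u) (g.p l)) ∧
      (Commute (g.L (-u) v) (g.p (-l)) ∧ Commute (g.L (-v) u) (g.p (-l))) := fun l h1 h2 => by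
    have hl := isSpaceIndex_pos (N := N) h1 (by omega)
    constructor
    · apply roots_commute_p hrep h hl <;> omega
    · apply roots_commute_p hrep h hl.neg <;> omega
  obtain ⟨z1, z2⟩ := roots_commute_p_zero hN hrep h hu0
  exact ⟨commute_dot hq hm z1 fun l h1 h2 => (hc l h1 h2).2.1.mul_right (hc l h1 h2).1.1,
    commute_dot hq hm z2 fun l h1 h2 => (hc l h1 h2).2.2.mul_right (hc l h1 h2).1.2⟩

lemma IsSimpleRoot.eq_or (hN : 3 ≤ N) (h : IsSimpleRoot N u v) : u = v - 1 ∨ u = -(v - 1) := by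
  obtain ⟨-, hv, -, hu, -⟩ := h.bounds hN
  exact (abs_eq (by omega)).mp hu

lemma QComm.apply {a : ℂ} {A B : Module.End ℂ D} (h : QComm a A B) (x : D) :
    A (B x) = a • B (A x) := LinearMap.congr_fun h x

lemma qcomm_apply_eq {a : ℂ} {A B C : Module.End ℂ D} (h : qcomm a A B = C) (x : D) :
    A (B x) = a • B (A x) + C x := by
  rw [← h]; simp [qcomm]

lemma pos_p_v_apply (hrep : IsStarRep N q g) (h : IsSimpleRoot N u v) (x : D) :
    g.L (-u) v (g.p (-v) x)
      = (q : ℂ) • g.p (-v) (g.L (-u) v x) + qp q (rho N v) • g.p (-u) x :=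
  qcomm_apply_eq (hrep.pos_p_v u v h) x

lemma neg_p_v_apply (hrep : IsStarRep N q g) (h : IsSimpleRoot N u v) (x : D) :
    g.L (-v) u (g.p v x)
      = (q : ℂ)⁻¹ • g.p v (g.L (-v) u x) - qp q (rho N v) • g.p u x := by
  rw [qcomm_apply_eq (hrep.neg_p_v u v h) x, sub_eq_add_neg]; rfl

lemma pos_p_u_apply (hrep : IsStarRep N q g) (h : IsSimpleRoot N u v) (hu : u ≠ 0) (x : D) :
    g.L (-u) v (g.p u x)
      = (q : ℂ) • g.p u (g.L (-u) v x) - qp q (rho N v) • g.p v x := by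
  rw [qcomm_apply_eq (hrep.pos_p_u u v h hu) x, sub_eq_add_neg]; rfl

lemma neg_p_u_apply (hrep : IsStarRep N q g) (h : IsSimpleRoot N u v) (hu : u ≠ 0) (x : D) :
    g.L (-v) u (g.p (-u) x)
      = (q : ℂ)⁻¹ • g.p (-u) (g.L (-v) u x) + qp q (rho N v) • g.p (-v) x :=
  qcomm_apply_eq (hrep.neg_p_u u v h hu) x

lemma pos_p_pos_apply (hN : 3 ≤ N) (hrep : IsStarRep N q g) (h : IsSimpleRoot N u v) (x : D) :
    g.L (-u) v (g.p v x) = (q : ℂ)⁻¹ • g.p v (g.L (-u) v x) := by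
  obtain ⟨-, hv, hv2, -⟩ := h.bounds hN
  have hu := h.eq_or hN
  have := (pos_qcomm hrep h (isSpaceIndex_pos hv hv2) (by omega) (by omega)).apply x
  rwa [show bexp u v v = -1 by
    simp [bexp, kd, show v ≠ u by omega, show v ≠ -u by omega, show v ≠ -v by omega],
    zpow_neg_one] at this

lemma neg_p_neg_apply (hN : 3 ≤ N) (hrep : IsStarRep N q g) (h : IsSimpleRoot N u v) (x : D) :
    g.L (-v) u (g.p (-v) x) = (q : ℂ) • g.p (-v) (g.L (-v) u x) := by
  obtain ⟨-, hv, hv2, -⟩ := h.bounds hN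
  have hu := h.eq_or hN
  have := (neg_qcomm hrep h (isSpaceIndex_pos hv hv2).neg (by omega) (by omega)).apply x
  rwa [show bexp u v (-v) = 1 by
    simp [bexp, kd, show -v ≠ u by omega, show v ≠ u by omega, show -v ≠ v by omega],
    zpow_one] at this

lemma pos_p_neg_u_apply (hN : 3 ≤ N) (hrep : IsStarRep N q g) (h : IsSimpleRoot N u v)
    (h0 : u ≠ 0) (x : D) :
    g.L (-u) v (g.p (-u) x) = (q : ℂ)⁻¹ • g.p (-u) (g.L (-u) v x) := by
  obtain ⟨-, hv, hv2, -, hs, -⟩ := h.bounds hN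
  have hu := h.eq_or hN
  have := (pos_qcomm hrep h hs.neg (by omega) (by omega)).apply x
  rwa [show bexp u v (-u) = -1 by
    simp [bexp, kd, show -u ≠ u by omega, show -u ≠ v by omega, show u ≠ v by omega],
    zpow_neg_one] at this

lemma neg_p_pos_u_apply (hN : 3 ≤ N) (hrep : IsStarRep N q g) (h : IsSimpleRoot N u v)
    (h0 : u ≠ 0) (x : D) :
    g.L (-v) u (g.p u x) = (q : ℂ) • g.p u (g.L (-v) u x) := by
  obtain ⟨-, hv, hv2, -, hs, -⟩ := h.bounds hN
  have hu := h.eq_or hN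
  have := (neg_qcomm hrep h hs (by omega) (by omega)).apply x
  rwa [show bexp u v u = 1 by
    simp [bexp, kd, show u ≠ -u by omega, show u ≠ v by omega, show u ≠ -v by omega],
    zpow_one] at this

/-- The quadratic invariant below the upper end of a simple root, for nonzero lower end. -/
lemma dot_step_root (hN : 3 ≤ N) (hrep : IsStarRep N q g) (hq : 0 < q) (h : IsSimpleRoot N u v)
    (hu : u ≠ 0) : g.dot N q (v - 1)
      = g.dot N q (v - 2) + ((q : ℂ) * qp q (rho N v)) • (g.p (-u) * g.p u) := by
  obtain ⟨-, hv, hv2, -, hs, -, h2⟩ := h.bounds hN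
  have h2 := h2 hu
  rw [dot_step g N q (show 1 ≤ v - 1 by omega), show v - 1 - 1 = v - 2 by ring,
    qp_rho_pred hq N h2]
  rcases h with ⟨h1, h3, h4⟩ | ⟨h1, rfl, rfl⟩
  · rw [show v - 1 = u by omega]
  -- For the root $(-1,2)$ the order of the two momenta is reversed. This is harmless because
  -- $(p\cdot p)_0=0$ makes $p^1$ and $p^{-1}$ commute.
  · have A := p_mul_p_neg hrep hq (l := 1) le_rfl (by omega)
    have B := p_neg_mul_p (g := g) (N := N) hq (l := 1) le_rfl
    rw [show (1 : ℤ) - 1 = 0 by norm_num, dot_zero_even hrep hq h1, smul_zero] at A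
    rw [show (1 : ℤ) - 1 = 0 by norm_num, dot_zero_even hrep hq h1] at B
    norm_num
    rw [A, B]

lemma p_mul_p_zero (hrep : IsStarRep N q g) (hN : ¬ Even N) {l : ℤ} (h1 : 1 ≤ l) (h2 : l ≤ rk N)
    (x : D) : g.p 0 (g.p l x) = (q : ℂ) • g.p l (g.p 0 x) ∧
      g.p (-l) (g.p 0 x) = (q : ℂ) • g.p 0 (g.p (-l) x) :=
  ⟨(p_swap hrep (isSpaceIndex_zero hN) (isSpaceIndex_pos h1 h2) (by omega) (by omega)).apply x,
   (p_swap hrep (isSpaceIndex_pos h1 h2).neg (isSpaceIndex_zero hN) (by omega) (by omega)).apply x⟩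

lemma one_add_inv_ne_zero (hq : 0 < q) : (1 + (q : ℂ)⁻¹) ≠ 0 := by
  have : (0 : ℝ) < 1 + q⁻¹ := by positivity
  exact_mod_cast this.ne'

/-- The one invariant that the root does not commute with. For $u\ne0$ the defect arises from the
term $p^{-u}p^u$ of $(p\cdot p)_{v-1}$, in which the root turns $p^u$ into $p^v$; for $u=0$ it
arises from $(p^0)^2$. -/
lemma pos_dot_pred_apply (hN : 3 ≤ N) (hrep : IsStarRep N q g) (hq : 0 < q)
    (h : IsSimpleRoot N u v) (x : D) :
    g.L (-u) v (g.dot N q (v - 1) x) = g.dot N q (v - 1) (g.L (-u) v x)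
      - qp q (rho N v) ^ 2 • g.p (-u) (g.p v x) := by
  obtain ⟨-, hv, hv2, -, hs, h0, h2⟩ := h.bounds hN
  have hqc : (q : ℂ) ≠ 0 := by exact_mod_cast hq.ne'
  by_cases hu : u = 0
  · obtain ⟨hodd, rfl⟩ := h0 hu
    subst hu
    have hq1 : (1 + (q : ℂ)) ≠ 0 := by
      have : (0 : ℝ) < 1 + q := by positivity
      exact_mod_cast this.ne'
    have hq2 : 1 + (q : ℂ)⁻¹ = (1 + (q : ℂ)) / q := by field_simp; ring
    have e1 := p_mul_p_zero hrep hodd le_rfl hv2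
    have e2 : ∀ x, g.L 0 1 (g.p 0 x) = g.p 0 (g.L 0 1 x) - (q : ℂ)⁻¹ • g.p 1 x := fun x => by
      rw [qcomm_apply_eq (hrep.pos_p_zero hodd) x, sub_eq_add_neg, one_smul]; rfl
    have e3 : g.p 1 (g.p 0 x) = (q : ℂ)⁻¹ • g.p 0 (g.p 1 x) := by
      rw [(e1 x).1, smul_smul, inv_mul_cancel₀ hqc, one_smul]
    rw [qp_rho_one_odd hodd hq, sub_self, dot_zero g N hq, neg_zero, hq2]
    simp only [LinearMap.smul_apply, Module.End.mul_apply, map_smul, e2, map_sub, e3]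
    match_scalars <;> field_simp
    ring
  · have e := roots_commute_dot_of_lt hN hrep hq h (m := v - 2) (by have := h2 hu; omega) (by omega)
    have e1 := fun x => LinearMap.congr_fun e.1 x
    simp only [Module.End.mul_apply] at e1
    rw [dot_step_root hN hrep hq h hu]
    simp only [LinearMap.add_apply, LinearMap.smul_apply, Module.End.mul_apply, map_add, map_smul,
      e1, pos_p_neg_u_apply hN hrep h hu, pos_p_u_apply hrep h hu, map_sub]
    match_scalars <;> field_simp

lemma neg_dot_pred_apply (hN : 3 ≤ N) (hrep : IsStarRep N q g) (hq : 0 < q)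
    (h : IsSimpleRoot N u v) (x : D) :
    g.L (-v) u (g.dot N q (v - 1) x) = g.dot N q (v - 1) (g.L (-v) u x)
      + (qp q (rho N v) ^ 2 * q) • g.p (-v) (g.p u x) := by
  obtain ⟨-, hv, hv2, -, hs, h0, h2⟩ := h.bounds hN
  have hqc : (q : ℂ) ≠ 0 := by exact_mod_cast hq.ne'
  by_cases hu : u = 0
  · obtain ⟨hodd, rfl⟩ := h0 hu
    subst hu
    have hq1 : (1 + (q : ℂ)) ≠ 0 := by
      have : (0 : ℝ) < 1 + q := by positivity
      exact_mod_cast this.ne'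
    have hq2 : 1 + (q : ℂ)⁻¹ = (1 + (q : ℂ)) / q := by field_simp; ring
    have e1 := p_mul_p_zero hrep hodd le_rfl hv2
    have e2 : ∀ x, g.L (-1) 0 (g.p 0 x) = g.p 0 (g.L (-1) 0 x) + g.p (-1) x := fun x => by
      rw [qcomm_apply_eq (hrep.neg_p_zero hodd) x, one_smul]
    have e3 : g.p 0 (g.p (-1) x) = (q : ℂ)⁻¹ • g.p (-1) (g.p 0 x) := by
      rw [(e1 x).2, smul_smul, inv_mul_cancel₀ hqc, one_smul]
    rw [qp_rho_one_odd hodd hq, sub_self, dot_zero g N hq, hq2]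
    simp only [LinearMap.smul_apply, Module.End.mul_apply, map_smul, e2, map_add, e3]
    match_scalars <;> field_simp
  · have e := roots_commute_dot_of_lt hN hrep hq h (m := v - 2) (by have := h2 hu; omega) (by omega)
    have e1 := fun x => LinearMap.congr_fun e.2 x
    simp only [Module.End.mul_apply] at e1
    rw [dot_step_root hN hrep hq h hu]
    simp only [LinearMap.add_apply, LinearMap.smul_apply, Module.End.mul_apply, map_add, map_smul,
      e1, neg_p_u_apply hrep h hu, neg_p_pos_u_apply hN hrep h hu]
    match_scalars <;> field_simp

/-- In $(p\cdot p)_v=(p\cdot p)_{v-1}+q^{\rho_v}p^{-v}p^v$ the defects of the two summands cancel,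
and the higher summands commute with the roots factor by factor. -/
lemma roots_commute_dot_of_ge (hN : 3 ≤ N) (hrep : IsStarRep N q g) (hq : 0 < q)
    (h : IsSimpleRoot N u v) {m : ℤ} (hvm : v ≤ m) (hm : m ≤ rk N) :
    Commute (g.L (-u) v) (g.dot N q m) ∧ Commute (g.L (-v) u) (g.dot N q m) := by
  obtain ⟨-, hv, hv2, -, hs, h0, h2⟩ := h.bounds hN
  have hqc : (q : ℂ) ≠ 0 := by exact_mod_cast hq.ne'
  have hu := h.eq_or hN
  have hc : ∀ l, v < l → l ≤ m →
      (Commute (g.L (-u) v) (g.p l) ∧ Commute (g.L (-v) u) (g.p l)) ∧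
      (Commute (g.L (-u) v) (g.p (-l)) ∧ Commute (g.L (-v) u) (g.p (-l))) := fun l h1 h2 => by
    have hl := isSpaceIndex_pos (N := N) (l := l) (by omega) (by omega)
    constructor
    · apply roots_commute_p hrep h hl <;> omega
    · apply roots_commute_p hrep h hl.neg <;> omega
  constructor
  · refine commute_dot_of_le (by omega) hvm ?_
      fun l h1 h2 => (hc l h1 h2).2.1.mul_right (hc l h1 h2).1.1
    ext x
    rw [dot_step g N q hv]
    simp only [LinearMap.add_apply, LinearMap.smul_apply, Module.End.mul_apply, map_add, map_smul,
      pos_dot_pred_apply hN hrep hq h, pos_p_v_apply hrep h, pos_p_pos_apply hN hrep h]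
    match_scalars <;> field_simp
    ring
  · refine commute_dot_of_le (by omega) hvm ?_
      fun l h1 h2 => (hc l h1 h2).2.2.mul_right (hc l h1 h2).1.2
    ext x
    rw [dot_step g N q hv]
    simp only [LinearMap.add_apply, LinearMap.smul_apply, Module.End.mul_apply, map_add, map_smul,
      neg_dot_pred_apply hN hrep hq h, neg_p_neg_apply hN hrep h, neg_p_v_apply hrep h, map_sub]
    match_scalars <;> field_simp
    ring

lemma roots_commute_dot (hN : 3 ≤ N) (hrep : IsStarRep N q g) (hq : 0 < q)
    (h : IsSimpleRoot N u v) {m : ℤ} (hm0 : 0 ≤ m) (hm : m ≤ rk N) (hmv : m ≠ v - 1) :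
    Commute (g.L (-u) v) (g.dot N q m) ∧ Commute (g.L (-v) u) (g.dot N q m) := by
  rcases lt_or_ge m (v - 1) with h1 | h1
  · exact roots_commute_dot_of_lt hN hrep hq h hm0 h1
  · exact roots_commute_dot_of_ge hN hrep hq h (by omega) hm

lemma k_qcomm_pos (hrep : IsStarRep N q g) (h : IsSimpleRoot N u v) {i : ℤ} (h1 : 1 ≤ i)
    (h2 : i ≤ rk N) : QComm ((q : ℂ) ^ (2 * (kd i v - kd i u + kd i (-u)))) (g.k i) (g.L (-u) v) :=
  qcomm_eq_zero_iff.mp (hrep.k_pos i u v h1 h2 h)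

lemma k_qcomm_neg (hrep : IsStarRep N q g) (h : IsSimpleRoot N u v) {i : ℤ} (h1 : 1 ≤ i)
    (h2 : i ≤ rk N) :
    QComm ((q : ℂ) ^ (-(2 * (kd i v - kd i u + kd i (-u))))) (g.k i) (g.L (-v) u) :=
  qcomm_eq_zero_iff.mp (hrep.k_neg i u v h1 h2 h)

end Roots

/-! ### Adjoints, norms and positivity. -/

section Star

variable {D : Type*} [NormedAddCommGroup D] [InnerProductSpace ℂ D]
variable {N : ℕ} {q : ℝ} {g : Generators D}

lemma conj_qp (q x : ℝ) : (starRingEnd ℂ) (qp q x) = qp q x := by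
  unfold qp; exact Complex.conj_ofReal _

lemma inner_p_left (hrep : IsStarRep N q g) {i : ℤ} (hi : IsSpaceIndex N i) (x y : D) :
    inner ℂ (g.p i x) y = qp q (rho N i) * inner ℂ x (g.p (-i) y) := by
  rw [hrep.star_p i hi x y, LinearMap.smul_apply, inner_smul_right]

lemma inner_p_right (hrep : IsStarRep N q g) {i : ℤ} (hi : IsSpaceIndex N i) (x y : D) :
    inner ℂ x (g.p i y) = qp q (rho N i) * inner ℂ (g.p (-i) x) y := by
  rw [← inner_conj_symm, inner_p_left hrep hi, map_mul, conj_qp, inner_conj_symm]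

lemma inner_p_p (hrep : IsStarRep N q g) (hq : 0 < q) {l : ℤ} (h1 : 1 ≤ l) (h2 : l ≤ rk N)
    (x y : D) : inner ℂ (g.p l x) (g.p l y) = inner ℂ x ((g.dot N q l - g.dot N q (l - 1)) y) := by
  rw [inner_p_left hrep (isSpaceIndex_pos h1 h2), ← Module.End.mul_apply, p_neg_mul_p hq h1,
    LinearMap.smul_apply, inner_smul_right, ← mul_assoc, mul_inv_cancel₀ (qp_ne_zero hq _), one_mul]

lemma inner_p_neg_p_neg (hrep : IsStarRep N q g) (hq : 0 < q) {l : ℤ} (h1 : 1 ≤ l)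
    (h2 : l ≤ rk N) (x y : D) : inner ℂ (g.p (-l) x) (g.p (-l) y)
      = (qp q (rho N l) ^ 2)⁻¹ *
        inner ℂ x ((g.dot N q l - ((q : ℂ) ^ 2)⁻¹ • g.dot N q (l - 1)) y) := by
  rw [inner_p_left hrep (isSpaceIndex_pos h1 h2).neg, neg_neg, ← Module.End.mul_apply,
    p_mul_p_neg hrep hq h1 h2, LinearMap.smul_apply, inner_smul_right, ← mul_assoc,
    qp_rho_neg hq, sq (qp q _), mul_inv]

lemma inner_p_zero (hrep : IsStarRep N q g) (x y : D) :
    inner ℂ (g.p 0 x) y = inner ℂ x (g.p 0 y) := by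
  by_cases hN : Even N
  · simp [hrep.p_zero hN]
  · rw [inner_p_left hrep (isSpaceIndex_zero hN), rho_zero, qp_zero, one_mul, neg_zero]

lemma inner_dot_zero (hq : 0 < q) (hrep : IsStarRep N q g) (x y : D) :
    inner ℂ x (g.dot N q 0 y) = (1 / (1 + (q : ℂ)⁻¹)) * inner ℂ (g.p 0 x) (g.p 0 y) := by
  rw [dot_zero g N hq, LinearMap.smul_apply, inner_smul_right, Module.End.mul_apply,
    ← inner_p_zero hrep]

lemma inner_dot (hrep : IsStarRep N q g) (hq : 0 < q) {m : ℤ} (hm0 : 0 ≤ m) (hm : m ≤ rk N)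
    (x y : D) : inner ℂ (g.dot N q m x) y = inner ℂ x (g.dot N q m y) := by
  induction m, hm0 using Int.leInduction with
  | base =>
    rw [inner_dot_zero hq hrep, dot_zero g N hq, LinearMap.smul_apply, inner_smul_left,
      Module.End.mul_apply, inner_p_zero hrep]
    congr 1
    simp
  | succ k hk ih =>
    have h := isSpaceIndex_pos (N := N) (l := k + 1) (by omega) hm
    have ih := ih (by omega)
    rw [dot_step g N q (by omega), add_sub_cancel_right]
    simp only [LinearMap.add_apply, LinearMap.smul_apply, Module.End.mul_apply, inner_add_left,
      inner_add_right, inner_smul_left, inner_smul_right, ih, conj_qp]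
    congr 2
    rw [inner_p_left hrep h.neg, neg_neg, inner_p_right hrep h.neg, neg_neg]

/-- The quadratic invariants are positive. -/
lemma dot_nonneg (hrep : IsStarRep N q g) (hq : 0 < q) {m : ℤ} (hm0 : 0 ≤ m) (hm : m ≤ rk N)
    (x : D) : 0 ≤ RCLike.re (inner ℂ x (g.dot N q m x)) := by
  induction m, hm0 using Int.leInduction with
  | base =>
    rw [inner_dot_zero hq hrep, inner_self_eq_norm_sq_to_K]
    have : (1 / (1 + (q : ℂ)⁻¹)) * ((‖g.p 0 x‖ : ℂ)) ^ 2
      = ((1 / (1 + q⁻¹) * ‖g.p 0 x‖ ^ 2 : ℝ) : ℂ) := by push_cast; rfl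
    erw [this]
    rw [RCLike.re_to_complex, Complex.ofReal_re]
    positivity
  | succ k hk ih =>
    have e := inner_p_p hrep hq (l := k + 1) (by omega) hm x x
    rw [add_sub_cancel_right, LinearMap.sub_apply, inner_sub_right] at e
    rw [← sub_add_cancel (inner ℂ x (g.dot N q (k + 1) x)) (inner ℂ x (g.dot N q k x)), ← e,
      map_add]
    exact add_nonneg inner_self_nonneg (ih (by omega))

end Star

/-! ### Eigenvalues and how they change with the labels. -/

/-- The constants that label an irreducible representation: the momentum scale `M`, the sign `ε` of
`p_0`, and the offsets `lam i` in the spectra of the `𝐤^i`. -/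
structure SpectralData where
  M : ℝ
  ε : ℝ
  lam : ℤ → ℝ

/-- The eigenvalue of `(p·p)_l`. -/
def dotVal (N : ℕ) (q : ℝ) (c : SpectralData) (π : ℤ → ℤ) (l : ℤ) : ℂ :=
  ((c.M ^ 2 * q ^ (2 * expSum N π l) : ℝ) : ℂ)

/-- The eigenvalue of `𝐤^i`. -/
def kVal (q : ℝ) (c : SpectralData) (j : ℤ → ℤ) (i : ℤ) : ℂ :=
  ((c.lam i * q ^ (2 * j i) : ℝ) : ℂ)

/-- The eigenvalue of `p_0`, for odd `N`. -/
def pVal (N : ℕ) (q : ℝ) (c : SpectralData) (π : ℤ → ℤ) : ℂ :=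
  ((c.ε * c.M * √(1 + q⁻¹) * q ^ expSum N π 0 : ℝ) : ℂ)

section Shifts

variable {N : ℕ} {q : ℝ} {c : SpectralData} {π π' j j' : ℤ → ℤ}

lemma dotVal_shift (hq : 0 < q) {m t : ℤ} (h : expSum N π' m = expSum N π m + t) :
    dotVal N q c π' m = (q : ℂ) ^ (2 * t) * dotVal N q c π m := by
  have hqc : (q : ℂ) ≠ 0 := by exact_mod_cast hq.ne'
  unfold dotVal
  rw [h, mul_add]
  push_cast
  rw [zpow_add₀ hqc]
  ring

lemma kVal_shift (hq : 0 < q) {i t : ℤ} (h : j' i = j i + t) :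
    kVal q c j' i = (q : ℂ) ^ (2 * t) * kVal q c j i := by
  have hqc : (q : ℂ) ≠ 0 := by exact_mod_cast hq.ne'
  unfold kVal
  rw [h, mul_add]
  push_cast
  rw [zpow_add₀ hqc]
  ring

lemma pVal_shift (hq : 0 < q) {t : ℤ} (h : expSum N π' 0 = expSum N π 0 + t) :
    pVal N q c π' = (q : ℂ) ^ t * pVal N q c π := by
  have hqc : (q : ℂ) ≠ 0 := by exact_mod_cast hq.ne'
  unfold pVal
  rw [h]
  push_cast
  rw [zpow_add₀ hqc]
  ring

lemma expSum_add (N : ℕ) (π δ : ℤ → ℤ) (m : ℤ) :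
    expSum N (π + δ) m = expSum N π m + ∑ k ∈ Finset.Icc m (rk N), δ k := by
  unfold expSum
  rw [← Finset.sum_add_distrib]
  exact Finset.sum_congr rfl fun k _ => by simp [add_assoc]

lemma expSum_step (N : ℕ) (π : ℤ → ℤ) {m : ℤ} (hm : m ≤ rk N) :
    expSum N π m = (1 + π m) + expSum N π (m + 1) := by
  unfold expSum
  have : Finset.Icc m (rk N) = insert m (Finset.Icc (m + 1) (rk N)) := by
    ext; simp only [Finset.mem_Icc, Finset.mem_insert]; omega
  rw [this, Finset.sum_insert (by simp)]

lemma expSum_congr (h : ∀ l, hh N ≤ l → l ≤ rk N → π l = π' l) {m : ℤ} (hm : hh N ≤ m) :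
    expSum N π m = expSum N π' m := by
  unfold expSum
  refine Finset.sum_congr rfl fun k hk => ?_
  rw [Finset.mem_Icc] at hk
  rw [h k (by omega) hk.2]

lemma sum_ee (a b k : ℤ) :
    ∑ i ∈ Finset.Icc a b, ee k i = if a ≤ k ∧ k ≤ b then 1 else 0 := by
  simp [ee, Pi.single_apply]

/-- The change of the momentum label under `p^i`. -/
def mstep (N : ℕ) (i : ℤ) : ℤ → ℤ :=
  if hh N < i then ee (i - 1) else if i < -hh N then -ee (-i - 1) else 0

/-- The change of the exponent of `(p·p)_m` under `p^i`. -/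
def lowStep (m i : ℤ) : ℤ := if m < |i| then (if 0 < i then 1 else -1) else 0

lemma sum_mstep {i m : ℤ} (hi : IsSpaceIndex N i) (hm : hh N ≤ m) :
    ∑ k ∈ Finset.Icc m (rk N), mstep N i k = lowStep m i := by
  have h0 := hh_nonneg N
  obtain ⟨h1, h2, -⟩ := hi
  unfold mstep lowStep
  split_ifs with a b b d b d d
  all_goals first
    | (simp only [Pi.neg_apply, Finset.sum_neg_distrib, sum_ee]; split_ifs <;> grind)
    | (simp; try grind)

lemma expSum_mstep {i m : ℤ} (hi : IsSpaceIndex N i) (hm : hh N ≤ m) :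
    expSum N (π + mstep N i) m = expSum N π m + lowStep m i := by
  rw [expSum_add, sum_mstep hi hm]

lemma mstep_neg (N : ℕ) (i : ℤ) : mstep N (-i) = -mstep N i := by
  have h0 := hh_nonneg N
  unfold mstep
  split_ifs <;> first | omega | simp

lemma mstep_of_lt {l : ℤ} (h : hh N < l) : mstep N l = ee (l - 1) := if_pos h

lemma yy_apply {i : ℤ} (hi : 1 ≤ i) (u : ℤ) : yy u i = kd u i - kd u (-i) := by
  unfold yy kd
  split_ifs <;> first | omega | (simp [Pi.single_apply]; try omega)

lemma yy_neg (u : ℤ) : yy (-u) = -yy u := by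
  unfold yy
  split_ifs <;> first | omega | simp

end Shifts

/-! ### Joint eigenspaces and the generators that permute them. -/

section JointSpaces

variable {D : Type*} [NormedAddCommGroup D] [InnerProductSpace ℂ D]

/-- The joint eigenspace of the `(p·p)_l`, the `𝐤^i` and `p_0` with label `(π, j)`. -/
def Generators.jointSpace (g : Generators D) (N : ℕ) (q : ℝ) (c : SpectralData) (π j : ℤ → ℤ) :
    Submodule ℂ D where
  carrier := {x | (∀ m, hh N ≤ m → m ≤ rk N → g.dot N q m x = dotVal N q c π m • x) ∧
    (∀ i, 1 ≤ i → i ≤ rk N → g.k i x = kVal q c j i • x) ∧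
    (¬ Even N → g.p 0 x = pVal N q c π • x)}
  add_mem' := by
    rintro x y ⟨h1, h2, h3⟩ ⟨h1', h2', h3'⟩
    refine ⟨fun m a b => ?_, fun m a b => ?_, fun a => ?_⟩
    · rw [map_add, h1 m a b, h1' m a b, smul_add]
    · rw [map_add, h2 m a b, h2' m a b, smul_add]
    · rw [map_add, h3 a, h3' a, smul_add]
  zero_mem' := by simp
  smul_mem' := by
    rintro z x ⟨h1, h2, h3⟩
    refine ⟨fun m a b => ?_, fun m a b => ?_, fun a => ?_⟩
    · rw [map_smul, h1 m a b, smul_comm]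
    · rw [map_smul, h2 m a b, smul_comm]
    · rw [map_smul, h3 a, smul_comm]

variable {N : ℕ} {q : ℝ} {g : Generators D} {c : SpectralData} {π π' j j' : ℤ → ℤ}

lemma mem_jointSpace {x : D} : x ∈ g.jointSpace N q c π j ↔
    (∀ m, hh N ≤ m → m ≤ rk N → g.dot N q m x = dotVal N q c π m • x) ∧
    (∀ i, 1 ≤ i → i ≤ rk N → g.k i x = kVal q c j i • x) ∧
    (¬ Even N → g.p 0 x = pVal N q c π • x) := Iff.rfl

lemma jointSpace_congr (h : ∀ l, hh N ≤ l → l ≤ rk N → π l = π' l)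
    (h' : ∀ i, 1 ≤ i → i ≤ rk N → j i = j' i) :
    g.jointSpace N q c π j = g.jointSpace N q c π' j' := by
  ext x
  rw [mem_jointSpace, mem_jointSpace]
  refine and_congr ?_ (and_congr ?_ ?_)
  · refine forall_congr' fun m => forall_congr' fun hm => ?_
    rw [dotVal, dotVal, expSum_congr h hm]
  · refine forall_congr' fun i => forall_congr' fun h1 => forall_congr' fun h2 => ?_
    rw [kVal, kVal, h' i h1 h2]
  · refine forall_congr' fun hN => ?_
    rw [pVal, pVal, expSum_congr h (hh_odd hN).le]

/-- An operator with definite `q`-commutation relations maps joint eigenspaces to joint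
eigenspaces. -/
lemma map_mem_jointSpace (hq : 0 < q) {X : Module.End ℂ D} {s t : ℤ → ℤ} {r : ℤ}
    (hd : ∀ m, hh N ≤ m → m ≤ rk N → QComm ((q : ℂ) ^ (2 * s m)) (g.dot N q m) X)
    (hk : ∀ i, 1 ≤ i → i ≤ rk N → QComm ((q : ℂ) ^ (2 * t i)) (g.k i) X)
    (hp : ¬ Even N → QComm ((q : ℂ) ^ r) (g.p 0) X)
    (hs : ∀ m, hh N ≤ m → m ≤ rk N → expSum N π' m = expSum N π m + s m)
    (ht : ∀ i, 1 ≤ i → i ≤ rk N → j' i = j i + t i)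
    (hr : ¬ Even N → expSum N π' 0 = expSum N π 0 + r)
    {x : D} (hx : x ∈ g.jointSpace N q c π j) : X x ∈ g.jointSpace N q c π' j' := by
  obtain ⟨h1, h2, h3⟩ := hx
  refine ⟨fun m a b => ?_, fun m a b => ?_, fun a => ?_⟩
  · rw [(hd m a b).apply, h1 m a b, map_smul, smul_smul, dotVal_shift hq (hs m a b)]
  · rw [(hk m a b).apply, h2 m a b, map_smul, smul_smul, kVal_shift hq (ht m a b)]
  · rw [(hp a).apply, h3 a, map_smul, smul_smul, pVal_shift hq (hr a)]

lemma dot_qcomm_p (hrep : IsStarRep N q g) (hq : 0 < q) {i m : ℤ} (hi : IsSpaceIndex N i)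
    (h0 : 0 ≤ m) (hm : m ≤ rk N) :
    QComm ((q : ℂ) ^ (2 * lowStep m i)) (g.dot N q m) (g.p i) := by
  have ⟨h1, h2, h3⟩ := hi
  unfold lowStep
  split_ifs with a b
  · rw [abs_of_pos b] at a
    exact (dot_p_of_lt hrep hq h0 a h2).congr (by norm_cast)
  · rw [abs_of_nonpos (by omega)] at a
    have := dot_p_neg_of_lt hrep hq h0 a (by omega)
    rw [neg_neg] at this
    exact this.congr (by rw [← zpow_natCast, ← zpow_neg]; norm_num)
  · rw [mul_zero, zpow_zero]
    exact QComm.of_commute (p_commute_dot hrep hq hi (by omega) hm).symm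

lemma p_mem_jointSpace (hrep : IsStarRep N q g) (hq : 0 < q) {i : ℤ} (hi : IsSpaceIndex N i)
    {x : D} (hx : x ∈ g.jointSpace N q c π j) :
    g.p i x ∈ g.jointSpace N q c (π + mstep N i) (j + yy i) := by
  have h0 := hh_nonneg N
  refine map_mem_jointSpace hq (s := fun m => lowStep m i) (t := fun k => yy i k)
    (r := lowStep 0 i)
    (fun m a b => dot_qcomm_p hrep hq hi (by omega) b) (fun k a b => ?_) (fun hN => ?_)
    (fun m a b => expSum_mstep hi a) (fun k a b => rfl)
    (fun hN => expSum_mstep hi (hh_odd hN).le) hx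
  · rw [yy_apply a]; exact k_qcomm_p hrep a b hi
  · have hz := isSpaceIndex_zero hN
    unfold lowStep
    rcases lt_trichotomy i 0 with h | rfl | h
    · rw [if_pos (abs_pos.mpr h.ne), if_neg h.not_gt, zpow_neg_one]
      exact p_swap' hrep hq hi hz h (by omega)
    · simpa using QComm.of_commute (Commute.refl (g.p 0))
    · rw [if_pos (abs_pos.mpr h.ne'), if_pos h, zpow_one]
      exact p_swap hrep hz hi h (by omega)

lemma dotVal_ne_zero (hq : 0 < q) (hM : 0 < c.M) (π : ℤ → ℤ) (m : ℤ) :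
    dotVal N q c π m ≠ 0 := by
  unfold dotVal
  have : 0 < c.M ^ 2 * q ^ (2 * expSum N π m) := by positivity
  exact_mod_cast this.ne'

lemma kVal_ne_zero (hq : 0 < q) {i : ℤ} (h : 0 < c.lam i) (j : ℤ → ℤ) : kVal q c j i ≠ 0 := by
  unfold kVal
  have : 0 < c.lam i * q ^ (2 * j i) := by positivity
  exact_mod_cast this.ne'

/-- The dilatation scales all momenta alike, hence raises every exponent $\sum_{k\ge m}(1+\pi_k)$ by
one. In terms of $\pi$ this changes $\pi_n$ alone. -/
lemma lam_mem_jointSpace (hN : 3 ≤ N) (hrep : IsStarRep N q g) (hq : 0 < q) {x : D}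
    (hx : x ∈ g.jointSpace N q c π j) :
    g.Lam x ∈ g.jointSpace N q c (π + ee (rk N)) j := by
  have h0 := hh_nonneg N
  have h1 := one_le_rk hN
  have hqc : (q : ℂ) ≠ 0 := by exact_mod_cast hq.ne'
  refine map_mem_jointSpace hq (s := fun _ => 1) (t := 0) (r := 1)
    (fun m a b => ?_) (fun k a b => ?_) (fun hN => ?_)
    (fun m a b => ?_) (fun k a b => ?_) (fun hN => ?_) hx
  · exact (lam_qcomm_dot hrep hq (by omega) b).congr (by norm_cast)
  · simpa using (qcomm_eq_zero_iff.mp (hrep.lam_k k a b)).symm one_ne_zero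
  · simpa using (qcomm_eq_zero_iff.mp (hrep.lam_p 0 (isSpaceIndex_zero hN))).symm
      (inv_ne_zero hqc)
  · rw [expSum_add, sum_ee, if_pos ⟨b, le_rfl⟩]
  · simp
  · rw [expSum_add, sum_ee, if_pos ⟨by omega, le_rfl⟩]

lemma QComm.of_inverse {a : ℂ} (ha : a ≠ 0) {A X Y : Module.End ℂ D} (h : QComm a A X)
    (h1 : X * Y = 1) (h2 : Y * X = 1) : QComm a⁻¹ A Y := by
  have h' := h.symm ha
  unfold QComm at *
  calc A * Y = Y * (X * A) * Y := by rw [← mul_assoc, h2, one_mul]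
    _ = a⁻¹ • (Y * A * (X * Y)) := by rw [h', mul_smul_comm, smul_mul_assoc]; simp only [mul_assoc]
    _ = _ := by rw [h1, mul_one]

lemma lamInv_mem_jointSpace (hN : 3 ≤ N) (hrep : IsStarRep N q g) (hq : 0 < q) {x : D}
    (hx : x ∈ g.jointSpace N q c π j) :
    g.LamInv x ∈ g.jointSpace N q c (π - ee (rk N)) j := by
  have h0 := hh_nonneg N
  have h1 := one_le_rk hN
  have hqc : (q : ℂ) ≠ 0 := by exact_mod_cast hq.ne'
  obtain ⟨e1, e2⟩ := hrep.lam_inv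
  rw [sub_eq_add_neg]
  refine map_mem_jointSpace hq (s := fun _ => -1) (t := 0) (r := -1)
    (fun m a b => ?_) (fun k a b => ?_) (fun hN => ?_)
    (fun m a b => ?_) (fun k a b => ?_) (fun hN => ?_) hx
  · exact ((lam_qcomm_dot hrep hq (by omega) b).of_inverse (pow_ne_zero _ hqc) e1 e2).congr
      (by rw [← zpow_natCast, ← zpow_neg]; norm_num)
  · simpa using ((qcomm_eq_zero_iff.mp (hrep.lam_k k a b)).symm one_ne_zero).of_inverse
      (by simp) e1 e2
  · simpa using ((qcomm_eq_zero_iff.mp (hrep.lam_p 0 (isSpaceIndex_zero hN))).symm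
      (inv_ne_zero hqc)).of_inverse (by simpa using hqc) e1 e2
  · simp only [expSum_add, Pi.neg_apply, Finset.sum_neg_distrib, sum_ee]
    rw [if_pos ⟨b, le_rfl⟩]
  · simp
  · simp only [expSum_add, Pi.neg_apply, Finset.sum_neg_distrib, sum_ee]
    rw [if_pos ⟨by omega, le_rfl⟩]

lemma k_neg_mem_jointSpace (hrep : IsStarRep N q g) (hq : 0 < q) {i : ℤ} (h1 : 1 ≤ i)
    (h2 : i ≤ rk N) (hl : 0 < c.lam i) {x : D} (hx : x ∈ g.jointSpace N q c π j) :
    g.k (-i) x = (kVal q c j i)⁻¹ • x := by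
  have e := LinearMap.congr_fun (hrep.k_inv i h1 h2).2 x
  rw [Module.End.mul_apply, hx.2.1 i h1 h2, map_smul] at e
  rw [eq_inv_smul_iff₀ (kVal_ne_zero hq hl j), e]
  rfl

end JointSpaces

/-! ### Improved roots on joint eigenvectors. -/

section ImprovedRoots

variable {D : Type*} [NormedAddCommGroup D] [InnerProductSpace ℂ D]
variable {N : ℕ} {q : ℝ} {g : Generators D} {c : SpectralData} {π j : ℤ → ℤ} {u v : ℤ}

lemma one_sub_sq_ne_zero (hq0 : 0 < q) (hq1 : q < 1) : (1 - (q : ℂ) ^ 2) ≠ 0 := by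
  have : 0 < 1 - q ^ 2 := by nlinarith
  exact_mod_cast this.ne'

lemma pVal_sq (hq : 0 < q) (hε : c.ε ^ 2 = 1) :
    pVal N q c π ^ 2 = (1 + (q : ℂ)⁻¹) * dotVal N q c π 0 := by
  have h : √(1 + q⁻¹) ^ 2 = 1 + q⁻¹ := Real.sq_sqrt (by positivity)
  have : (c.ε * c.M * √(1 + q⁻¹) * q ^ expSum N π 0) ^ 2
      = (1 + q⁻¹) * (c.M ^ 2 * q ^ (2 * expSum N π 0)) := by
    rw [mul_comm 2, zpow_mul]
    simp only [mul_pow, h, hε]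
    norm_cast
    ring
  unfold pVal dotVal
  exact_mod_cast this

/-- The change of the momentum label under `p^{-u} p^v` affects only `(p·p)_{v-1}`. -/
lemma lowStep_root (hN : 3 ≤ N) (h : IsSimpleRoot N u v) {m : ℤ} (hm : hh N ≤ m) :
    lowStep m v + lowStep m (-u) = if m = v - 1 then 1 else 0 := by
  obtain ⟨h1, h2, h3, h4, h5, h6, h7⟩ := h.bounds hN
  have h0 := hh_nonneg N
  have : 0 < u ∨ m = 1 ∧ v = 2 ∧ u = -1 ∨ 1 < m ∧ v = 2 ∧ u = -1 ∨ u = 0 := by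
    rcases h with h | ⟨h, h', h''⟩
    · omega
    · rw [hh_even h] at hm; omega
  unfold lowStep
  rw [abs_neg, h4, abs_of_pos (by omega)]
  split_ifs <;> omega

/-- On a joint eigenvector, the improved positive root. -/
lemma pos_mem_jointSpace (hN : 3 ≤ N) (hrep : IsStarRep N q g) (hq0 : 0 < q) (hq1 : q < 1)
    (hM : 0 < c.M) (hε : c.ε ^ 2 = 1) (h : IsSimpleRoot N u v) {x : D}
    (hx : x ∈ g.jointSpace N q c π j) :
    g.L (-u) v x + (qp q (2 * rho N v + 2) / (1 - (q : ℂ) ^ 2) *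
      (((q : ℂ) ^ 2 * dotVal N q c π (v - 1))⁻¹)) • g.p (-u) (g.p v x)
      ∈ g.jointSpace N q c π (j + yy v - yy u) := by
  have ⟨h1, h2, h3, h4, h5, h6, h7⟩ := h.bounds hN
  have h0 := hh_nonneg N
  have hqc : (q : ℂ) ≠ 0 := by exact_mod_cast hq0.ne'
  have hc := dotVal_ne_zero (N := N) hq0 hM π (v - 1)
  have hq2 := one_sub_sq_ne_zero hq0 hq1
  have hw := p_mem_jointSpace hrep hq0 h5.neg
    (p_mem_jointSpace hrep hq0 (isSpaceIndex_pos h2 h3) hx)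
  rw [qp_two_mul_add_two hq0]
  have hE : ∀ m, hh N ≤ m → expSum N (π + mstep N v + mstep N (-u)) m
      = expSum N π m + if m = v - 1 then 1 else 0 := fun m hm => by
    rw [expSum_mstep h5.neg hm, expSum_mstep (isSpaceIndex_pos h2 h3) hm, add_assoc,
      lowStep_root hN h hm]
  obtain ⟨w1, w2, w3⟩ := hw
  have ⟨x1, x2, x3⟩ := hx
  refine ⟨fun m a b => ?_, fun m a b => ?_, fun hodd => ?_⟩
  · rw [map_add, map_smul, w1 m a b, dotVal_shift hq0 (hE m a)]
    -- With $d$ the eigenvalue of $(p\cdot p)_{v-1}$ on $x$ and $w=p^{-u}p^vx$, the defect is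
    -- $q^{2\rho_v}w$, while $w$ has eigenvalue $q^2d$. A correction $cw$ restores $d$ exactly if
    -- $c(1-q^2)d=q^{2\rho_v}$.
    split_ifs with hm
    · subst hm
      have e := pos_dot_pred_apply hN hrep hq0 h x
      rw [x1 _ a b, map_smul] at e
      rw [eq_add_of_sub_eq e.symm]
      rw [show (q : ℂ) ^ (2 * (1 : ℤ)) = (q : ℂ) ^ 2 by norm_cast]
      match_scalars <;> field_simp
      ring
    · have e := LinearMap.congr_fun (roots_commute_dot hN hrep hq0 h (by omega) b hm).1 x
      simp only [Module.End.mul_apply, x1 m a b, map_smul] at e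
      rw [← e]
      simp only [mul_zero, zpow_zero, one_mul]
      module
  · rw [map_add, map_smul, w2 m a b, (k_qcomm_pos hrep h a b).apply, x2 m a b, map_smul, smul_smul]
    have e1 : (j + yy v + yy (-u)) m = j m + (kd m v - kd m u + kd m (-u)) := by
      rw [yy_neg]
      simp only [Pi.add_apply, Pi.neg_apply, yy_apply a]
      unfold kd; split_ifs <;> omega
    have e2 : j + yy v - yy u = j + yy v + yy (-u) := by rw [yy_neg]; abel
    rw [e2, kVal_shift hq0 e1]
    module
  · by_cases hu : u = 0
    · have hv := (h6 hu).2
      subst hu hv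
      have e2 : g.p 0 (g.L 0 1 x) = pVal N q c π • g.L 0 1 x + (q : ℂ)⁻¹ • g.p 1 x := by
        have := qcomm_apply_eq (hrep.pos_p_zero hodd) x
        rw [x3 hodd, map_smul, one_smul] at this
        rw [this]; simp
      have e3 : g.p 0 (g.p 1 x) = ((q : ℂ) * pVal N q c π) • g.p 1 x := by
        rw [(p_mul_p_zero hrep hodd le_rfl h3 x).1, x3 hodd, map_smul, smul_smul]
      have hp := pVal_sq (N := N) (π := π) hq0 hε
      rw [sub_self] at hc ⊢
      simp only [neg_zero, map_add, map_smul, e2, e3, smul_smul]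
      rw [qp_rho_one_odd hodd hq0]
      -- For $u=0$ the correction is a multiple of $p^0p^1x$, so it contributes the square of the
      -- eigenvalue of $p_0$. That square is $(1+q^{-1})$ times the eigenvalue of $(p\cdot p)_0$,
      -- whatever the sign of $p_0$.
      have key : (q : ℂ)⁻¹ + ((q : ℂ)⁻¹ * (q : ℂ) ^ 2 / (1 - (q : ℂ) ^ 2) *
          (((q : ℂ) ^ 2 * dotVal N q c π 0)⁻¹)) * ((q : ℂ) ^ 2 - q) * pVal N q c π ^ 2 = 0 := by
        rw [hp]
        field_simp
        ring
      match_scalars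
      · ring
      · linear_combination key
    · have e := LinearMap.congr_fun (roots_commute_p_zero hN hrep h hu).1 x
      simp only [Module.End.mul_apply, x3 hodd, map_smul] at e
      rw [map_add, map_smul, w3 hodd, pVal_shift hq0 (hE 0 (hh_odd hodd).le), ← e,
        if_neg (by have := h7 hu; omega), zpow_zero, one_mul]
      module

/-- On a joint eigenvector, the improved negative root. -/
lemma neg_mem_jointSpace (hN : 3 ≤ N) (hrep : IsStarRep N q g) (hq0 : 0 < q) (hq1 : q < 1)
    (hM : 0 < c.M) (hε : c.ε ^ 2 = 1) (h : IsSimpleRoot N u v) {x : D}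
    (hx : x ∈ g.jointSpace N q c π j) :
    g.L (-v) u x + (qp q (2 * rho N v + 1) / (1 - (q : ℂ) ^ 2) *
      ((((q : ℂ) ^ 2)⁻¹ * dotVal N q c π (v - 1))⁻¹)) • g.p (-v) (g.p u x)
      ∈ g.jointSpace N q c π (j - yy v + yy u) := by
  have ⟨h1, h2, h3, h4, h5, h6, h7⟩ := h.bounds hN
  have h0 := hh_nonneg N
  have hqc : (q : ℂ) ≠ 0 := by exact_mod_cast hq0.ne'
  have hc := dotVal_ne_zero (N := N) hq0 hM π (v - 1)
  have hq2 := one_sub_sq_ne_zero hq0 hq1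
  have hv' := (isSpaceIndex_pos h2 h3).neg
  have hw := p_mem_jointSpace hrep hq0 hv' (p_mem_jointSpace hrep hq0 h5 hx)
  rw [qp_two_mul_add_one hq0]
  have hE : ∀ m, hh N ≤ m → expSum N (π + mstep N u + mstep N (-v)) m
      = expSum N π m + -(if m = v - 1 then 1 else 0) := fun m hm => by
    -- The shift of $p^{-v}p^u$ is opposite to that of $p^vp^{-u}$, so `lowStep_root` is applied on
    -- the way back to $\pi$.
    have e := expSum_mstep (π := π + mstep N u + mstep N (-v)) (isSpaceIndex_pos h2 h3) hm
    have e' := expSum_mstep (π := π + mstep N u + mstep N (-v) + mstep N v) h5.neg hm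
    have := lowStep_root hN h hm
    rw [show π + mstep N u + mstep N (-v) + mstep N v + mstep N (-u) = π by
      rw [mstep_neg, mstep_neg]; abel] at e'
    omega
  obtain ⟨w1, w2, w3⟩ := hw
  have ⟨x1, x2, x3⟩ := hx
  refine ⟨fun m a b => ?_, fun m a b => ?_, fun hodd => ?_⟩
  · rw [map_add, map_smul, w1 m a b, dotVal_shift hq0 (hE m a)]
    split_ifs with hm
    · subst hm
      have e := neg_dot_pred_apply hN hrep hq0 h x
      rw [x1 _ a b, map_smul] at e
      rw [eq_sub_of_add_eq e.symm, show (q : ℂ) ^ (2 * (-1 : ℤ)) = ((q : ℂ) ^ 2)⁻¹ by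
        rw [← zpow_natCast, ← zpow_neg]; norm_num]
      match_scalars <;> field_simp
      ring
    · have e := LinearMap.congr_fun (roots_commute_dot hN hrep hq0 h (by omega) b hm).2 x
      simp only [Module.End.mul_apply, x1 m a b, map_smul] at e
      rw [← e]
      simp only [neg_zero, mul_zero, zpow_zero, one_mul]
      module
  · rw [map_add, map_smul, w2 m a b, (k_qcomm_neg hrep h a b).apply, x2 m a b, map_smul, smul_smul]
    have e1 : (j + yy u + yy (-v)) m = j m + -(kd m v - kd m u + kd m (-u)) := by
      rw [yy_neg]
      simp only [Pi.add_apply, Pi.neg_apply, yy_apply a]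
      unfold kd; split_ifs <;> omega
    have e2 : j - yy v + yy u = j + yy u + yy (-v) := by rw [yy_neg]; abel
    rw [e2, kVal_shift hq0 e1, mul_neg]
    module
  · by_cases hu : u = 0
    · have hv := (h6 hu).2
      subst hu hv
      have e2 : g.p 0 (g.L (-1) 0 x) = pVal N q c π • g.L (-1) 0 x - g.p (-1) x := by
        have := qcomm_apply_eq (hrep.neg_p_zero hodd) x
        rw [x3 hodd, map_smul, one_smul] at this
        rw [this]; simp
      have e3 : g.p 0 (g.p (-1) x) = ((q : ℂ)⁻¹ * pVal N q c π) • g.p (-1) x := by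
        have := (p_mul_p_zero hrep hodd le_rfl h3 x).2
        rw [x3 hodd, map_smul] at this
        rw [mul_smul, this, smul_smul, inv_mul_cancel₀ hqc, one_smul]
      have hp := pVal_sq (N := N) (π := π) hq0 hε
      rw [sub_self] at hc ⊢
      simp only [map_add, map_smul, e2, e3, x3 hodd, smul_smul]
      rw [qp_rho_one_odd hodd hq0]
      have key : -1 + ((q : ℂ)⁻¹ * q / (1 - (q : ℂ) ^ 2) *
          ((((q : ℂ) ^ 2)⁻¹ * dotVal N q c π 0)⁻¹)) * ((q : ℂ)⁻¹ - 1) * pVal N q c π ^ 2 = 0 := by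
        rw [hp]
        field_simp
        ring
      match_scalars
      · ring
      · linear_combination key
    · have e := LinearMap.congr_fun (roots_commute_p_zero hN hrep h hu).2 x
      simp only [Module.End.mul_apply, x3 hodd, map_smul] at e
      rw [map_add, map_smul, w3 hodd, pVal_shift hq0 (hE 0 (hh_odd hodd).le), ← e,
        if_neg (by have := h7 hu; omega), neg_zero, zpow_zero, one_mul]
      module

end ImprovedRoots

/-! ### Matrix elements of the momenta. -/

section Steps

variable {D : Type*} [NormedAddCommGroup D] [InnerProductSpace ℂ D]
variable {N : ℕ} {q : ℝ} {g : Generators D} {c : SpectralData} {π π' j j' : ℤ → ℤ}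

/-- The square of the matrix element of `p^l`, without the factor `M² q^{2 ∑ (1 + π_k)}`. -/
def stepGap (N : ℕ) (q : ℝ) (l : ℤ) (π : ℤ → ℤ) : ℝ :=
  if hh N < l then 1 - q ^ (2 * (π (l - 1) + 1)) else 1

/-- The matrix element of `p^l`, `l ≥ 1`. -/
def stepVal (N : ℕ) (q : ℝ) (c : SpectralData) (l : ℤ) (π : ℤ → ℤ) : ℝ :=
  c.M * √(stepGap N q l π) * q ^ expSum N π l

lemma stepGap_pos (hq0 : 0 < q) (hq1 : q < 1) {l : ℤ} (h : hh N < l → 0 ≤ π (l - 1)) :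
    0 < stepGap N q l π := by
  unfold stepGap
  split_ifs with hl
  · have := zpow_lt_one_of_neg₀ (one_lt_inv_iff₀.mpr ⟨hq0, hq1⟩)
      (show -(2 * (π (l - 1) + 1)) < 0 by have := h hl; omega)
    rw [zpow_neg, inv_zpow, inv_inv] at this
    linarith
  · exact one_pos

lemma stepVal_pos (hq0 : 0 < q) (hq1 : q < 1) (hM : 0 < c.M) {l : ℤ}
    (h : hh N < l → 0 ≤ π (l - 1)) : 0 < stepVal N q c l π := by
  have := stepGap_pos (N := N) hq0 hq1 h
  unfold stepVal
  positivity

lemma stepVal_sq (h : 0 ≤ stepGap N q l π) :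
    stepVal N q c l π ^ 2 = stepGap N q l π * (c.M ^ 2 * q ^ (2 * expSum N π l)) := by
  unfold stepVal
  rw [mul_pow, mul_pow, Real.sq_sqrt h, mul_comm 2, zpow_mul]
  norm_cast
  ring

lemma dotVal_pred (hq : 0 < q) {l : ℤ} (hl : l ≤ rk N) :
    dotVal N q c π (l - 1) = (q : ℂ) ^ (2 * (π (l - 1) + 1)) * dotVal N q c π l := by
  have hqc : (q : ℂ) ≠ 0 := by exact_mod_cast hq.ne'
  unfold dotVal
  rw [expSum_step N π (show l - 1 ≤ rk N by omega), sub_add_cancel, mul_add]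
  push_cast
  rw [zpow_add₀ hqc, add_comm (1 : ℤ)]
  ring

lemma dot_pred_apply (hrep : IsStarRep N q g) (hq : 0 < q) {l : ℤ} (h1 : 1 ≤ l)
    (h2 : l ≤ rk N) {x : D} (hx : x ∈ g.jointSpace N q c π j) :
    g.dot N q (l - 1) x = ((1 - stepGap N q l π : ℝ) * dotVal N q c π l) • x := by
  unfold stepGap
  split_ifs with hl
  · rw [hx.1 (l - 1) (by omega) (by omega), dotVal_pred hq h2]
    push_cast
    congr 1
    ring
  -- The remaining case is $N$ even and $l=1$, where $(p\cdot p)_0=0$ matches a gap equal to $1$.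
  · have hN : Even N := by by_contra hN; rw [hh_odd hN] at hl; omega
    rw [hh_even hN] at hl
    obtain rfl : l = 1 := by omega
    simp [dot_zero_even hrep hq hN]

/-- One minus the gap is the ratio of the eigenvalues of $(p\cdot p)_{l-1}$ and $(p\cdot p)_l$, and
$p^{-l}$ multiplies this ratio by $q^{-2}$. -/
lemma stepGap_sub (hq : 0 < q) (l : ℤ) :
    1 - stepGap N q l (π - mstep N l) = (q ^ 2)⁻¹ * (1 - stepGap N q l π) := by
  unfold stepGap
  split_ifs with hl
  · rw [mstep_of_lt hl]
    simp only [Pi.sub_apply, ee, Pi.single_eq_same]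
    rw [show 2 * (π (l - 1) - 1 + 1) = 2 * (π (l - 1) + 1) + -2 by ring, zpow_add₀ hq.ne',
      zpow_neg]
    norm_cast
    ring
  · simp

lemma sub_dot_pred_apply (hrep : IsStarRep N q g) (hq : 0 < q) {l : ℤ} (h1 : 1 ≤ l)
    (h2 : l ≤ rk N) {x : D} (hx : x ∈ g.jointSpace N q c π j) :
    (g.dot N q l - g.dot N q (l - 1)) x
      = ((stepGap N q l π * (c.M ^ 2 * q ^ (2 * expSum N π l)) : ℝ) : ℂ) • x := by
  have := hh_le_one N
  rw [LinearMap.sub_apply, dot_pred_apply hrep hq h1 h2 hx, hx.1 l (by omega) h2, dotVal]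
  push_cast
  module

lemma sub_dot_pred_apply' (hrep : IsStarRep N q g) (hq : 0 < q) {l : ℤ} (h1 : 1 ≤ l)
    (h2 : l ≤ rk N) {x : D} (hx : x ∈ g.jointSpace N q c π j) :
    (g.dot N q l - ((q : ℂ) ^ 2)⁻¹ • g.dot N q (l - 1)) x
      = ((stepGap N q l (π - mstep N l) * (c.M ^ 2 * q ^ (2 * expSum N π l)) : ℝ) : ℂ) • x := by
  have := hh_le_one N
  have e : stepGap N q l (π - mstep N l) = 1 - (q ^ 2)⁻¹ * (1 - stepGap N q l π) := by
    rw [← stepGap_sub hq]; ring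
  rw [LinearMap.sub_apply, LinearMap.smul_apply, dot_pred_apply hrep hq h1 h2 hx,
    hx.1 l (by omega) h2, dotVal, e]
  push_cast
  module

lemma expSum_sub_mstep {l : ℤ} (h1 : 1 ≤ l) (h2 : l ≤ rk N) :
    expSum N (π - mstep N l) l = expSum N π l := by
  have := hh_le_one N
  rw [sub_eq_add_neg, ← mstep_neg, expSum_mstep (isSpaceIndex_pos h1 h2).neg (by omega), lowStep,
    abs_neg, abs_of_pos (by omega), if_neg (lt_irrefl _), add_zero]

lemma p_neg_p_apply (hrep : IsStarRep N q g) (hq0 : 0 < q) {l : ℤ}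
    (h1 : 1 ≤ l) (h2 : l ≤ rk N) {x : D} (hx : x ∈ g.jointSpace N q c π j)
    (hπ : 0 ≤ stepGap N q l π) :
    g.p (-l) (g.p l x) = ((qp q (rho N l))⁻¹ * (stepVal N q c l π : ℂ) ^ 2) • x := by
  rw [← Module.End.mul_apply, p_neg_mul_p (N := N) hq0 h1, LinearMap.smul_apply,
    sub_dot_pred_apply hrep hq0 h1 h2 hx, smul_smul, ← stepVal_sq hπ]
  push_cast; rfl

lemma p_p_neg_apply (hrep : IsStarRep N q g) (hq0 : 0 < q) {l : ℤ}
    (h1 : 1 ≤ l) (h2 : l ≤ rk N) {x : D} (hx : x ∈ g.jointSpace N q c π j)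
    (hπ : 0 ≤ stepGap N q l (π - mstep N l)) :
    g.p l (g.p (-l) x)
      = ((qp q (rho N l))⁻¹ * (stepVal N q c l (π - mstep N l) : ℂ) ^ 2) • x := by
  rw [← Module.End.mul_apply, p_mul_p_neg hrep hq0 h1 h2, LinearMap.smul_apply,
    sub_dot_pred_apply' hrep hq0 h1 h2 hx, smul_smul, ← expSum_sub_mstep h1 h2, ← stepVal_sq hπ]
  push_cast; rfl

lemma inner_p_p_apply (hrep : IsStarRep N q g) (hq0 : 0 < q) {l : ℤ}
    (h1 : 1 ≤ l) (h2 : l ≤ rk N) (x : D) {y : D} (hy : y ∈ g.jointSpace N q c π j)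
    (hπ : 0 ≤ stepGap N q l π) :
    inner ℂ (g.p l x) (g.p l y) = (stepVal N q c l π : ℂ) ^ 2 * inner ℂ x y := by
  rw [inner_p_p hrep hq0 h1 h2, sub_dot_pred_apply hrep hq0 h1 h2 hy, inner_smul_right,
    ← stepVal_sq hπ]
  push_cast; rfl

lemma inner_p_neg_p_neg_apply (hrep : IsStarRep N q g) (hq0 : 0 < q) {l : ℤ}
    (h1 : 1 ≤ l) (h2 : l ≤ rk N) (x : D) {y : D} (hy : y ∈ g.jointSpace N q c π j) :
    inner ℂ (g.p (-l) x) (g.p (-l) y) = (qp q (rho N l) ^ 2)⁻¹ *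
      ((stepGap N q l (π - mstep N l) * (c.M ^ 2 * q ^ (2 * expSum N π l)) : ℝ) : ℂ) *
        inner ℂ x y := by
  rw [inner_p_neg_p_neg hrep hq0 h1 h2, sub_dot_pred_apply' hrep hq0 h1 h2 hy, inner_smul_right,
    mul_assoc]

lemma inner_self_eq_ofReal (x : D) : inner ℂ x x = ((‖x‖ ^ 2 : ℝ) : ℂ) := by
  rw [inner_self_eq_norm_sq_to_K]; push_cast; rfl

lemma qp_sq_inv (q x : ℝ) : (qp q x ^ 2)⁻¹ = ((((q ^ x) ^ 2)⁻¹ : ℝ) : ℂ) := by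
  unfold qp; push_cast; rfl

lemma p_neg_norm (hrep : IsStarRep N q g) (hq0 : 0 < q) {l : ℤ}
    (h1 : 1 ≤ l) (h2 : l ≤ rk N) {x : D} (hx : x ∈ g.jointSpace N q c π j) :
    ‖g.p (-l) x‖ ^ 2 = ((q ^ rho N l) ^ 2)⁻¹ *
      (stepGap N q l (π - mstep N l) * (c.M ^ 2 * q ^ (2 * expSum N π l))) * ‖x‖ ^ 2 := by
  have := inner_p_neg_p_neg_apply hrep hq0 h1 h2 x hx
  rw [inner_self_eq_ofReal, inner_self_eq_ofReal, qp_sq_inv] at this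
  exact_mod_cast this

/-- The momentum labels `π_l`, `l < n`, are natural numbers. -/
lemma eq_zero_of_mem_jointSpace (hrep : IsStarRep N q g) (hq0 : 0 < q) (hq1 : q < 1)
    (hM : 0 < c.M) {l : ℤ} (h1 : hh N ≤ l) (h2 : l < rk N) (hl : π l < 0) {x : D}
    (hx : x ∈ g.jointSpace N q c π j) : x = 0 := by
  have h0 := hh_nonneg N
  have e := p_neg_norm hrep hq0 (l := l + 1) (by omega) (by omega) hx
  -- This gap is $1-q^{2\pi_l}$. For $\pi_l<0$ it would give $p^{-(l+1)}x$ a negative squared norm.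
  have hgap : stepGap N q (l + 1) (π - mstep N (l + 1)) < 0 := by
    rw [stepGap, if_pos (by omega), mstep_of_lt (by omega), add_sub_cancel_right]
    simp only [Pi.sub_apply, ee, Pi.single_eq_same, sub_add_cancel]
    have := zpow_lt_one_of_neg₀ (one_lt_inv_iff₀.mpr ⟨hq0, hq1⟩) (show 2 * π l < 0 by omega)
    rw [inv_zpow, inv_lt_one₀ (by positivity)] at this
    linarith
  have hp : 0 < c.M ^ 2 * q ^ (2 * expSum N π (l + 1)) := by positivity
  have hr : 0 < ((q ^ rho N (l + 1)) ^ 2)⁻¹ := by positivity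
  by_contra hne
  have hn : 0 < ‖x‖ ^ 2 := by positivity
  have : ((q ^ rho N (l + 1)) ^ 2)⁻¹ * (stepGap N q (l + 1) (π - mstep N (l + 1)) *
      (c.M ^ 2 * q ^ (2 * expSum N π (l + 1)))) * ‖x‖ ^ 2 < 0 :=
    mul_neg_of_neg_of_pos (mul_neg_of_pos_of_neg hr (mul_neg_of_neg_of_pos hgap hp)) hn
  have := sq_nonneg ‖g.p (-(l + 1)) x‖
  linarith

end Steps

/-! ### Spectrum of the observables on the given joint eigenvector. -/

section Spectrum

variable {D : Type*} [NormedAddCommGroup D] [InnerProductSpace ℂ D]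
variable {N : ℕ} {q : ℝ} {g : Generators D}

lemma eq_zero_of_re_inner_nonpos {x : D} (h : RCLike.re (inner ℂ x x) ≤ 0) : x = 0 :=
  inner_self_eq_zero.mp ((inner_self_eq_ofReal x).trans (by
    rw [inner_self_eq_ofReal, RCLike.re_to_complex, Complex.ofReal_re] at h
    rw [le_antisymm h (sq_nonneg _), Complex.ofReal_zero]))

/-- The squared norms of $p^{\pm l}x$ reduce to negative multiples of $\langle x,(p\cdot
p)_{l-1}x\rangle\ge0$. -/
lemma p_eq_zero_of_dot_eq_zero (hrep : IsStarRep N q g) (hq : 0 < q) {l : ℤ} (h1 : 1 ≤ l)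
    (h2 : l ≤ rk N) {x : D} (hx : g.dot N q l x = 0) : g.p l x = 0 ∧ g.p (-l) x = 0 := by
  have hd := dot_nonneg hrep hq (m := l - 1) (by omega) (by omega) x
  constructor
  · refine eq_zero_of_re_inner_nonpos ?_
    rw [inner_p_p hrep hq h1 h2, LinearMap.sub_apply, hx, zero_sub, inner_neg_right, map_neg]
    linarith
  · refine eq_zero_of_re_inner_nonpos ?_
    rw [inner_p_neg_p_neg hrep hq h1 h2, LinearMap.sub_apply, hx, zero_sub, inner_neg_right,
      LinearMap.smul_apply, inner_smul_right, qp_sq_inv]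
    have e : ((q : ℂ) ^ 2)⁻¹ = (((q ^ 2)⁻¹ : ℝ) : ℂ) := by push_cast; rfl
    rw [e, RCLike.re_to_complex, Complex.re_ofReal_mul, Complex.neg_re, Complex.re_ofReal_mul]
    rw [RCLike.re_to_complex] at hd
    have : 0 ≤ ((q ^ rho N l) ^ 2)⁻¹ * ((q ^ 2)⁻¹ * (inner ℂ x (g.dot N q (l - 1) x)).re) := by
      positivity
    linarith

/-- If `(p·p)_u` has a null vector, so has `(p·p)_{u+1}`. -/
lemma dot_succ_eq_zero (hrep : IsStarRep N q g) (hq : 0 < q) {u : ℤ}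
    (h1 : hh N ≤ u) (h2 : u + 1 ≤ rk N) {x : D} (hx : g.dot N q u x = 0) :
    g.dot N q (u + 1) x = 0 := by
  have hqc : (q : ℂ) ≠ 0 := by exact_mod_cast hq.ne'
  have h0 := hh_nonneg N
  have hs : IsSimpleRoot N u (u + 1) := Or.inl ⟨h1, rfl, h2⟩
  suffices h : g.p (u + 1) x = 0 by
    rw [dot_step g N q (by omega), add_sub_cancel_right, LinearMap.add_apply, hx,
      LinearMap.smul_apply, Module.End.mul_apply, h, map_zero, smul_zero, add_zero]
  -- In both cases $p^ux=0$, so the root relation gives $p^u\mathbf Lx\propto p^{u+1}x$. Applying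
  -- the adjoint $p^{-u}$ of $p^u$, up to a factor, and moving it past $p^{u+1}$ gives zero because
  -- $p^{-u}x=0$. So $p^u\mathbf Lx$ has norm zero and $p^{u+1}x=0$.
  rcases (show 0 ≤ u by omega).eq_or_lt with rfl | hu
  · have hodd : ¬ Even N := fun e => by rw [hh_even e] at h1; omega
    have hz : g.p 0 x = 0 := by
      have := inner_dot_zero hq hrep x x
      rw [hx, inner_zero_right, eq_comm, mul_eq_zero] at this
      exact inner_self_eq_zero.mp (this.resolve_left
        (one_div_ne_zero (one_add_inv_ne_zero hq)))
    have e := qcomm_apply_eq (hrep.pos_p_zero hodd) x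
    rw [hz, map_zero, one_smul] at e
    have e : g.p 0 (g.L 0 1 x) = (q : ℂ)⁻¹ • g.p 1 x := by
      rw [← sub_eq_zero, sub_eq_add_neg, e]; rfl
    have e2 : g.p 0 (g.p 0 (g.L 0 1 x)) = 0 := by
      rw [e, map_smul, (p_mul_p_zero hrep hodd le_rfl h2 x).1, hz, map_zero, smul_zero, smul_zero]
    have e3 : g.p 0 (g.L 0 1 x) = 0 := by
      rw [← inner_self_eq_zero (𝕜 := ℂ), inner_p_zero hrep, e2, inner_zero_right]
    rw [e3] at e
    exact (smul_eq_zero.mp e.symm).resolve_left (inv_ne_zero hqc)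
  · obtain ⟨z1, z2⟩ := p_eq_zero_of_dot_eq_zero hrep hq (by omega) (by omega) hx
    have hr := qp_ne_zero hq (rho N (u + 1))
    have e := pos_p_u_apply hrep hs hu.ne' x
    rw [z1, map_zero, eq_comm, sub_eq_zero] at e
    have hi := isSpaceIndex_pos (N := N) (l := u) (by omega) (by omega)
    have e2 : g.p (-u) (g.p u (g.L (-u) (u + 1) x)) = 0 := by
      have := congrArg (g.p (-u)) e
      rw [map_smul, map_smul, (p_swap hrep hi.neg
        (isSpaceIndex_pos (l := u + 1) (by omega) h2) (by omega) (by omega)).apply x, z2,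
        map_zero, smul_zero, smul_zero] at this
      exact (smul_eq_zero.mp this).resolve_left hqc
    have e3 : g.p u (g.L (-u) (u + 1) x) = 0 := by
      rw [← inner_self_eq_zero (𝕜 := ℂ), inner_p_left hrep hi, e2, inner_zero_right, mul_zero]
    rw [e3, smul_zero, eq_comm] at e
    exact (smul_eq_zero.mp e).resolve_left hr

lemma eigenvalue_eq_re {X : Module.End ℂ D} (hX : ∀ x y : D, inner ℂ (X x) y = inner ℂ x (X y))
    {x : D} (hx : x ≠ 0) {a : ℂ} (h : X x = a • x) : ((a.re : ℝ) : ℂ) = a := by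
  have := hX x x
  rw [h, inner_smul_left, inner_smul_right] at this
  exact Complex.conj_eq_iff_re.mp (mul_right_cancel₀ (inner_self_ne_zero.mpr hx) this)

/-- Repeated lowering by `p^{-l}` terminates, which quantizes the ratio of the eigenvalues of
`(p·p)_{l-1}` and `(p·p)_l`. -/
lemma exists_ratio (hrep : IsStarRep N q g) (hq0 : 0 < q) (hq1 : q < 1) {l : ℤ} (h1 : 1 ≤ l)
    (h2 : l ≤ rk N) {x : D} (hx : x ≠ 0) {a b : ℝ} (ha : g.dot N q l x = (a : ℂ) • x)
    (hb : g.dot N q (l - 1) x = (b : ℂ) • x) (hb0 : 0 < b) :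
    ∃ k : ℕ, b = q ^ (2 * (1 + (k : ℤ))) * a := by
  have hqc : (q : ℂ) ≠ 0 := by exact_mod_cast hq0.ne'
  have hi := (isSpaceIndex_pos (N := N) h1 h2).neg
  set f : ℕ → D := fun k => (g.p (-l))^[k] x with hf
  have fs : ∀ k, f (k + 1) = g.p (-l) (f k) := fun k => Function.iterate_succ_apply' _ _ _
  have A : ∀ k, g.dot N q l (f k) = (a : ℂ) • f k := by
    intro k
    induction k with
    | zero => exact ha
    | succ k ih =>
      rw [fs]
      have := LinearMap.congr_fun (p_commute_dot_self hrep hq0 h1 h2).2 (f k)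
      simp only [Module.End.mul_apply, ih, map_smul] at this
      exact this.symm
  have B : ∀ k, g.dot N q (l - 1) (f k) = ((((q ^ 2)⁻¹) ^ k * b : ℝ) : ℂ) • f k := by
    intro k
    induction k with
    | zero => rw [pow_zero, one_mul]; exact hb
    | succ k ih =>
      rw [fs, (dot_p_neg_of_lt hrep hq0 (show 0 ≤ l - 1 by omega) (by omega) h2).apply, ih,
        map_smul, smul_smul]
      push_cast
      congr 1
      ring
  have C : ∀ k, ‖f (k + 1)‖ ^ 2
      = ((q ^ rho N l) ^ 2)⁻¹ * (a - ((q ^ 2)⁻¹) ^ (k + 1) * b) * ‖f k‖ ^ 2 := by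
    intro k
    have e := inner_p_neg_p_neg hrep hq0 h1 h2 (f k) (f k)
    rw [← fs, LinearMap.sub_apply, LinearMap.smul_apply, A, B, smul_smul, ← sub_smul,
      inner_smul_right, inner_self_eq_ofReal, inner_self_eq_ofReal, qp_sq_inv] at e
    have e' : ‖f (k + 1)‖ ^ 2 = ((q ^ rho N l) ^ 2)⁻¹ *
        ((a - (q ^ 2)⁻¹ * (((q ^ 2)⁻¹) ^ k * b)) * ‖f k‖ ^ 2) := by exact_mod_cast e
    rw [e']; ring
  have hr : 0 < ((q ^ rho N l) ^ 2)⁻¹ := by positivity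
  -- If no power of $p^{-l}$ killed $x$, all the factors $a-q^{-2(k+1)}b$ would be nonnegative,
  -- although $q^{-2k}b$ is unbounded.
  have hex : ∃ k, f (k + 1) = 0 := by
    by_contra hne
    push Not at hne
    have hle : ∀ k, ((q ^ 2)⁻¹) ^ (k + 1) * b ≤ a := by
      intro k
      have h3 : 0 < ‖f (k + 1)‖ ^ 2 := by have := hne k; positivity
      rw [C k] at h3
      by_contra hlt
      push Not at hlt
      have : ((q ^ rho N l) ^ 2)⁻¹ * (a - ((q ^ 2)⁻¹) ^ (k + 1) * b) * ‖f k‖ ^ 2 ≤ 0 :=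
        mul_nonpos_of_nonpos_of_nonneg
          (mul_nonpos_of_nonneg_of_nonpos hr.le (by linarith)) (sq_nonneg _)
      linarith
    obtain ⟨k, hk⟩ := pow_unbounded_of_one_lt (a / b)
      (show 1 < (q ^ 2)⁻¹ from one_lt_inv_iff₀.mpr ⟨by positivity, by nlinarith⟩)
    have h4 : ((q ^ 2)⁻¹) ^ k ≤ ((q ^ 2)⁻¹) ^ (k + 1) :=
      pow_le_pow_right₀ (one_le_inv_iff₀.mpr ⟨by positivity, by nlinarith⟩) (Nat.le_succ k)
    rw [div_lt_iff₀ hb0] at hk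
    have := hle k
    nlinarith
  classical
  have hk := Nat.find_spec hex
  set k := Nat.find hex with hkdef
  have hfk : f k ≠ 0 := by
    rcases Nat.eq_zero_or_pos k with h | h
    · rw [h]; exact hx
    · have := Nat.find_min hex (m := k - 1) (by omega)
      rwa [Nat.sub_add_cancel h] at this
  refine ⟨k, ?_⟩
  have e := C k
  rw [hk, norm_zero, zero_pow two_ne_zero, eq_comm, mul_eq_zero, mul_eq_zero] at e
  have hn : ‖f k‖ ^ 2 ≠ 0 := by positivity
  have e : a = ((q ^ 2)⁻¹) ^ (k + 1) * b := by
    rcases e with (e | e) | e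
    · exact absurd e hr.ne'
    · linarith
    · exact absurd e hn
  rw [e, show 2 * (1 + (k : ℤ)) = ((2 * (k + 1) : ℕ) : ℤ) by push_cast; ring, zpow_natCast,
    pow_mul, ← mul_assoc, ← mul_pow, mul_inv_cancel₀ (by positivity), one_pow, one_mul]

/-- The half-open intervals $(q^{2(t+1)},q^{2t}]$ tile the positive reals. The interval found below
is in powers of $q^{-2}$, whence the sign and the shift by one in the witness. -/
lemma exists_offset (hq0 : 0 < q) (hq1 : q < 1) {κ : ℝ} (hκ : 0 < κ) :
    ∃ (lam : ℝ) (t : ℤ), q ^ 2 < lam ∧ lam ≤ 1 ∧ κ = lam * q ^ (2 * t) := by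
  have hq2 : 0 < q ^ 2 := by positivity
  obtain ⟨t, h1, h2⟩ := exists_mem_Ioc_zpow hκ
    (show 1 < (q ^ 2)⁻¹ from one_lt_inv_iff₀.mpr ⟨hq2, by nlinarith⟩)
  have hz : ∀ s : ℤ, ((q ^ 2)⁻¹) ^ s = (q ^ (2 * s))⁻¹ := fun s => by
    rw [inv_zpow, zpow_mul]; norm_cast
  rw [hz] at h1 h2
  have hp : 0 < q ^ (2 * (t + 1)) := by positivity
  have e : q ^ (2 * (t + 1)) = q ^ 2 * q ^ (2 * t) := by
    rw [mul_add, zpow_add₀ hq0.ne', mul_comm]; norm_cast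
  refine ⟨κ * q ^ (2 * (t + 1)), -(t + 1), ?_, ?_, ?_⟩
  · rw [inv_lt_iff_one_lt_mul₀ (by positivity)] at h1
    rw [e]; nlinarith
  · rwa [← inv_mul_cancel₀ hp.ne', mul_le_mul_iff_left₀ hp]
  · rw [mul_neg, zpow_neg, mul_assoc, mul_inv_cancel₀ hp.ne', mul_one]

/-- The given joint eigenvector lies in one of the joint eigenspaces of the theorem. -/
lemma exists_jointSpace (hN : 3 ≤ N) (hq0 : 0 < q) (hq1 : q < 1) (hrep : IsStarRep N q g)
    {φ : D} (hφ : IsJointEigenvector N q g φ) :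
    ∃ (c : SpectralData) (π j : ℤ → ℤ), 0 < c.M ∧ (c.ε = 1 ∨ c.ε = -1) ∧
      (∀ i, q ^ 2 < c.lam i ∧ c.lam i ≤ 1) ∧ φ ∈ g.jointSpace N q c π j := by
  obtain ⟨hne, ⟨b, hb⟩, ha, hn, hk⟩ := hφ
  have h0 := hh_nonneg N
  have hr1 := one_le_rk hN
  choose! a ha using ha
  have hre : ∀ l, hh N ≤ l → l ≤ rk N → g.dot N q l φ = ((a l).re : ℂ) • φ := fun l h1 h2 => by
    rw [eigenvalue_eq_re (inner_dot hrep hq0 (by omega) h2) hne (ha l h1 h2), ha l h1 h2]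
  have hnn : ∀ l, hh N ≤ l → l ≤ rk N → 0 ≤ (a l).re := fun l h1 h2 => by
    have := dot_nonneg hrep hq0 (m := l) (by omega) h2 φ
    rw [hre l h1 h2, inner_smul_right, inner_self_eq_ofReal, ← Complex.ofReal_mul,
      RCLike.re_to_complex, Complex.ofReal_re] at this
    exact nonneg_of_mul_nonneg_left this (by positivity)
  -- Downward from $l=n$: a zero at $l-1$ would propagate to $l$ by `dot_succ_eq_zero`.
  have hpos : ∀ l, l ≤ rk N → hh N ≤ l → g.dot N q l φ ≠ 0 := by
    intro l hl
    induction l, hl using Int.leInductionDown with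
    | base => exact fun _ => hn
    | pred k hk ih =>
      intro h1 h2
      refine ih (by omega) ?_
      have := dot_succ_eq_zero hrep hq0 (u := k - 1) h1 (by omega) h2
      rwa [sub_add_cancel] at this
  have hapos : ∀ l, hh N ≤ l → l ≤ rk N → 0 < (a l).re := fun l h1 h2 => by
    refine lt_of_le_of_ne (hnn l h1 h2) fun h => hpos l h2 h1 ?_
    rw [hre l h1 h2, ← h]; simp
  have hratio : ∀ l, hh N ≤ l → l < rk N →
      ∃ k : ℕ, (a l).re = q ^ (2 * (1 + (k : ℤ))) * (a (l + 1)).re := fun l h1 h2 =>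
    exists_ratio hrep hq0 hq1 (l := l + 1) (by omega) (by omega) hne (hre _ (by omega) (by omega))
      (by rw [add_sub_cancel_right]; exact hre l h1 h2.le) (hapos l h1 h2.le)
  choose! kk hkk using hratio
  choose! κ hκ using hk
  have hoff : ∀ i, ∃ (lam : ℝ) (t : ℤ), q ^ 2 < lam ∧ lam ≤ 1 ∧
      (1 ≤ i → i ≤ rk N → κ i = lam * q ^ (2 * t)) := fun i => by
    by_cases hi : 1 ≤ i ∧ i ≤ rk N
    · obtain ⟨lam, t, x1, x2, x3⟩ := exists_offset hq0 hq1 (hκ i hi.1 hi.2).1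
      exact ⟨lam, t, x1, x2, fun _ _ => x3⟩
    · exact ⟨1, 0, by nlinarith, le_rfl, fun y1 y2 => absurd ⟨y1, y2⟩ hi⟩
  choose lam t hlam1 hlam2 hlt using hoff
  set π : ℤ → ℤ := fun l => if l < rk N then (kk l : ℤ) else 0 with hπ
  -- The choice $\pi_n=0$ makes the exponent at $l=n$ equal to $1$, so the eigenvalue of $(p\cdot
  -- p)_n$ has to be $M^2q^2$.
  set M : ℝ := √(a (rk N)).re / q with hM
  have hMpos : 0 < M := div_pos (Real.sqrt_pos.mpr (hapos _ (hh_le_rk hN) le_rfl)) hq0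
  have hM2 : M ^ 2 = (a (rk N)).re / q ^ 2 := by
    rw [hM, div_pow, Real.sq_sqrt (hnn _ (hh_le_rk hN) le_rfl)]
  have hval : ∀ l, l ≤ rk N → hh N ≤ l → (a l).re = M ^ 2 * q ^ (2 * expSum N π l) := by
    intro l hl
    induction l, hl using Int.leInductionDown with
    | base =>
      intro _
      have : expSum N π (rk N) = 1 := by simp [expSum, hπ]
      rw [this, hM2, mul_one]
      norm_cast
      field_simp
    | pred k hk ih =>
      intro h1
      have e := hkk (k - 1) h1 (by omega)
      rw [sub_add_cancel, ih (by omega)] at e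
      have : π (k - 1) = kk (k - 1) := if_pos (by omega)
      rw [e, expSum_step N π (show k - 1 ≤ rk N by omega), sub_add_cancel,
        mul_add 2 (1 + π (k - 1)), zpow_add₀ hq0.ne', this]
      ring
  obtain ⟨ε, hε, hp⟩ : ∃ ε : ℝ, (ε = 1 ∨ ε = -1) ∧
      (¬ Even N → g.p 0 φ = pVal N q ⟨M, ε, lam⟩ π • φ) := by
    by_cases hE : Even N
    · exact ⟨1, Or.inl rfl, fun h => absurd hE h⟩
    · rw [lower_zero] at hb
      have hbr := eigenvalue_eq_re (inner_p_zero hrep) hne hb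
      rw [← hbr] at hb
      have e := hre 0 (hh_odd hE).le (by omega)
      rw [dot_zero g N hq0, LinearMap.smul_apply, Module.End.mul_apply, hb, map_smul, hb,
        smul_smul, smul_smul, hval 0 (by omega) (hh_odd hE).le] at e
      have e := smul_left_injective ℂ hne e
      have e : b.re ^ 2 = (M * √(1 + q⁻¹) * q ^ expSum N π 0) ^ 2 := by
        rw [mul_pow, mul_pow, Real.sq_sqrt (by positivity), ← zpow_natCast, ← zpow_natCast,
          ← zpow_natCast, ← zpow_mul]
        have e : 1 / (1 + q⁻¹) * b.re * b.re = M ^ 2 * q ^ (2 * expSum N π 0) := by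
          exact_mod_cast e
        have h1q : 1 + q⁻¹ ≠ 0 := by positivity
        rw [mul_assoc, one_div, inv_mul_eq_iff_eq_mul₀ h1q] at e
        rw [mul_comm (expSum N π 0)]
        push_cast
        norm_cast at e ⊢
        rw [sq, e]; ring
      rcases sq_eq_sq_iff_eq_or_eq_neg.mp e with e | e
      · refine ⟨1, Or.inl rfl, fun _ => ?_⟩
        rw [hb, pVal, e]; simp
      · refine ⟨-1, Or.inr rfl, fun _ => ?_⟩
        rw [hb, pVal, e]; simp
  refine ⟨⟨M, ε, lam⟩, π, t, hMpos, hε, fun i => ⟨hlam1 i, hlam2 i⟩, fun m h1 h2 => ?_,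
    fun i h1 h2 => ?_, hp⟩
  · rw [hre m h1 h2, hval m h2 h1]; rfl
  · rw [(hκ i h1 h2).2, hlt i h1 h2]; rfl

end Spectrum

/-! ### Decomposition of the representation into joint eigenspaces. -/

section Spectral

variable {D : Type*} [NormedAddCommGroup D] [InnerProductSpace ℂ D]

section Countability

/-- Gram–Schmidt on a countable spanning sequence. Without completeness an orthonormal basis in the
algebraic sense needs countable dimension. Entries that depend on earlier ones become $0$ and are
discarded through the index set. -/
lemma exists_orthonormal_seq_span {V : Submodule ℂ D} (hD : Module.rank ℂ D ≤ Cardinal.aleph0) :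
    ∃ b : ℕ → D, Orthonormal ℂ (fun i : {i | b i ≠ 0} => b i) ∧
      Submodule.span ℂ (Set.range b) = V := by
  obtain ⟨f, hf⟩ : ∃ f : ℕ → D, Submodule.span ℂ (Set.range f) = V := by
    let B := Module.Basis.ofVectorSpace ℂ V
    have hc : (Set.range fun i => (B i : D)).Countable := by
      have hV : Module.rank ℂ V ≤ Cardinal.aleph0 := (Submodule.rank_le V).trans hD
      rw [← B.mk_eq_rank'', Cardinal.mk_le_aleph0_iff] at hV
      exact Set.countable_range _
    obtain ⟨f, hf⟩ := (hc.insert 0).exists_eq_range (Set.insert_nonempty _ _)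
    refine ⟨f, ?_⟩
    rw [← hf, Submodule.span_insert_zero]
    have := congrArg (Submodule.map V.subtype) B.span_eq
    rw [Submodule.map_span, ← Set.range_comp, Submodule.map_top, Submodule.range_subtype] at this
    exact this
  refine ⟨InnerProductSpace.gramSchmidtNormed ℂ f, 
    InnerProductSpace.gramSchmidtNormed_orthonormal' f, ?_⟩
  rw [InnerProductSpace.span_gramSchmidtNormed_range, InnerProductSpace.span_gramSchmidt, hf]

/-- An irreducible representation has countable dimension. -/
lemma rank_le_aleph0 {N : ℕ} {g : Generators D} (hirr : IsIrreducibleRep N g) :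
    Module.rank ℂ D ≤ Cardinal.aleph0 := by
  obtain ⟨hnt, hirr⟩ := hirr
  obtain ⟨φ, hφ⟩ := exists_ne (0 : D)
  let gen : ℤ ⊕ (ℤ × ℤ) ⊕ ℤ ⊕ Bool → Module.End ℂ D := fun s => match s with
    | .inl i => g.p i
    | .inr (.inl a) => g.L a.1 a.2
    | .inr (.inr (.inl i)) => g.k i
    | .inr (.inr (.inr true)) => g.Lam
    | .inr (.inr (.inr false)) => g.LamInv
  -- Words in the generators applied to one nonzero vector span an invariant subspace, and there are
  -- countably many words. Operators with indices outside the range may occur among the letters;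
  -- this does no harm.
  let w : List (ℤ ⊕ (ℤ × ℤ) ⊕ ℤ ⊕ Bool) → D := fun l => (l.map gen).prod φ
  have hinv : ∀ s, ∀ x ∈ Submodule.span ℂ (Set.range w), gen s x ∈ Submodule.span ℂ (Set.range w) := by
    intro s x hx
    have : Submodule.span ℂ (Set.range w) ≤ (Submodule.span ℂ (Set.range w)).comap (gen s) := by
      rw [Submodule.span_le]
      rintro _ ⟨l, rfl⟩
      exact Submodule.subset_span ⟨s :: l, by simp [w]⟩
    exact this hx
  have htop : Submodule.span ℂ (Set.range w) = ⊤ := by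
    refine (hirr _ (fun i _ => hinv (.inl i)) (fun u v _ x hx => ⟨hinv (.inr (.inl (-u, v))) x hx,
      hinv (.inr (.inl (-v, u))) x hx⟩) (fun i _ _ x hx => ⟨hinv (.inr (.inr (.inl i))) x hx,
      hinv (.inr (.inr (.inl (-i)))) x hx⟩) (fun x hx => ⟨hinv (.inr (.inr (.inr true))) x hx,
      hinv (.inr (.inr (.inr false))) x hx⟩)).resolve_left fun h => hφ ?_
    have : φ ∈ Submodule.span ℂ (Set.range w) := Submodule.subset_span ⟨[], rfl⟩
    rwa [h, Submodule.mem_bot] at this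
  rw [← rank_top ℂ D, ← htop]
  exact (rank_span_le _).trans (Cardinal.mk_le_aleph0_iff.mpr (Set.countable_range w))

end Countability

/-- The standing hypotheses: a `*`-representation with spectral data `c` which is spanned by joint
eigenvectors. -/
structure IsSpectral (N : ℕ) (q : ℝ) (g : Generators D) (c : SpectralData) : Prop where
  hN : 3 ≤ N
  hq0 : 0 < q
  hq1 : q < 1
  rep : IsStarRep N q g
  M_pos : 0 < c.M
  ε_sq : c.ε ^ 2 = 1
  lam_mem : ∀ i, q ^ 2 < c.lam i ∧ c.lam i ≤ 1
  span_eq_top : Submodule.span ℂ {x | ∃ π j, x ∈ g.jointSpace N q c π j} = ⊤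

/-- Normalized labels `(π, j)`. -/
def IsPairLabel (N : ℕ) (π j : ℤ → ℤ) : Prop :=
  IsMomentumLabel N π ∧ ∀ i, (i < 1 ∨ rk N < i) → j i = 0

variable {N : ℕ} {q : ℝ} {g : Generators D} {c : SpectralData} {π π' j j' : ℤ → ℤ}

/-- The span of the joint eigenvectors is invariant, so irreducibility applies. For a root, the
corrected vector and the correction both lie in the span, hence so does their difference. -/
lemma isSpectral_of_mem (hN : 3 ≤ N) (hq0 : 0 < q) (hq1 : q < 1) (hrep : IsStarRep N q g)
    (hirr : IsIrreducibleRep N g) (hM : 0 < c.M) (hε : c.ε ^ 2 = 1)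
    (hlam : ∀ i, q ^ 2 < c.lam i ∧ c.lam i ≤ 1) {φ : D} (hφ : φ ≠ 0)
    (h : φ ∈ g.jointSpace N q c π j) : IsSpectral N q g c := by
  refine ⟨hN, hq0, hq1, hrep, hM, hε, hlam, ?_⟩
  set W := Submodule.span ℂ {x | ∃ π j, x ∈ g.jointSpace N q c π j} with hW
  have sub : ∀ {π j x}, x ∈ g.jointSpace N q c π j → x ∈ W :=
    fun {π j x} hx => Submodule.subset_span ⟨π, j, hx⟩
  have ind : ∀ X : Module.End ℂ D, (∀ π j x, x ∈ g.jointSpace N q c π j → X x ∈ W) →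
      ∀ x ∈ W, X x ∈ W := fun X hX x hx => by
    have : W ≤ W.comap X := by
      rw [hW, Submodule.span_le]
      rintro x ⟨π, j, hx⟩
      exact hX π j x hx
    exact this hx
  refine (hirr.2 W (fun i hi => ind _ fun π j x hx => sub (p_mem_jointSpace hrep hq0 hi hx))
    (fun u v huv x hx => ⟨ind _ (fun π j x hx => ?_) x hx, ind _ (fun π j x hx => ?_) x hx⟩)
    (fun i h1 h2 x hx => ⟨ind _ (fun π j x hx => ?_) x hx, ind _ (fun π j x hx => ?_) x hx⟩)
    (fun x hx => ⟨ind _ (fun π j x hx => sub (lam_mem_jointSpace hN hrep hq0 hx)) x hx,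
      ind _ (fun π j x hx => sub (lamInv_mem_jointSpace hN hrep hq0 hx)) x hx⟩)).resolve_left
    fun h0 => hφ ?_
  · obtain ⟨-, h2, h3, -, h5, -⟩ := huv.bounds hN
    exact (Submodule.add_mem_iff_left W (W.smul_mem _ (sub (p_mem_jointSpace hrep hq0 h5.neg
      (p_mem_jointSpace hrep hq0 (isSpaceIndex_pos h2 h3) hx))))).mp
      (sub (pos_mem_jointSpace hN hrep hq0 hq1 hM hε huv hx))
  · obtain ⟨-, h2, h3, -, h5, -⟩ := huv.bounds hN
    exact (Submodule.add_mem_iff_left W (W.smul_mem _ (sub (p_mem_jointSpace hrep hq0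
      (isSpaceIndex_pos h2 h3).neg (p_mem_jointSpace hrep hq0 h5 hx))))).mp
      (sub (neg_mem_jointSpace hN hrep hq0 hq1 hM hε huv hx))
  · rw [hx.2.1 i h1 h2]; exact W.smul_mem _ (sub hx)
  · rw [k_neg_mem_jointSpace hrep hq0 h1 h2 (lt_trans (by positivity) (hlam i).1) hx]
    exact W.smul_mem _ (sub hx)
  · have := sub h
    rwa [h0, Submodule.mem_bot] at this

/-- Consecutive exponents differ by $1+\pi_m$, so the eigenvalues of the invariants determine the
momentum label. -/
lemma expSum_injective (hπ : IsMomentumLabel N π) (hπ' : IsMomentumLabel N π')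
    (h : ∀ m, hh N ≤ m → m ≤ rk N → expSum N π m = expSum N π' m) : π = π' := by
  funext l
  by_cases hl : hh N ≤ l ∧ l ≤ rk N
  · have e := h l hl.1 hl.2
    rw [expSum_step N π hl.2, expSum_step N π' hl.2] at e
    rcases hl.2.eq_or_lt with rfl | hlt
    · simp only [expSum, Finset.Icc_eq_empty_of_lt (lt_add_one (rk N)), Finset.sum_empty] at e
      omega
    · rw [h (l + 1) (by omega) (by omega)] at e; omega
  · rw [hπ.1 l (by omega), hπ'.1 l (by omega)]

lemma inner_eq_zero_of_eigenvalue_ne {X : Module.End ℂ D}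
    (hX : ∀ x y : D, inner ℂ (X x) y = inner ℂ x (X y)) {x y : D} {a b : ℝ}
    (hx : X x = (a : ℂ) • x) (hy : X y = (b : ℂ) • y) (hab : a ≠ b) : inner ℂ x y = 0 := by
  have := hX x y
  rw [hx, hy, inner_smul_left, inner_smul_right, Complex.conj_ofReal, ← sub_eq_zero, ← sub_mul,
    mul_eq_zero, sub_eq_zero] at this
  exact this.resolve_left (by exact_mod_cast hab)

namespace IsSpectral

variable (hs : IsSpectral N q g c)
include hs

lemma inner_eq_zero (h : IsPairLabel N π j) (h' : IsPairLabel N π' j')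
    (hne : π ≠ π' ∨ j ≠ j') {x y : D} (hx : x ∈ g.jointSpace N q c π j)
    (hy : y ∈ g.jointSpace N q c π' j') : inner ℂ x y = 0 := by
  have h0 := hh_nonneg N
  have hinj : ∀ {a b : ℤ}, q ^ (2 * a) = q ^ (2 * b) → a = b := fun {a b} e => by
    have := zpow_right_injective₀ hs.hq0 hs.hq1.ne e
    omega
  by_contra hxy
  have hπ : π = π' := expSum_injective h.1 h'.1 fun m h1 h2 => by
    by_contra hm
    refine hxy (inner_eq_zero_of_eigenvalue_ne (inner_dot hs.rep hs.hq0 (by omega) h2)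
      (hx.1 m h1 h2) (hy.1 m h1 h2) fun e => hm (hinj ?_))
    exact mul_left_cancel₀ (pow_ne_zero 2 hs.M_pos.ne') e
  have hj : j = j' := by
    funext i
    by_cases hi : 1 ≤ i ∧ i ≤ rk N
    · by_contra hm
      refine hxy (inner_eq_zero_of_eigenvalue_ne (hs.rep.star_k i hi.1 hi.2)
        (hx.2.1 i hi.1 hi.2) (hy.2.1 i hi.1 hi.2) fun e => hm (hinj ?_))
      exact mul_left_cancel₀ (lt_trans (pow_pos hs.hq0 2) (hs.lam_mem i).1).ne' e
    · rw [h.2 i (by omega), h'.2 i (by omega)]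
  tauto

/-- Components outside the relevant range are irrelevant to the eigenspace and are set to zero.
Nonnegativity of $\pi_l$ for $l<n$ is forced by $x\ne0$. -/
lemma exists_label {x : D} (hx : x ∈ g.jointSpace N q c π j) (h0 : x ≠ 0) :
    ∃ π' j', IsPairLabel N π' j' ∧ x ∈ g.jointSpace N q c π' j' := by
  refine ⟨fun l => if hh N ≤ l ∧ l ≤ rk N then π l else 0,
    fun i => if 1 ≤ i ∧ i ≤ rk N then j i else 0, ⟨⟨fun l hl => if_neg (by omega),
    fun l h1 h2 => ?_⟩, fun i hi => if_neg (by omega)⟩, ?_⟩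
  · simp only [h1, h2.le, and_self, if_true]
    by_contra hneg
    exact h0 (eq_zero_of_mem_jointSpace hs.rep hs.hq0 hs.hq1 hs.M_pos h1 h2 (not_le.mp hneg) hx)
  · rwa [jointSpace_congr (π' := π) (j' := j)]
    · intro l h1 h2; simp [h1, h2]
    · intro i h1 h2; simp [h1, h2]

lemma span_labels_eq_top :
    Submodule.span ℂ {x | ∃ π j, IsPairLabel N π j ∧ x ∈ g.jointSpace N q c π j} = ⊤ := by
  rw [eq_top_iff, ← hs.span_eq_top, Submodule.span_le]
  rintro x ⟨π, j, hx⟩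
  rcases eq_or_ne x 0 with rfl | h0
  · exact zero_mem _
  · obtain ⟨π', j', h1, h2⟩ := hs.exists_label hx h0
    exact Submodule.subset_span ⟨π', j', h1, h2⟩

lemma ext_jointSpace {A B : Module.End ℂ D}
    (h : ∀ π j, IsPairLabel N π j → ∀ x ∈ g.jointSpace N q c π j, A x = B x) : A = B := by
  refine LinearMap.ext_on hs.span_labels_eq_top ?_
  rintro x ⟨π, j, h1, h2⟩
  exact h π j h1 x h2

/-- Linear operators may be prescribed on the joint eigenspaces. -/
lemma exists_end (f : (ℤ → ℤ) → (ℤ → ℤ) → Module.End ℂ D) :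
    ∃ F : Module.End ℂ D, ∀ π j, IsPairLabel N π j → ∀ x ∈ g.jointSpace N q c π j,
      F x = f π j x := by
  classical
  let ι := {s : (ℤ → ℤ) × (ℤ → ℤ) // IsPairLabel N s.1 s.2}
  let A : ι → Submodule ℂ D := fun s => g.jointSpace N q c s.1.1 s.1.2
  have hA : OrthogonalFamily ℂ (fun i => A i) fun i => (A i).subtypeₗᵢ := by
    intro s t hst x y
    refine hs.inner_eq_zero s.2 t.2 ?_ x.2 y.2
    by_contra h
    push Not at h
    exact hst (Subtype.ext (Prod.ext h.1 h.2))
  have hint : DirectSum.IsInternal A := by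
    rw [DirectSum.isInternal_submodule_iff_iSupIndep_and_iSup_eq_top]
    refine ⟨hA.independent, ?_⟩
    rw [eq_top_iff, ← hs.span_labels_eq_top, Submodule.span_le]
    rintro x ⟨π, j, h1, h2⟩
    exact Submodule.mem_iSup_of_mem (⟨(π, j), h1⟩ : ι) h2
  let e := LinearEquiv.ofBijective (DirectSum.coeLinearMap A) hint
  refine ⟨(DirectSum.toModule ℂ ι D fun s => (f s.1.1 s.1.2).comp (A s).subtype).comp
    e.symm.toLinearMap, fun π j h x hx => ?_⟩
  have : e.symm x = DirectSum.lof ℂ ι (fun s => A s) ⟨(π, j), h⟩ ⟨x, hx⟩ := by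
    rw [LinearEquiv.symm_apply_eq]
    exact (DirectSum.coeLinearMap_lof A ⟨(π, j), h⟩ ⟨x, hx⟩).symm
  simp [this]

lemma isUnit_dot {m : ℤ} (h1 : hh N ≤ m) (h2 : m ≤ rk N) : IsUnit (g.dot N q m) := by
  obtain ⟨F, hF⟩ := hs.exists_end fun π _ => (dotVal N q c π m)⁻¹ • (1 : Module.End ℂ D)
  have hne := fun π => dotVal_ne_zero (N := N) hs.hq0 hs.M_pos π m
  refine ⟨⟨g.dot N q m, F, hs.ext_jointSpace fun π j h x hx => ?_,
    hs.ext_jointSpace fun π j h x hx => ?_⟩, rfl⟩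
  · rw [Module.End.mul_apply, hF π j h x hx]
    simp [hx.1 m h1 h2, hne π]
  · rw [Module.End.mul_apply, hx.1 m h1 h2, map_smul, hF π j h x hx]
    simp [hne π]

lemma inverse_dot_apply {m : ℤ} (h1 : hh N ≤ m) (h2 : m ≤ rk N) {x : D} {a : ℂ} (ha : a ≠ 0)
    (h : g.dot N q m x = a • x) : Ring.inverse (g.dot N q m) x = a⁻¹ • x := by
  have e := LinearMap.congr_fun (Ring.inverse_mul_cancel _ (hs.isUnit_dot h1 h2)) x
  rw [Module.End.mul_apply, h, map_smul] at e
  rw [eq_inv_smul_iff₀ ha]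
  exact e

/-- The inverse of $(p\cdot p)_{v-1}$ acts after $p^{-u}p^v$, which has multiplied its eigenvalue by
$q^2$; this cancels the $q^2$ in the definition. -/
lemma newPos_apply {u v : ℤ} (h : IsSimpleRoot N u v) {x : D}
    (hx : x ∈ g.jointSpace N q c π j) :
    g.newPos N q u v x = g.L (-u) v x + (qp q (rho N v) ^ 2 / ((1 - (q : ℂ) ^ 2) *
      dotVal N q c π (v - 1))) • g.p (-u) (g.p v x) := by
  have ⟨h1, h2, h3, h4, h5, h6, h7⟩ := h.bounds hs.hN
  have hqc : (q : ℂ) ≠ 0 := by exact_mod_cast hs.hq0.ne'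
  have h0 := hh_nonneg N
  have hc := dotVal_ne_zero (N := N) hs.hq0 hs.M_pos π (v - 1)
  have hq2 := one_sub_sq_ne_zero hs.hq0 hs.hq1
  have e : g.dot N q (v - 1) (g.p (-u) (g.p v x))
      = ((q : ℂ) ^ 2 * dotVal N q c π (v - 1)) • g.p (-u) (g.p v x) := by
    have hw := p_mem_jointSpace hs.rep hs.hq0 h5.neg
      (p_mem_jointSpace hs.rep hs.hq0 (isSpaceIndex_pos h2 h3) hx)
    rw [hw.1 (v - 1) (by omega) (by omega), dotVal_shift (t := 1) hs.hq0]
    · norm_cast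
    · rw [expSum_mstep h5.neg (by omega), expSum_mstep (isSpaceIndex_pos h2 h3) (by omega),
        add_assoc, lowStep_root hs.hN h (by omega), if_pos rfl]
  have e' := hs.inverse_dot_apply (by omega) (by omega) (mul_ne_zero (pow_ne_zero 2 hqc) hc) e
  unfold Generators.newPos
  rw [LinearMap.add_apply, LinearMap.smul_apply, Module.End.mul_apply, Module.End.mul_apply, e',
    smul_smul, qp_two_mul_add_two hs.hq0]
  congr 2
  field_simp

lemma newNeg_apply {u v : ℤ} (h : IsSimpleRoot N u v) {x : D}
    (hx : x ∈ g.jointSpace N q c π j) :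
    g.newNeg N q u v x = g.L (-v) u x + (qp q (rho N v) ^ 2 * (q : ℂ) ^ 3 / ((1 - (q : ℂ) ^ 2) *
      dotVal N q c π (v - 1))) • g.p (-v) (g.p u x) := by
  have ⟨h1, h2, h3, h4, h5, h6, h7⟩ := h.bounds hs.hN
  have hqc : (q : ℂ) ≠ 0 := by exact_mod_cast hs.hq0.ne'
  have h0 := hh_nonneg N
  have hc := dotVal_ne_zero (N := N) hs.hq0 hs.M_pos π (v - 1)
  have hq2 := one_sub_sq_ne_zero hs.hq0 hs.hq1
  have e : g.dot N q (v - 1) (g.p (-v) (g.p u x))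
      = (((q : ℂ) ^ 2)⁻¹ * dotVal N q c π (v - 1)) • g.p (-v) (g.p u x) := by
    have hv := isSpaceIndex_pos h2 h3
    have hw := p_mem_jointSpace hs.rep hs.hq0 hv.neg (p_mem_jointSpace hs.rep hs.hq0 h5 hx)
    rw [hw.1 (v - 1) (by omega) (by omega), dotVal_shift (t := -1) hs.hq0]
    · congr 2
    · have e := expSum_mstep (π := π + mstep N u + mstep N (-v)) hv (m := v - 1) (by omega)
      have e' := expSum_mstep (π := π + mstep N u + mstep N (-v) + mstep N v) h5.neg (m := v - 1)
        (by omega)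
      have := lowStep_root hs.hN h (m := v - 1) (by omega)
      rw [if_pos rfl] at this
      rw [show π + mstep N u + mstep N (-v) + mstep N v + mstep N (-u) = π by
        rw [mstep_neg, mstep_neg]; abel] at e'
      omega
  have e' := hs.inverse_dot_apply (by omega) (by omega) (mul_ne_zero
    (inv_ne_zero (pow_ne_zero 2 hqc)) hc) e
  unfold Generators.newNeg
  rw [LinearMap.add_apply, LinearMap.smul_apply, Module.End.mul_apply, Module.End.mul_apply, e',
    smul_smul, qp_two_mul_add_one hs.hq0]
  congr 2
  field_simp

lemma newPos_mem {u v : ℤ} (h : IsSimpleRoot N u v) {x : D}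
    (hx : x ∈ g.jointSpace N q c π j) :
    g.newPos N q u v x ∈ g.jointSpace N q c π (j + yy v - yy u) := by
  have hqc : (q : ℂ) ≠ 0 := by exact_mod_cast hs.hq0.ne'
  rw [hs.newPos_apply h hx]
  convert pos_mem_jointSpace hs.hN hs.rep hs.hq0 hs.hq1 hs.M_pos hs.ε_sq h hx using 3
  rw [qp_two_mul_add_two hs.hq0]
  field_simp

lemma newNeg_mem {u v : ℤ} (h : IsSimpleRoot N u v) {x : D}
    (hx : x ∈ g.jointSpace N q c π j) :
    g.newNeg N q u v x ∈ g.jointSpace N q c π (j - yy v + yy u) := by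
  have hqc : (q : ℂ) ≠ 0 := by exact_mod_cast hs.hq0.ne'
  rw [hs.newNeg_apply h hx]
  convert neg_mem_jointSpace hs.hN hs.rep hs.hq0 hs.hq1 hs.M_pos hs.ε_sq h hx using 3
  rw [qp_two_mul_add_one hs.hq0]
  field_simp

end IsSpectral

end Spectral

/-! ### Isometric parts of the momenta and towers over ground spaces. -/

section Isometries

variable {D : Type*} [NormedAddCommGroup D] [InnerProductSpace ℂ D]
variable {N : ℕ} {q : ℝ} {g : Generators D} {c : SpectralData} {π π' j j' δ δ' η η' : ℤ → ℤ}

lemma IsPairLabel.add (h : IsPairLabel N π j) (h' : IsPairLabel N π' j') :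
    IsPairLabel N (π + π') (j + j') :=
  ⟨⟨fun l hl => by simp [h.1.1 l hl, h'.1.1 l hl],
    fun l h1 h2 => add_nonneg (h.1.2 l h1 h2) (h'.1.2 l h1 h2)⟩,
    fun i hi => by simp [h.2 i hi, h'.2 i hi]⟩

lemma isPairLabel_zero : IsPairLabel N 0 0 := ⟨⟨fun _ _ => rfl, fun _ _ _ => le_rfl⟩, fun _ _ => rfl⟩

lemma isPairLabel_step {l : ℤ} (h1 : 1 ≤ l) (h2 : l ≤ rk N) : IsPairLabel N (mstep N l) (yy l) := by
  have h0 := hh_nonneg N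
  refine ⟨⟨fun k hk => ?_, fun k hk1 hk2 => ?_⟩, fun i hi => ?_⟩
  · unfold mstep
    split_ifs
    · simp [ee, Pi.single_apply]; omega
    · omega
    · rfl
  · unfold mstep
    split_ifs
    · simp only [ee, Pi.single_apply]; split_ifs <;> omega
    · omega
    · exact le_rfl
  · rw [yy, if_pos (by omega), Pi.single_apply, if_neg (by omega)]

lemma IsPairLabel.neg_right (h : IsPairLabel N 0 η) : IsPairLabel N 0 (-η) :=
  ⟨h.1, fun i hi => by simp [h.2 i hi]⟩

/-- `U` shifts all labels by `(δ, η)`, mapping joint eigenspaces isometrically onto each other. -/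
structure IsShift (N : ℕ) (q : ℝ) (g : Generators D) (c : SpectralData) (U : Module.End ℂ D)
    (δ η : ℤ → ℤ) : Prop where
  label : IsPairLabel N δ η
  map : ∀ π j, IsPairLabel N π j → ∀ x ∈ g.jointSpace N q c π j,
    U x ∈ g.jointSpace N q c (π + δ) (j + η)
  isometry : ∀ π j, IsPairLabel N π j → ∀ x ∈ g.jointSpace N q c π j,
    ∀ y ∈ g.jointSpace N q c π j, inner ℂ (U x) (U y) = inner ℂ x y
  surj : ∀ π j, IsPairLabel N π j → ∀ y ∈ g.jointSpace N q c (π + δ) (j + η),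
    ∃ x ∈ g.jointSpace N q c π j, U x = y

namespace IsShift

lemma one : IsShift N q g c 1 0 0 where
  label := isPairLabel_zero
  map π j _ x hx := by simpa using hx
  isometry _ _ _ _ _ _ _ := rfl
  surj π j _ y hy := ⟨y, by simpa using hy, rfl⟩

lemma mul {U U' : Module.End ℂ D} (h' : IsShift N q g c U' δ' η') (h : IsShift N q g c U δ η) :
    IsShift N q g c (U' * U) (δ + δ') (η + η') where
  label := h.label.add h'.label
  map π j hl x hx := by
    rw [← add_assoc, ← add_assoc]
    exact h'.map _ _ (hl.add h.label) _ (h.map π j hl x hx)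
  isometry π j hl x hx y hy := by
    rw [Module.End.mul_apply, Module.End.mul_apply, h'.isometry _ _ (hl.add h.label) _
      (h.map π j hl x hx) _ (h.map π j hl y hy), h.isometry π j hl x hx y hy]
  surj π j hl y hy := by
    rw [← add_assoc, ← add_assoc] at hy
    obtain ⟨z, hz, rfl⟩ := h'.surj _ _ (hl.add h.label) y hy
    obtain ⟨x, hx, rfl⟩ := h.surj π j hl z hz
    exact ⟨x, hx, rfl⟩

lemma pow {U : Module.End ℂ D} (h : IsShift N q g c U δ η) (k : ℕ) :
    IsShift N q g c (U ^ k) (k • δ) (k • η) := by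
  induction k with
  | zero => simpa using one
  | succ k ih => rw [pow_succ', succ_nsmul, succ_nsmul]; exact h.mul ih

/-- Restricted to $\delta=0$ because a negative shift of $\pi$ could leave the admissible labels,
whereas $j$ may be any integer vector. -/
lemma inverse {U V : Module.End ℂ D} (h : IsShift N q g c U 0 η) (h2 : V * U = 1) : IsShift N q g c V 0 (-η) := by
  have hl' := h.label.neg_right
  have key : ∀ π j, IsPairLabel N π j → ∀ y ∈ g.jointSpace N q c π j,
      ∃ x ∈ g.jointSpace N q c (π + 0) (j + -η), U x = y := fun π j hl y hy =>
    h.surj _ _ (hl.add hl') y (by simpa using hy)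
  have hV : ∀ x, V (U x) = x := fun x => LinearMap.congr_fun h2 x
  refine ⟨hl', fun π j hl y hy => ?_, fun π j hl y hy z hz => ?_, fun π j hl y hy => ?_⟩
  · obtain ⟨x, hx, rfl⟩ := key π j hl y hy
    rwa [hV]
  · obtain ⟨x, hx, rfl⟩ := key π j hl y hy
    obtain ⟨x', hx', rfl⟩ := key π j hl z hz
    rw [hV, hV, h.isometry _ _ (hl.add hl') x hx x' hx']
  · exact ⟨U y, by simpa using h.map _ _ (hl.add hl') y hy, hV y⟩

lemma zpow {U : (Module.End ℂ D)ˣ} (h : IsShift N q g c (U : Module.End ℂ D) 0 η) (k : ℤ) :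
    IsShift N q g c ((U ^ k : (Module.End ℂ D)ˣ) : Module.End ℂ D) 0 (k • η) := by
  cases k with
  | ofNat k => simpa using h.pow k
  | negSucc k =>
    have := (by simpa using h.pow (k + 1) :
      IsShift N q g c ((U : Module.End ℂ D) ^ (k + 1)) 0 ((k + 1) • η)).inverse
      (V := ((U ^ (k + 1))⁻¹ : (Module.End ℂ D)ˣ))
      (by rw [← Units.val_pow_eq_pow_val, Units.inv_mul])
    rw [zpow_negSucc, negSucc_zsmul]
    exact this

/-- Shift operators map nonzero joint eigenspaces to nonzero ones, in both directions. -/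
lemma eq_bot_iff {U : Module.End ℂ D} (h : IsShift N q g c U δ η) (hl : IsPairLabel N π j) :
    g.jointSpace N q c (π + δ) (j + η) = ⊥ ↔ g.jointSpace N q c π j = ⊥ := by
  rw [Submodule.eq_bot_iff, Submodule.eq_bot_iff]
  constructor
  · intro h0 x hx
    have e := h.isometry π j hl x hx x hx
    rw [h0 _ (h.map π j hl x hx), inner_zero_left, eq_comm] at e
    exact inner_self_eq_zero.mp e
  · intro h0 y hy
    obtain ⟨x, hx, rfl⟩ := h.surj π j hl y hy
    rw [h0 x hx, map_zero]

end IsShift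

lemma IsPairLabel.nonneg_pred (h : IsPairLabel N π j) {l : ℤ} (h2 : l ≤ rk N) (h1 : hh N < l) :
    0 ≤ π (l - 1) := h.1.2 (l - 1) (by omega) (by omega)

namespace IsSpectral

variable (hs : IsSpectral N q g c)

/-- The partial isometry in the polar decomposition of `p^l`. -/
def step (l : ℤ) : Module.End ℂ D :=
  Classical.choose (hs.exists_end fun π _ => (stepVal N q c l π : ℂ)⁻¹ • g.p l)

lemma step_apply (l : ℤ) (h : IsPairLabel N π j) {x : D} (hx : x ∈ g.jointSpace N q c π j) :
    hs.step l x = (stepVal N q c l π : ℂ)⁻¹ • g.p l x :=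
  Classical.choose_spec (hs.exists_end fun π _ => (stepVal N q c l π : ℂ)⁻¹ • g.p l) π j h x hx

include hs in
lemma stepVal_ne_zero {l : ℤ} (h2 : l ≤ rk N) (h : IsPairLabel N π j) :
    (stepVal N q c l π : ℂ) ≠ 0 := by
  exact_mod_cast (stepVal_pos hs.hq0 hs.hq1 hs.M_pos (h.nonneg_pred h2)).ne'

lemma p_eq_step {l : ℤ} (h2 : l ≤ rk N) (h : IsPairLabel N π j) {x : D}
    (hx : x ∈ g.jointSpace N q c π j) :
    g.p l x = (stepVal N q c l π : ℂ) • hs.step l x := by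
  rw [hs.step_apply l h hx, smul_smul, mul_inv_cancel₀ (hs.stepVal_ne_zero h2 h), one_smul]

lemma p_neg_step {l : ℤ} (h1 : 1 ≤ l) (h2 : l ≤ rk N) (h : IsPairLabel N π j) {x : D}
    (hx : x ∈ g.jointSpace N q c π j) :
    g.p (-l) (hs.step l x) = ((qp q (rho N l))⁻¹ * (stepVal N q c l π : ℂ)) • x := by
  have hne := hs.stepVal_ne_zero h2 h
  rw [hs.step_apply l h hx, map_smul, p_neg_p_apply hs.rep hs.hq0 h1 h2 hx
    (stepGap_pos hs.hq0 hs.hq1 (h.nonneg_pred h2)).le, smul_smul]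
  congr 1
  field_simp

/-- Above an admissible label the matrix element of $p^l$ is positive, so $p^{-l}$, suitably scaled,
provides the preimages. -/
lemma isShift_step {l : ℤ} (h1 : 1 ≤ l) (h2 : l ≤ rk N) :
    IsShift N q g c (hs.step l) (mstep N l) (yy l) where
  label := isPairLabel_step h1 h2
  map π j h x hx := by
    rw [hs.step_apply l h hx]
    exact Submodule.smul_mem _ _ (p_mem_jointSpace hs.rep hs.hq0 (isSpaceIndex_pos h1 h2) hx)
  isometry π j h x hx y hy := by
    have hne := hs.stepVal_ne_zero h2 h
    rw [hs.step_apply l h hx, hs.step_apply l h hy, inner_smul_left, inner_smul_right,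
      inner_p_p_apply hs.rep hs.hq0 h1 h2 x hy
      (stepGap_pos hs.hq0 hs.hq1 (h.nonneg_pred h2)).le, map_inv₀, Complex.conj_ofReal]
    field_simp
  surj π j h y hy := by
    have hne := hs.stepVal_ne_zero h2 h
    have hr := qp_ne_zero hs.hq0 (rho N l)
    have hgap := (stepGap_pos hs.hq0 hs.hq1 (h.nonneg_pred h2)).le
    have hx : g.p (-l) y ∈ g.jointSpace N q c π j := by
      have := p_mem_jointSpace hs.rep hs.hq0 (isSpaceIndex_pos h1 h2).neg hy
      rwa [mstep_neg, yy_neg, add_neg_cancel_right, add_neg_cancel_right] at this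
    refine ⟨((stepVal N q c l π : ℂ)⁻¹ * qp q (rho N l)) • g.p (-l) y,
      Submodule.smul_mem _ _ hx, ?_⟩
    rw [hs.step_apply l h (Submodule.smul_mem _ _ hx), map_smul,
      p_p_neg_apply hs.rep hs.hq0 h1 h2 hy (by rwa [add_sub_cancel_right]),
      add_sub_cancel_right, smul_smul, smul_smul]
    convert one_smul ℂ y using 2
    field_simp

lemma stepVal_low_step {l l' : ℤ} (hq : 0 < q) (h1 : 1 ≤ l) (h : l < l') (h2 : l' ≤ rk N) :
    stepVal N q c l (π + mstep N l') = q * stepVal N q c l π := by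
  have := hh_le_one N
  have e : stepGap N q l (π + mstep N l') = stepGap N q l π := by
    unfold stepGap
    rw [mstep_of_lt (show hh N < l' by omega)]
    simp [ee, show l - 1 ≠ l' - 1 by omega]
  unfold stepVal
  rw [e, expSum_mstep (isSpaceIndex_pos (by omega) h2) (by omega), lowStep,
    abs_of_pos (by omega), if_pos h, if_pos (by omega), zpow_add₀ hq.ne', zpow_one]
  ring

lemma stepVal_high_step {l l' : ℤ} (h1 : 1 ≤ l) (h : l < l') (h2 : l' ≤ rk N) :
    stepVal N q c l' (π + mstep N l) = stepVal N q c l' π := by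
  have := hh_le_one N
  have e : stepGap N q l' (π + mstep N l) = stepGap N q l' π := by
    unfold stepGap mstep
    split_ifs <;> simp [ee, Pi.single_apply, show l' - 1 ≠ l - 1 by omega]
    have := hh_nonneg N
    omega
  unfold stepVal
  rw [e, expSum_mstep (isSpaceIndex_pos h1 (by omega)) (by omega), lowStep,
    abs_of_pos (by omega), if_neg (by omega), add_zero]

/-- The step $l'$ multiplies the matrix element of $p^l$ by $q$, while the step $l$ leaves that of
$p^{l'}$ unchanged. This $q$ cancels the one in $p^lp^{l'}=q\,p^{l'}p^l$. -/
lemma commute_step_of_lt {l l' : ℤ} (h1 : 1 ≤ l) (h : l < l') (h2 : l' ≤ rk N) :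
    Commute (hs.step l) (hs.step l') := by
  refine hs.ext_jointSpace fun π j hl x hx => ?_
  have hqc : (q : ℂ) ≠ 0 := by exact_mod_cast hs.hq0.ne'
  have hx1 := (hs.isShift_step (l := l) h1 (by omega)).map π j hl x hx
  have hx2 := (hs.isShift_step (l := l') (by omega) h2).map π j hl x hx
  have hl1 := hl.add (isPairLabel_step (N := N) h1 (by omega))
  have hl2 := hl.add (isPairLabel_step (N := N) (l := l') (by omega) h2)
  rw [Module.End.mul_apply, Module.End.mul_apply, hs.step_apply l hl2 hx2,
    hs.step_apply l' hl1 hx1, hs.step_apply l hl hx, hs.step_apply l' hl hx, map_smul, map_smul,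
    stepVal_low_step hs.hq0 h1 h h2, stepVal_high_step h1 h h2,
    (p_swap hs.rep (isSpaceIndex_pos h1 (by omega)) (isSpaceIndex_pos (by omega) h2) h
      (by omega)).apply, smul_smul, smul_smul, smul_smul]
  congr 1
  push_cast
  field_simp

lemma commute_step {l l' : ℤ} (h1 : 1 ≤ l) (h2 : l ≤ rk N) (h1' : 1 ≤ l') (h2' : l' ≤ rk N) :
    Commute (hs.step l) (hs.step l') := by
  rcases lt_trichotomy l l' with h | rfl | h
  · exact hs.commute_step_of_lt h1 h h2'
  · exact Commute.refl _
  · exact (hs.commute_step_of_lt h1' h h2).symm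

lemma mstep_one_even (hN : Even N) : mstep N 1 = 0 := by
  unfold mstep
  rw [hh_even hN]
  simp

/-- For even `N`, the unitary part of `p^1`; for odd `N`, the identity. -/
def unitStep : (Module.End ℂ D)ˣ := by
  classical
  -- Invertibility is automatic for even $N$ by `isUnit_step_one`; it is tested here only to obtain
  -- a unit, whose integer powers are needed since $j_1$ can be negative.
  exact if h : IsUnit (hs.step 1) ∧ Even N then h.1.unit else 1

/-- For even $N$ the momentum $p^1$ leaves $\pi$ unchanged, so its step can be undone on every
eigenspace. The inverse is $p^{-1}$ with the same scaling. -/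
lemma isUnit_step_one (hN : Even N) : IsUnit (hs.step 1) := by
  have h2 := one_le_rk hs.hN
  have hsh := hs.isShift_step le_rfl h2
  obtain ⟨F, hF⟩ := hs.exists_end fun π _ => (stepVal N q c 1 π : ℂ)⁻¹ • g.p (-1)
  have hm := mstep_one_even hN
  have hm' : mstep N (-1) = 0 := by rw [mstep_neg, hm, neg_zero]
  have hr := qp_rho_one_even hN q
  have hinv : ∀ π j, IsPairLabel N π j → ∀ x ∈ g.jointSpace N q c π j, F (hs.step 1 x) = x := by
    intro π j h x hx
    have hx' := hsh.map π j h x hx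
    have hl' := h.add hsh.label
    have hne := hs.stepVal_ne_zero h2 h
    rw [hF _ _ hl' _ hx', LinearMap.smul_apply, hs.p_neg_step le_rfl h2 h hx, hr, hm, add_zero,
      smul_smul, inv_one, one_mul, inv_mul_cancel₀ hne, one_smul]
  refine ⟨⟨hs.step 1, F, hs.ext_jointSpace fun π j h x hx => ?_, hs.ext_jointSpace hinv⟩, rfl⟩
  have hl := hsh.label
  rw [hm] at hl hsh
  have h' := h.add hl.neg_right
  obtain ⟨y, hy, rfl⟩ := hsh.surj _ _ h' x (by simpa using hx)
  rw [Module.End.mul_apply, hinv _ _ h' y hy]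
  rfl

lemma unitStep_even (hN : Even N) : (hs.unitStep : Module.End ℂ D) = hs.step 1 := by
  unfold unitStep
  rw [dif_pos ⟨hs.isUnit_step_one hN, hN⟩]
  rfl

lemma unitStep_odd (hN : ¬ Even N) : hs.unitStep = 1 := by
  unfold unitStep
  rw [dif_neg fun h => hN h.2]

/-- The ordered product of powers of the steps `p^l`, `h < l ≤ h + k`. -/
def stepProd (m : ℤ → ℕ) : ℕ → Module.End ℂ D
  | 0 => 1
  | k + 1 => hs.step (hh N + k + 1) ^ m (hh N + k + 1) * stepProd m k

lemma isShift_stepProd (hπ : IsMomentumLabel N π) (k : ℕ) (hk : hh N + k ≤ rk N) :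
    IsShift N q g c (hs.stepProd (fun l => (π (l - 1)).toNat) k)
      (fun l => if hh N ≤ l ∧ l < hh N + k then π l else 0)
      (fun l => if hh N < l ∧ l ≤ hh N + k then π (l - 1) else 0) := by
  have h0 := hh_nonneg N
  induction k with
  | zero =>
    convert IsShift.one (N := N) (q := q) (g := g) (c := c) using 1
    · rfl
    · funext l; exact if_neg (by push_cast; omega)
    · funext l; exact if_neg (by push_cast; omega)
  | succ k ih =>
    push_cast at hk
    have hp : 0 ≤ π (hh N + k) := hπ.2 _ (by omega) (by omega)
    convert ((hs.isShift_step (l := hh N + k + 1) (by omega) (by omega)).pow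
      (π (hh N + k)).toNat).mul (ih (by omega)) using 1
    · rw [stepProd, add_sub_cancel_right]
    · funext l
      rw [mstep_of_lt (by omega)]
      simp only [Pi.add_apply, Pi.smul_apply, ee, Pi.single_apply, add_sub_cancel_right]
      push_cast
      rcases eq_or_ne l (hh N + k) with rfl | hl
      · rw [if_pos (by omega), if_neg (by omega), if_pos rfl]
        simp [hp]
      · rw [if_neg hl, smul_zero, add_zero]
        congr 1
        apply propext; omega
    · funext l
      simp only [Pi.add_apply, Pi.smul_apply, yy, if_pos (show 0 < hh N + (k : ℤ) + 1 by omega),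
        Pi.single_apply]
      push_cast
      rcases eq_or_ne l (hh N + k + 1) with rfl | hl
      · rw [if_pos (by omega), if_neg (by omega), if_pos rfl, add_sub_cancel_right]
        simp [hp]
      · rw [if_neg hl, smul_zero, add_zero]
        congr 1
        apply propext; omega

/-- Because the steps commute, one more factor at position $l$ can be pulled out on the left. -/
lemma stepProd_succ {l : ℤ} (h1 : hh N < l) {m m' : ℤ → ℕ}
    (hl : m' l = m l + 1) (hm : ∀ i, i ≠ l → m' i = m i) (k : ℕ) (hk : hh N + k ≤ rk N) :
    hs.stepProd m' k = if l ≤ hh N + k then hs.step l * hs.stepProd m k else hs.stepProd m k := by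
  have h0 := hh_nonneg N
  induction k with
  | zero => rw [if_neg (by push_cast; omega)]; rfl
  | succ k ih =>
    push_cast at hk ⊢
    rw [stepProd, stepProd, ih (by omega)]
    rcases lt_trichotomy l (hh N + k + 1) with h | h | h
    · rw [if_pos (by omega), if_pos (by omega), hm _ (by omega), ← mul_assoc, ← mul_assoc,
        ((hs.commute_step (l := l) (l' := hh N + k + 1) (by omega) (by omega) (by omega)
          (by omega)).pow_right _).eq]
    · rw [if_neg (by omega), if_pos (by omega), ← h, hl, pow_succ', mul_assoc]
    · rw [if_neg (by omega), if_neg (by omega), hm _ (by omega)]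

/-- The operator that carries the ground space of a tower onto the joint eigenspace `(π, j)`. -/
def transport (π j : ℤ → ℤ) : Module.End ℂ D :=
  ((hs.unitStep ^ j 1 : (Module.End ℂ D)ˣ) : Module.End ℂ D) *
    hs.stepProd (fun l => (π (l - 1)).toNat) (rk N - hh N).toNat

end IsSpectral

/-- The momentum label of the ground space below `π`. -/
def groundπ (N : ℕ) (π : ℤ → ℤ) : ℤ → ℤ := fun l => if l = rk N then π l else 0

/-- The label of the `𝐤^i` on the ground space below `(π, j)`. -/
def groundj (N : ℕ) (π j : ℤ → ℤ) : ℤ → ℤ :=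
  fun l => if hh N < l ∧ l ≤ rk N then j l - π (l - 1) else 0

lemma isPairLabel_ground (hN : 3 ≤ N) (π j : ℤ → ℤ) :
    IsPairLabel N (groundπ N π) (groundj N π j) := by
  have h0 := hh_nonneg N
  have h1 := hh_le_rk hN
  refine ⟨⟨fun l hl => if_neg (by omega), fun l h1 h2 => ?_⟩, fun i hi => if_neg (by omega)⟩
  rw [groundπ, if_neg (by omega)]

namespace IsSpectral

variable (hs : IsSpectral N q g c)

/-- Each factor $p^l$ adds one to both $\pi_{l-1}$ and $j_l$, so $\pi_{l-1}$ factors account for the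
difference between $j_l$ and its ground value. For even $N$ the ground value of $j_1$ is $0$ and the
power of `unitStep` supplies $j_1$. -/
lemma isShift_transport (h : IsPairLabel N π j) : ∃ δ η, groundπ N π + δ = π ∧
    groundj N π j + η = j ∧ IsShift N q g c (hs.transport π j) δ η := by
  have h0 := hh_nonneg N
  have hn := hh_le_rk hs.hN
  have A := hs.isShift_stepProd h.1 (rk N - hh N).toNat (by omega)
  have hk : hh N + ((rk N - hh N).toNat : ℤ) = rk N := by omega
  rw [hk] at A
  by_cases hN : Even N
  · have B := hs.isShift_step le_rfl (one_le_rk hs.hN)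
    rw [mstep_one_even hN, ← hs.unitStep_even hN] at B
    refine ⟨_, _, ?_, ?_, (B.zpow (j 1)).mul A⟩
    · funext l
      simp only [groundπ, Pi.add_apply, Pi.zero_apply]
      split_ifs <;> first | omega | (rw [h.1.1 l (by omega)]; rfl)
    · funext l
      simp only [groundj, Pi.add_apply, Pi.smul_apply, yy, if_pos zero_lt_one, Pi.single_apply,
        hh_even hN]
      rcases eq_or_ne l 1 with rfl | hl
      · simp
      · rw [if_neg hl]
        split_ifs
        · simp
        · rw [h.2 l (by omega)]; simp
  · have B := IsShift.one (N := N) (q := q) (g := g) (c := c)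
    refine ⟨_, _, ?_, ?_, by rw [transport, hs.unitStep_odd hN, one_zpow]; exact B.mul A⟩
    · funext l
      simp only [groundπ, Pi.add_apply, Pi.zero_apply]
      split_ifs <;> first | omega | (rw [h.1.1 l (by omega)]; rfl)
    · funext l
      simp only [groundj, Pi.add_apply, Pi.zero_apply, hh_odd hN]
      split_ifs
      · omega
      · rw [h.2 l (by omega)]; rfl

/-- Transport is compatible with every step, which is why one basis of the ground space serves the
whole tower with the same degeneracy label. For $N$ even and $l=1$ the extra factor goes into
`unitStep`, otherwise into `stepProd`. -/
lemma transport_step {l : ℤ} (h1 : 1 ≤ l) (h2 : l ≤ rk N) (h : IsPairLabel N π j) :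
    hs.transport (π + mstep N l) (j + yy l) = hs.step l * hs.transport π j := by
  have h0 := hh_nonneg N
  have hk : hh N + ((rk N - hh N).toNat : ℤ) = rk N := by have := hh_le_rk hs.hN; omega
  unfold transport
  by_cases hl : hh N < l
  · have hU : Commute (hs.step l) ((hs.unitStep ^ j 1 : (Module.End ℂ D)ˣ) : Module.End ℂ D) := by
      by_cases hN : Even N
      · refine Commute.units_zpow_right ?_ _
        rw [hs.unitStep_even hN]
        exact hs.commute_step h1 h2 le_rfl (by omega)
      · rw [hs.unitStep_odd hN, one_zpow]; exact Commute.one_right _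
    have hj : hs.unitStep ^ (j + yy l) 1 = hs.unitStep ^ j 1 := by
      by_cases hN : Even N
      · congr 1
        rw [hh_even hN] at hl
        rw [Pi.add_apply, yy, if_pos (by omega), Pi.single_apply, if_neg (by omega), add_zero]
      · rw [hs.unitStep_odd hN, one_zpow, one_zpow]
    have hp := h.1.2 (l - 1) (by omega) (by omega)
    rw [hj, hs.stepProd_succ (l := l) (m := fun l => (π (l - 1)).toNat) hl ?_ ?_ _ hk.le, hk,
      if_pos h2, ← mul_assoc, ← mul_assoc, hU.eq]
    · rw [mstep_of_lt hl]
      simp only [Pi.add_apply, ee, Pi.single_eq_same]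
      omega
    · intro i hi
      rw [mstep_of_lt hl]
      simp [ee, show i - 1 ≠ l - 1 by omega]
  · have hN : Even N := by by_contra hN; rw [hh_odd hN] at hl; omega
    rw [hh_even hN] at hl
    obtain rfl : l = 1 := by omega
    rw [mstep_one_even hN, add_zero, ← mul_assoc, ← hs.unitStep_even hN, ← Units.val_mul,
      ← zpow_one_add, Pi.add_apply, yy, if_pos one_pos, Pi.single_eq_same, add_comm]

lemma groundπ_step {l : ℤ} (h1 : 1 ≤ l) (h2 : l ≤ rk N) :
    groundπ N (π + mstep N l) = groundπ N π := by
  have h0 := hh_nonneg N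
  funext k
  unfold groundπ mstep
  split_ifs with hk <;> first | rfl | (simp [ee, Pi.single_apply]; try omega)

/-- The differences $j_l-\pi_{l-1}$ are invariants of the tower. -/
lemma groundj_step {l : ℤ} (h1 : 1 ≤ l) :
    groundj N (π + mstep N l) (j + yy l) = groundj N π j := by
  have h0 := hh_nonneg N
  funext k
  unfold groundj
  split_ifs with hk
  · simp only [Pi.add_apply, yy, if_pos (show 0 < l by omega), mstep]
    rcases eq_or_ne k l with rfl | hkl
    · rw [if_pos hk.1]; simp [ee]
    · rw [Pi.single_apply, if_neg hkl]
      split_ifs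
      · simp [ee, hkl]
      · omega
      · simp
  · rfl

end IsSpectral

end Isometries

/-! ### The orthonormal basis of kets. -/

section Kets

variable {D : Type*} [NormedAddCommGroup D] [InnerProductSpace ℂ D]
variable {N : ℕ} {q : ℝ} {g : Generators D} {c : SpectralData} {π π' j j' : ℤ → ℤ}

namespace IsSpectral

variable (hs : IsSpectral N q g c) (hD : Module.rank ℂ D ≤ Cardinal.aleph0)

/-- A sequence whose nonzero members form an orthonormal basis of the joint eigenspace `(π, j)`. -/
def basisSeq (_ : IsSpectral N q g c) (hD : Module.rank ℂ D ≤ Cardinal.aleph0) (π j : ℤ → ℤ) :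
    ℕ → D :=
  Classical.choose (exists_orthonormal_seq_span (V := g.jointSpace N q c π j) hD)

lemma orthonormal_basisSeq (π j : ℤ → ℤ) :
    Orthonormal ℂ (fun i : {i | hs.basisSeq hD π j i ≠ 0} => hs.basisSeq hD π j i) :=
  (Classical.choose_spec (exists_orthonormal_seq_span (V := g.jointSpace N q c π j) hD)).1

lemma span_basisSeq (π j : ℤ → ℤ) :
    Submodule.span ℂ (Set.range (hs.basisSeq hD π j)) = g.jointSpace N q c π j :=
  (Classical.choose_spec (exists_orthonormal_seq_span (V := g.jointSpace N q c π j) hD)).2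

lemma basisSeq_mem (π j : ℤ → ℤ) (α : ℕ) :
    hs.basisSeq hD π j α ∈ g.jointSpace N q c π j := by
  rw [← hs.span_basisSeq hD]
  exact Submodule.subset_span ⟨α, rfl⟩

/-- The vector `|π; j, α⟩`. -/
def ket (s : KetLabel) : D :=
  hs.transport s.π s.j (hs.basisSeq hD (groundπ N s.π) (groundj N s.π s.j) s.α)

/-- The labels of the basis vectors. -/
def ketLabels : Set KetLabel :=
  {s | IsPairLabel N s.π s.j ∧ hs.basisSeq hD (groundπ N s.π) (groundj N s.π s.j) s.α ≠ 0}

lemma ket_mem {s : KetLabel} (h : s ∈ hs.ketLabels hD) :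
    hs.ket hD s ∈ g.jointSpace N q c s.π s.j := by
  obtain ⟨δ, η, e1, e2, hsh⟩ := hs.isShift_transport h.1
  have := hsh.map _ _ (isPairLabel_ground hs.hN _ _) _
    (hs.basisSeq_mem hD (groundπ N s.π) (groundj N s.π s.j) s.α)
  rwa [e1, e2] at this

lemma orthonormal_ket : Orthonormal ℂ (fun s : hs.ketLabels hD => hs.ket hD s) := by
  classical
  rw [orthonormal_iff_ite]
  rintro ⟨s, hs1⟩ ⟨t, ht1⟩
  by_cases hπj : s.π = t.π ∧ s.j = t.j
  · obtain ⟨π, j, α⟩ := s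
    obtain ⟨π', j', β⟩ := t
    obtain ⟨rfl, rfl⟩ := hπj
    obtain ⟨δ, η, e1, e2, hsh⟩ := hs.isShift_transport hs1.1
    have e := hsh.isometry _ _ (isPairLabel_ground hs.hN _ _) _
      (hs.basisSeq_mem hD (groundπ N π) (groundj N π j) α) _
      (hs.basisSeq_mem hD (groundπ N π) (groundj N π j) β)
    have o := orthonormal_iff_ite.mp (hs.orthonormal_basisSeq hD (groundπ N π) (groundj N π j))
      ⟨α, hs1.2⟩ ⟨β, ht1.2⟩
    simp only [Subtype.mk.injEq, KetLabel.mk.injEq, true_and] at o ⊢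
    rw [← o]
    exact e
  · rw [if_neg fun e => hπj (by cases e; exact ⟨rfl, rfl⟩)]
    exact hs.inner_eq_zero hs1.1 ht1.1 (by tauto) (hs.ket_mem hD hs1) (hs.ket_mem hD ht1)

/-- Transport maps the ground space onto the joint eigenspace, hence a spanning set to a spanning
set. -/
lemma span_ket (h : IsPairLabel N π j) :
    Submodule.span ℂ (hs.ket hD '' {s ∈ hs.ketLabels hD | s.π = π ∧ s.j = j})
      = g.jointSpace N q c π j := by
  refine le_antisymm (Submodule.span_le.mpr ?_) fun x hx => ?_
  · rintro _ ⟨s, ⟨h1, rfl, rfl⟩, rfl⟩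
    exact hs.ket_mem hD h1
  · obtain ⟨δ, η, e1, e2, hsh⟩ := hs.isShift_transport h
    obtain ⟨y, hy, rfl⟩ := hsh.surj _ _ (isPairLabel_ground hs.hN _ _) x (by rwa [e1, e2])
    rw [← hs.span_basisSeq hD] at hy
    have : Submodule.span ℂ (Set.range (hs.basisSeq hD (groundπ N π) (groundj N π j)))
        ≤ (Submodule.span ℂ (hs.ket hD '' {s ∈ hs.ketLabels hD | s.π = π ∧ s.j = j})).comap
          (hs.transport π j) := by
      rw [Submodule.span_le]
      rintro _ ⟨α, rfl⟩
      rw [SetLike.mem_coe, Submodule.mem_comap]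
      by_cases h0 : hs.basisSeq hD (groundπ N π) (groundj N π j) α = 0
      · rw [h0, map_zero]; exact zero_mem _
      · exact Submodule.subset_span ⟨⟨π, j, α⟩, ⟨⟨h, h0⟩, rfl, rfl⟩, rfl⟩
    exact this hy

lemma span_ket_eq_top : Submodule.span ℂ (hs.ket hD '' hs.ketLabels hD) = ⊤ := by
  rw [eq_top_iff, ← hs.span_labels_eq_top, Submodule.span_le]
  rintro x ⟨π, j, h, hx⟩
  rw [← hs.span_ket hD h] at hx
  exact Submodule.span_mono (Set.image_mono (Set.sep_subset _ _)) hx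

lemma ket_step {l : ℤ} (h1 : 1 ≤ l) (h2 : l ≤ rk N) {α : ℕ}
    (h : (⟨π, j, α⟩ : KetLabel) ∈ hs.ketLabels hD) :
    (⟨π + mstep N l, j + yy l, α⟩ : KetLabel) ∈ hs.ketLabels hD ∧
      hs.ket hD ⟨π + mstep N l, j + yy l, α⟩ = hs.step l (hs.ket hD ⟨π, j, α⟩) := by
  have e1 := groundπ_step (π := π) h1 h2
  have e2 := groundj_step (N := N) (π := π) (j := j) h1
  constructor
  · refine ⟨h.1.add (isPairLabel_step h1 h2), ?_⟩
    simp only [e1, e2]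
    exact h.2
  · simp only [ket, e1, e2, hs.transport_step h1 h2 h.1]
    rfl

lemma ket_step_sub {l : ℤ} (h1 : 1 ≤ l) (h2 : l ≤ rk N) {α : ℕ}
    (h : (⟨π, j, α⟩ : KetLabel) ∈ hs.ketLabels hD)
    (hl : IsPairLabel N (π - mstep N l) (j - yy l)) :
    (⟨π - mstep N l, j - yy l, α⟩ : KetLabel) ∈ hs.ketLabels hD ∧
      hs.ket hD ⟨π, j, α⟩ = hs.step l (hs.ket hD ⟨π - mstep N l, j - yy l, α⟩) := by
  have e1 := groundπ_step (π := π - mstep N l) h1 h2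
  have e2 := groundj_step (N := N) (π := π - mstep N l) (j := j - yy l) h1
  rw [sub_add_cancel] at e1 e2
  rw [sub_add_cancel] at e2
  have hm : (⟨π - mstep N l, j - yy l, α⟩ : KetLabel) ∈ hs.ketLabels hD := by
    refine ⟨hl, ?_⟩
    simp only [← e1, ← e2]
    exact h.2
  refine ⟨hm, ?_⟩
  have := (hs.ket_step hD h1 h2 hm).2
  rwa [sub_add_cancel, sub_add_cancel] at this

-- No product of momentum steps in a tower alters $\pi_n$; powers of the invertible $\Lambda$ reach
-- all its integer values.
include hs in
lemma exists_zpow_lam (t : ℤ) {x : D} (hx : x ∈ g.jointSpace N q c π j) (h0 : x ≠ 0) :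
    ∃ y ∈ g.jointSpace N q c (π + t • ee (rk N)) j, y ≠ 0 := by
  obtain ⟨e1, e2⟩ := hs.rep.lam_inv
  induction t with
  | zero => exact ⟨x, by simpa using hx, h0⟩
  | succ t ih =>
    obtain ⟨y, hy, hy0⟩ := ih
    refine ⟨g.Lam y, ?_, fun h => hy0 ?_⟩
    · have := lam_mem_jointSpace hs.hN hs.rep hs.hq0 hy
      rwa [add_assoc, ← add_one_zsmul] at this
    · have := LinearMap.congr_fun e2 y
      rw [Module.End.mul_apply, h, map_zero] at this
      exact this.symm
  | pred t ih =>
    obtain ⟨y, hy, hy0⟩ := ih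
    refine ⟨g.LamInv y, ?_, fun h => hy0 ?_⟩
    · have := lamInv_mem_jointSpace hs.hN hs.rep hs.hq0 hy
      rwa [show π + -(t : ℤ) • ee (rk N) - ee (rk N) = π + (-(t : ℤ) - 1) • ee (rk N) by
        module] at this
    · have := LinearMap.congr_fun e1 y
      rw [Module.End.mul_apply, h, map_zero] at this
      exact this.symm

include hs in
lemma isShift_transport_ground {ν : ℤ → ℤ} (h : IsPairLabel N π j) (hν : IsMomentumLabel N ν) :
    ∃ (U : Module.End ℂ D) (δ η : ℤ → ℤ), groundπ N ν + δ = ν ∧ IsShift N q g c U δ η := by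
  obtain ⟨δ, η, e1, -, hsh⟩ := hs.isShift_transport (j := j) ⟨hν, h.2⟩
  exact ⟨_, δ, η, e1, hsh⟩

include hD in
/-- Every momentum label occurs. -/
lemma exists_ketLabel {x : D} (hx : x ∈ g.jointSpace N q c π j) (h0 : x ≠ 0)
    {ν : ℤ → ℤ} (hν : IsMomentumLabel N ν) : ∃ s ∈ hs.ketLabels hD, s.π = ν := by
  obtain ⟨π, j, hl, hx⟩ := hs.exists_label hx h0
  obtain ⟨δ, η, e1, e2, hsh⟩ := hs.isShift_transport hl
  have hg := isPairLabel_ground hs.hN π j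
  obtain ⟨y, hy, rfl⟩ := hsh.surj _ _ hg x (by rwa [e1, e2])
  have hy0 : y ≠ 0 := by rintro rfl; exact h0 (map_zero _)
  -- From the ground space of the given vector, $\Lambda$ adjusts $\pi_n$ to $\nu_n$. Transport then
  -- supplies the other components of $\nu$; the label $j$ reached in this way is of no concern.
  obtain ⟨z, hz, hz0⟩ := hs.exists_zpow_lam (ν (rk N) - π (rk N)) hy hy0
  have eν : groundπ N π + (ν (rk N) - π (rk N)) • ee (rk N) = groundπ N ν := by
    funext l
    simp only [groundπ, Pi.add_apply, Pi.smul_apply, ee, Pi.single_apply]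
    split_ifs with h
    · subst h; simp
    · simp
  rw [eν] at hz
  obtain ⟨U, δ', η', e1', hsh'⟩ := hs.isShift_transport_ground hl hν
  have hlν : IsPairLabel N (groundπ N ν) (groundj N π j) :=
    ⟨(isPairLabel_ground hs.hN ν j).1, hg.2⟩
  have hne : g.jointSpace N q c ν (groundj N π j + η') ≠ ⊥ := by
    intro hbot
    rw [← e1', hsh'.eq_bot_iff hlν, Submodule.eq_bot_iff] at hbot
    exact hz0 (hbot z hz)
  have hlab : IsPairLabel N ν (groundj N π j + η') := ⟨hν, (hlν.add hsh'.label).2⟩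
  by_contra hno
  push Not at hno
  refine hne ?_
  rw [← hs.span_ket hD hlab, Submodule.span_eq_bot]
  rintro _ ⟨s, ⟨h1, h2, -⟩, rfl⟩
  exact absurd h2 (hno s h1)

end IsSpectral

/-! ### Ladders of operators that terminate at both ends. -/

section Ladder

/-- A ladder of operators with `A B = q² B A + K (r q^{-4t} - s)` on its `t`-th rung that starts from
an eigenvector of `B A` terminates at both ends, and so quantizes `r / s`. -/
lemma ladder_quantization {q : ℝ} (hq0 : 0 < q) (hq1 : q < 1) (F : ℤ → Submodule ℂ D)
    {A B : Module.End ℂ D} (hA : ∀ t, ∀ x ∈ F t, A x ∈ F (t + 1))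
    (hB : ∀ t, ∀ x ∈ F t, B x ∈ F (t - 1)) {κ K r s : ℝ} (hκ : 0 < κ) (hK : 0 < K) (hr : 0 < r)
    (hs : 0 < s)
    (hadj : ∀ t, ∀ x ∈ F t, ∀ y ∈ F (t + 1), inner ℂ (A x) y = (κ : ℂ) * inner ℂ x (B y))
    (hrel : ∀ t, ∀ x ∈ F t, A (B x)
      = (q : ℂ) ^ 2 • B (A x) + ((K * (r * q ^ (-4 * t) - s) : ℝ) : ℂ) • x)
    {x : D} (hx : x ∈ F 0) (hx0 : x ≠ 0) {y₀ : ℂ} (hy : B (A x) = y₀ • x) :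
    ∃ m : ℤ, r = s * q ^ (2 * m) := by
  have hq2 : 0 < 1 - q ^ 2 := by nlinarith
  have hqc : (q : ℂ) ≠ 0 := by exact_mod_cast hq0.ne'
  have hn0 : ∀ {z : D}, z ≠ 0 → 0 < ‖z‖ ^ 2 := fun {z} h => by positivity
  obtain ⟨y, rfl⟩ : ∃ y : ℝ, y₀ = (y : ℂ) := by
    have e := hadj 0 x hx (A x) (hA 0 x hx)
    rw [hy, inner_smul_right, inner_self_eq_ofReal, inner_self_eq_ofReal] at e
    have hne : ((‖x‖ ^ 2 : ℝ) : ℂ) ≠ 0 := by exact_mod_cast (hn0 hx0).ne'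
    have hκc : (κ : ℂ) ≠ 0 := by exact_mod_cast hκ.ne'
    refine ⟨κ⁻¹ * (‖A x‖ ^ 2 / ‖x‖ ^ 2), ?_⟩
    rw [Complex.ofReal_mul, Complex.ofReal_div, e, Complex.ofReal_inv]
    field_simp
  -- Writing $BA=Y(t)$ on the $t$-th rung, the relation becomes $Y(t)=q^2Y(t+1)+K(rq^{-4(t+1)}-s)$.
  -- The terms with $a$ and $b$ solve it for the sources $r$ and $s$, and $\gamma q^{-2t}$ is the
  -- homogeneous solution, with $\gamma$ fixed by $Y(0)=y$.
  set a : ℝ := -(K * r / (q ^ 2 * (1 - q ^ 2))) with ha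
  set b : ℝ := -(K * s / (1 - q ^ 2)) with hb
  set γ : ℝ := y - a - b with hγ
  have ha0 : a < 0 := by rw [ha]; exact neg_neg_of_pos (by positivity)
  have hb0 : b < 0 := by rw [hb]; exact neg_neg_of_pos (by positivity)
  set Y : ℤ → ℝ := fun t => a * q ^ (-4 * t) + γ * q ^ (-2 * t) + b with hY
  have hY0 : Y 0 = y := by simp [hY, hγ]; ring
  have hYrec : ∀ t, Y t = q ^ 2 * Y (t + 1) + K * (r * q ^ (-4 * (t + 1)) - s) := by
    intro t
    have e4 : q ^ (-4 * t) = q ^ 4 * q ^ (-4 * (t + 1)) := by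
      rw [← zpow_natCast, ← zpow_add₀ hq0.ne']; congr 1; push_cast; ring
    have e2 : q ^ (-2 * t) = q ^ 2 * q ^ (-2 * (t + 1)) := by
      rw [← zpow_natCast, ← zpow_add₀ hq0.ne']; congr 1; push_cast; ring
    have E1 : a * q ^ 4 = q ^ 2 * a + K * r := by rw [ha]; field_simp; ring
    have E2 : b = q ^ 2 * b - K * s := by rw [hb]; field_simp; ring
    simp only [hY]
    rw [e4, e2]
    linear_combination q ^ (-4 * (t + 1)) * E1 + E2
  have up : ∀ k : ℕ, (A ^ k) x ∈ F k ∧ B (A ((A ^ k) x)) = (Y k : ℂ) • (A ^ k) x := by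
    intro k
    induction k with
    | zero => exact ⟨hx, by simpa [hY0] using hy⟩
    | succ k ih =>
      obtain ⟨i1, i2⟩ := ih
      have e : (A ^ (k + 1)) x = A ((A ^ k) x) := by rw [pow_succ']; rfl
      have m1 := hA _ _ i1
      rw [e]
      push_cast
      refine ⟨m1, ?_⟩
      have R := hrel _ _ m1
      rw [i2, map_smul, hYrec k] at R
      have R' : ((q : ℂ) ^ 2) • B (A (A ((A ^ k) x)))
          = ((q : ℂ) ^ 2) • ((Y ((k : ℤ) + 1) : ℂ) • A ((A ^ k) x)) := by
        rw [← sub_eq_iff_eq_add] at R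
        rw [← R]
        push_cast
        module
      exact smul_right_injective _ (pow_ne_zero 2 hqc) R'
  have down : ∀ k : ℕ, (B ^ k) x ∈ F (-k) ∧
      A (B ((B ^ k) x)) = (Y (-(k : ℤ) - 1) : ℂ) • (B ^ k) x := by
    intro k
    induction k with
    | zero =>
      refine ⟨hx, ?_⟩
      have R := hrel _ _ hx
      have e := hYrec (-1)
      norm_num at e
      rw [hY0] at e
      rw [hy] at R
      norm_num
      rw [R, e]
      push_cast
      norm_num
      module
    | succ k ih =>
      obtain ⟨i1, i2⟩ := ih
      have e : (B ^ (k + 1)) x = B ((B ^ k) x) := by rw [pow_succ']; rfl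
      have m1 := hB _ _ i1
      rw [e]
      push_cast
      rw [show -((k : ℤ) + 1) = -(k : ℤ) - 1 by ring]
      refine ⟨m1, ?_⟩
      have R := hrel _ _ m1
      rw [i2, map_smul] at R
      rw [R, hYrec (-(k : ℤ) - 1 - 1), sub_add_cancel]
      push_cast
      module
  have hupn : ∀ k : ℕ, ‖(A ^ (k + 1)) x‖ ^ 2 = κ * (Y k * ‖(A ^ k) x‖ ^ 2) := by
    intro k
    obtain ⟨i1, i2⟩ := up k
    have e := hadj _ _ i1 _ (hA _ _ i1)
    rw [i2, inner_smul_right, inner_self_eq_ofReal, inner_self_eq_ofReal] at e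
    rw [pow_succ' A, Module.End.mul_apply]
    exact_mod_cast e
  have hdownn : ∀ k : ℕ,
      κ * ‖(B ^ (k + 1)) x‖ ^ 2 = Y (-(k : ℤ) - 1) * ‖(B ^ k) x‖ ^ 2 := by
    intro k
    obtain ⟨i1, i2⟩ := down k
    have e := hadj _ _ (hB _ _ i1) ((B ^ k) x) (by rwa [sub_add_cancel])
    rw [i2, inner_smul_left, inner_self_eq_ofReal, inner_self_eq_ofReal, Complex.conj_ofReal] at e
    rw [pow_succ' B, Module.End.mul_apply]
    exact_mod_cast e.symm
  have term : ∀ f : ℕ → D, f 0 ≠ 0 → (∃ k, f (k + 1) = 0) → ∃ k, f k ≠ 0 ∧ f (k + 1) = 0 := by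
    classical
    intro f h0 hex
    refine ⟨Nat.find hex, ?_, Nat.find_spec hex⟩
    rcases Nat.eq_zero_or_pos (Nat.find hex) with h | h
    · rw [h]; exact h0
    · have := Nat.find_min hex (m := Nat.find hex - 1) (by omega)
      rwa [Nat.sub_add_cancel h] at this
  -- As $t\to\infty$ the term $aq^{-4t}$ dominates and is negative, which is incompatible with
  -- squared norms proportional to $Y(t)$; so the upward ladder stops.
  obtain ⟨k, hk1, hk2⟩ := term (fun k => (A ^ k) x) (by simpa using hx0) (by
    by_contra hne
    push Not at hne
    obtain ⟨k, hk⟩ := pow_unbounded_of_one_lt (γ / -a)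
      (show 1 < (q ^ 2)⁻¹ from one_lt_inv_iff₀.mpr ⟨by positivity, by nlinarith⟩)
    rw [div_lt_iff₀ (by linarith)] at hk
    set X := ((q ^ 2)⁻¹) ^ k with hX
    have hXpos : 0 < X := by positivity
    have e2 : q ^ (-2 * (k : ℤ)) = X := by
      rw [hX, neg_mul, zpow_neg, zpow_mul, inv_pow]; norm_cast
    have e4 : q ^ (-4 * (k : ℤ)) = X ^ 2 := by
      rw [← e2, ← zpow_natCast, ← zpow_mul]; congr 1; push_cast; ring
    have hYneg : Y k < 0 := by
      simp only [hY]
      rw [e2, e4]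
      nlinarith
    have e := hupn k
    have p1 : 0 < ‖(A ^ (k + 1)) x‖ ^ 2 := hn0 (hne k)
    rw [e] at p1
    have : κ * (Y k * ‖(A ^ k) x‖ ^ 2) ≤ 0 :=
      mul_nonpos_of_nonneg_of_nonpos hκ.le (mul_nonpos_of_nonpos_of_nonneg hYneg.le (sq_nonneg _))
    linarith)
  -- As $t\to-\infty$ the constant $b<0$ remains, so the downward ladder stops too.
  obtain ⟨m, hm1, hm2⟩ := term (fun k => (B ^ k) x) (by simpa using hx0) (by
    by_contra hne
    push Not at hne
    obtain ⟨k, hk⟩ := exists_pow_lt_of_lt_one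
      (show 0 < -b / (|γ| + 1) by have := abs_nonneg γ; exact div_pos (by linarith) (by linarith))
      (show q ^ 2 < 1 by nlinarith)
    rw [lt_div_iff₀ (by positivity)] at hk
    set X := (q ^ 2) ^ (k + 1) with hX
    have hXpos : 0 < X := by positivity
    have hXle : X ≤ (q ^ 2) ^ k := pow_le_pow_of_le_one (by positivity) (by nlinarith) (Nat.le_succ k)
    have e2 : q ^ (-2 * (-(k : ℤ) - 1)) = X := by
      rw [hX, ← pow_mul, ← zpow_natCast]; congr 1; push_cast; ring
    have e4 : q ^ (-4 * (-(k : ℤ) - 1)) = X ^ 2 := by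
      rw [← e2, ← zpow_natCast, ← zpow_mul]; congr 1; push_cast; ring
    have hYneg : Y (-(k : ℤ) - 1) < 0 := by
      simp only [hY]
      rw [e2, e4]
      have h1 : γ * X ≤ |γ| * X := mul_le_mul_of_nonneg_right (le_abs_self γ) hXpos.le
      have h2 : |γ| * X ≤ |γ| * (q ^ 2) ^ k := mul_le_mul_of_nonneg_left hXle (abs_nonneg γ)
      have h3 : 0 < (q ^ 2) ^ k := by positivity
      nlinarith [sq_nonneg X, mul_neg_of_neg_of_pos ha0 (sq_pos_of_pos hXpos)]
    have e := hdownn k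
    have p1 : 0 < κ * ‖(B ^ (k + 1)) x‖ ^ 2 := mul_pos hκ (hn0 (hne k))
    rw [e] at p1
    have : Y (-(k : ℤ) - 1) * ‖(B ^ k) x‖ ^ 2 ≤ 0 :=
      mul_nonpos_of_nonpos_of_nonneg hYneg.le (sq_nonneg _)
    linarith)
  have Y1 : Y k = 0 := by
    have e := hupn k
    rw [hk2, norm_zero, zero_pow two_ne_zero, eq_comm, mul_eq_zero, mul_eq_zero] at e
    exact (e.resolve_left hκ.ne').resolve_right (hn0 hk1).ne'
  have Y2 : Y (-(m : ℤ) - 1) = 0 := by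
    have e := hdownn m
    rw [hm2, norm_zero, zero_pow two_ne_zero, mul_zero, eq_comm, mul_eq_zero] at e
    exact e.resolve_right (hn0 hm1).ne'
  set X₁ := q ^ (-2 * (k : ℤ)) with hX1
  set X₂ := q ^ (-2 * (-(m : ℤ) - 1)) with hX2
  have e1 : q ^ (-4 * (k : ℤ)) = X₁ ^ 2 := by
    rw [hX1, ← zpow_natCast, ← zpow_mul]; congr 1; push_cast; ring
  have e2 : q ^ (-4 * (-(m : ℤ) - 1)) = X₂ ^ 2 := by
    rw [hX2, ← zpow_natCast, ← zpow_mul]; congr 1; push_cast; ring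
  simp only [hY] at Y1 Y2
  rw [e1] at Y1
  rw [e2] at Y2
  have hne : X₁ ≠ X₂ := fun h => by
    have := zpow_right_injective₀ hq0 hq1.ne h
    omega
  -- As a polynomial in $X=q^{-2t}$, $Y$ is quadratic, and the two ends give distinct roots since
  -- one has $t\ge0$ and the other $t<0$. Their product $b/a=q^2s/r$ is an even power of $q$; the
  -- unknown $\gamma$ has dropped out.
  have key : a * (X₁ * X₂) = b := by
    have : (a * (X₁ * X₂) - b) * (X₁ - X₂) = 0 := by
      linear_combination X₂ * Y1 - X₁ * Y2
    rcases mul_eq_zero.mp this with h | h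
    · linarith
    · exact absurd (sub_eq_zero.mp h) hne
  have hXX : X₁ * X₂ = q ^ 2 * (q ^ (2 * ((k : ℤ) - m)))⁻¹ := by
    rw [hX1, hX2, ← zpow_add₀ hq0.ne', ← zpow_neg, ← zpow_natCast, ← zpow_add₀ hq0.ne']
    congr 1; push_cast; ring
  refine ⟨k - m, ?_⟩
  rw [hXX, ha, hb] at key
  have hp : q ^ (2 * ((k : ℤ) - m)) ≠ 0 := by positivity
  generalize q ^ (2 * ((k : ℤ) - m)) = Z at key hp
  field_simp at key
  linarith

end Ladder

end Kets

/-! ### Improved roots on the joint eigenspaces and the constants $\lambda_i$. -/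

section RootAction

variable {D : Type*} [NormedAddCommGroup D] [InnerProductSpace ℂ D]
variable {N : ℕ} {q : ℝ} {g : Generators D} {c : SpectralData} {π π' j j' : ℤ → ℤ}

lemma isSimpleRoot_succ {u : ℤ} (h1 : hh N ≤ u) (h2 : u + 1 ≤ rk N) : IsSimpleRoot N u (u + 1) :=
  Or.inl ⟨h1, rfl, h2⟩

namespace IsSpectral

variable (hs : IsSpectral N q g c)
include hs

/-- The commutation relation of the improved roots `L^{∓}`. -/
lemma newPos_newNeg_apply {u : ℤ} (h1 : hh N < u) (h2 : u + 1 ≤ rk N) {x : D}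
    (hx : x ∈ g.jointSpace N q c π j) :
    g.newPos N q u (u + 1) (g.newNeg N q u (u + 1) x)
      = (q : ℂ) ^ 2 • g.newNeg N q u (u + 1) (g.newPos N q u (u + 1) x) +
        (qp q (rho N (u + 1)) ^ 2 * q / ((q : ℂ)⁻¹ - q) * (kVal q c j u / kVal q c j (u + 1) -
          dotVal N q c π (u - 1) * dotVal N q c π (u + 1) / dotVal N q c π u ^ 2)) • x := by
  have h0 := hh_nonneg N
  have hsr := isSimpleRoot_succ (N := N) h1.le h2
  have hu : u ≠ 0 := by omega
  have hqc : (q : ℂ) ≠ 0 := by exact_mod_cast hs.hq0.ne'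
  have hc := dotVal_ne_zero (N := N) hs.hq0 hs.M_pos π u
  have hq2 := one_sub_sq_ne_zero hs.hq0 hs.hq1
  have hr := qp_ne_zero hs.hq0 (rho N (u + 1))
  have hu1 : 1 ≤ u := by omega
  have hv1 : 1 ≤ u + 1 := by omega
  have hpu := isSpaceIndex_pos (N := N) (l := u) (by omega) (by omega)
  have hpv := isSpaceIndex_pos (N := N) (l := u + 1) (by omega) h2
  have er : qp q (rho N u) = q * qp q (rho N (u + 1)) := by
    have := qp_rho_pred hs.hq0 N (l := u + 1) (by omega)
    rwa [add_sub_cancel_right] at this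
  have dv := hx.1 (u + 1) (by omega) h2
  have du := hx.1 u (by omega) (by omega)
  have dw := hx.1 (u - 1) (by omega) (by omega)
  have Xv : g.p (-(u + 1)) (g.p (u + 1) x) = ((qp q (rho N (u + 1)))⁻¹ *
      (dotVal N q c π (u + 1) - dotVal N q c π u)) • x := by
    have := LinearMap.congr_fun (p_neg_mul_p (g := g) (N := N) hs.hq0 (l := u + 1) (by omega)) x
    rw [add_sub_cancel_right] at this
    simp only [Module.End.mul_apply, LinearMap.smul_apply, LinearMap.sub_apply, dv, du] at this
    rw [this]; module
  have Xu : g.p (-u) (g.p u x) = (((q : ℂ) * qp q (rho N (u + 1)))⁻¹ *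
      (dotVal N q c π u - dotVal N q c π (u - 1))) • x := by
    have := LinearMap.congr_fun (p_neg_mul_p (g := g) (N := N) hs.hq0 (l := u) hu1) x
    simp only [Module.End.mul_apply, LinearMap.smul_apply, LinearMap.sub_apply, dw, du, er] at this
    rw [this]; module
  -- `W1` and `W2`, followed by `Xu` and `Xv`, evaluate the quartic momentum terms that arise when
  -- the two corrections are multiplied.
  have W1 : g.p (u + 1) (g.p (-(u + 1)) (g.p u x)) = ((qp q (rho N (u + 1)))⁻¹ *
      (dotVal N q c π (u + 1) - ((q : ℂ) ^ 2)⁻¹ * dotVal N q c π u)) • g.p u x := by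
    have := LinearMap.congr_fun (p_mul_p_neg hs.rep hs.hq0 (l := u + 1) (by omega) h2) (g.p u x)
    rw [add_sub_cancel_right] at this
    have c1 := LinearMap.congr_fun (p_commute_dot hs.rep hs.hq0 hpu (m := u + 1)
      (by rw [abs_of_pos (by omega)]; omega) h2).symm.eq x
    have c2 := LinearMap.congr_fun (p_commute_dot hs.rep hs.hq0 hpu (m := u)
      (by rw [abs_of_pos (by omega)]) (by omega)).symm.eq x
    simp only [Module.End.mul_apply, du, dv, map_smul] at c1 c2
    simp only [Module.End.mul_apply, LinearMap.smul_apply, LinearMap.sub_apply, c1, c2] at this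
    rw [this]; module
  have W2 : g.p u (g.p (-u) (g.p (u + 1) x)) = (((q : ℂ) * qp q (rho N (u + 1)))⁻¹ *
      ((q : ℂ) ^ 2 * dotVal N q c π u - dotVal N q c π (u - 1))) • g.p (u + 1) x := by
    have := LinearMap.congr_fun (p_mul_p_neg hs.rep hs.hq0 (l := u) hu1 (by omega)) (g.p (u + 1) x)
    have c1 := (dot_p_of_lt hs.rep hs.hq0 (m := u) (l := u + 1) (by omega) (by omega) h2).apply x
    have c2 := (dot_p_of_lt hs.rep hs.hq0 (m := u - 1) (l := u + 1) (by omega) (by omega) h2).apply x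
    rw [du, map_smul, smul_smul] at c1
    rw [dw, map_smul, smul_smul] at c2
    simp only [Module.End.mul_apply, LinearMap.smul_apply, LinearMap.sub_apply, c1, c2, er,
      smul_smul, ← mul_assoc, inv_mul_cancel₀ (pow_ne_zero 2 hqc), one_mul] at this
    rw [this]; module
  have LL := qcomm_apply_eq (hs.rep.pos_neg u (u + 1) hsr hu) x
  have hk1 := hx.2.1 u hu1 (by omega)
  have hk2 := k_neg_mem_jointSpace hs.rep hs.hq0 (i := u + 1) (by omega) h2
    (lt_trans (pow_pos hs.hq0 2) (hs.lam_mem _).1) hx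
  simp only [LinearMap.smul_apply, LinearMap.sub_apply, Module.End.mul_apply, hk1, hk2, map_smul,
    Module.End.one_apply] at LL
  have hA := hs.newPos_mem hsr hx
  have hB := hs.newNeg_mem hsr hx
  rw [hs.newPos_apply hsr hB, hs.newNeg_apply hsr hA, hs.newPos_apply hsr hx,
    hs.newNeg_apply hsr hx, add_sub_cancel_right]
  simp only [map_add, map_smul, LL, pos_p_v_apply hs.rep hsr, neg_p_u_apply hs.rep hsr hu,
    pos_p_u_apply hs.rep hsr hu, neg_p_v_apply hs.rep hsr, map_sub, W1, W2, Xu, Xv,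
    qp_two_mul_add_one hs.hq0, add_comm (1 : ℝ)]
  have hk0 := kVal_ne_zero hs.hq0 (lt_trans (pow_pos hs.hq0 2) (hs.lam_mem (u + 1)).1) j
  have hqi : (q : ℂ)⁻¹ - q = (1 - (q : ℂ) ^ 2) / q := by field_simp
  have hqi' : (q : ℂ) - (q : ℂ)⁻¹ = -((1 - (q : ℂ) ^ 2) / q) := by field_simp; ring
  rw [hqi, hqi']
  match_scalars
  · ring
  · field_simp
    ring
  · field_simp
  · field_simp

/-- On vectors of equal momentum the improved roots are adjoint up to a factor. -/
lemma inner_newPos {u : ℤ} (h1 : hh N < u) (h2 : u + 1 ≤ rk N) {x y : D}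
    (hx : x ∈ g.jointSpace N q c π j) (hy : y ∈ g.jointSpace N q c π j') :
    inner ℂ (g.newPos N q u (u + 1) x) y
      = (((q ^ 2)⁻¹ : ℝ) : ℂ) * inner ℂ x (g.newNeg N q u (u + 1) y) := by
  have h0 := hh_nonneg N
  have hsr := isSimpleRoot_succ (N := N) h1.le h2
  have hpu := isSpaceIndex_pos (N := N) (l := u) (by omega) (by omega)
  have hpv := isSpaceIndex_pos (N := N) (l := u + 1) (by omega) h2
  -- The correction shifts the eigenvalue of $(p\cdot p)_u$, so it is orthogonal to vectors with the
  -- momentum label $\pi$. Only the adjointness of the original roots survives.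
  have hw : inner ℂ (g.p (-u) (g.p (u + 1) x)) y = 0 := by
    have hw := p_mem_jointSpace hs.rep hs.hq0 hpu.neg (p_mem_jointSpace hs.rep hs.hq0 hpv hx)
    refine inner_eq_zero_of_eigenvalue_ne (inner_dot hs.rep hs.hq0 (m := u) (by omega) (by omega))
      (hw.1 u (by omega) (by omega)) (hy.1 u (by omega) (by omega)) fun e => ?_
    have e := mul_left_cancel₀ (pow_ne_zero 2 hs.M_pos.ne') e
    have e := zpow_right_injective₀ hs.hq0 hs.hq1.ne e
    have e3 := lowStep_root hs.hN hsr (m := u) (by omega)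
    rw [if_pos (by omega)] at e3
    rw [expSum_mstep hpu.neg (by omega), expSum_mstep hpv (by omega)] at e
    omega
  have hw' : inner ℂ x (g.p (-(u + 1)) (g.p u y)) = 0 := by
    rw [inner_p_right hs.rep hpv.neg, neg_neg, inner_p_right hs.rep hpu, hw, mul_zero, mul_zero]
  have hL := hs.rep.star_L u (u + 1) hsr (by omega) x y
  rw [hs.newPos_apply hsr hx, hs.newNeg_apply hsr hy, inner_add_left, inner_add_right,
    inner_smul_left, inner_smul_right, hw, hw', mul_zero, mul_zero, add_zero, add_zero, hL,
    LinearMap.smul_apply, inner_smul_right]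
  congr 1
  unfold qp
  rw [Real.rpow_neg hs.hq0.le]
  norm_cast

/-- The improved roots of the pair $(u,u+1)$ form a ladder at fixed $\pi$, with $r$ the ratio of the
eigenvalues of $\mathbf k^u$ and $\mathbf k^{u+1}$, and $s$ an even power of $q$ built from $(p\cdot
p)_{u-1}$, $(p\cdot p)_u$, $(p\cdot p)_{u+1}$. The condition $u>h$ keeps $(p\cdot p)_{u-1}$ among
the invariants with nonzero eigenvalue. -/
lemma lam_eq_succ {u : ℤ} (h1 : hh N < u) (h2 : u + 1 ≤ rk N)
    (hne : g.jointSpace N q c π j ≠ ⊥) [FiniteDimensional ℂ (g.jointSpace N q c π j)] :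
    c.lam u = c.lam (u + 1) := by
  have h0 := hh_nonneg N
  have hsr := isSimpleRoot_succ (N := N) h1.le h2
  have hq0 := hs.hq0
  have hq1 := hs.hq1
  have hlam : ∀ i, 0 < c.lam i := fun i => lt_trans (pow_pos hs.hq0 2) (hs.lam_mem i).1
  set A := g.newPos N q u (u + 1)
  set B := g.newNeg N q u (u + 1)
  let F : ℤ → Submodule ℂ D := fun t => g.jointSpace N q c π (j + t • (yy (u + 1) - yy u))
  have hA : ∀ t, ∀ x ∈ F t, A x ∈ F (t + 1) := fun t x hx => by
    have := hs.newPos_mem hsr hx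
    rwa [show j + t • (yy (u + 1) - yy u) + yy (u + 1) - yy u
      = j + (t + 1) • (yy (u + 1) - yy u) by module] at this
  have hB : ∀ t, ∀ x ∈ F t, B x ∈ F (t - 1) := fun t x hx => by
    have := hs.newNeg_mem hsr hx
    rwa [show j + t • (yy (u + 1) - yy u) - yy (u + 1) + yy u
      = j + (t - 1) • (yy (u + 1) - yy u) by module] at this
  have hF0 : F 0 = g.jointSpace N q c π j := by simp [F]
  set r : ℝ := c.lam u * q ^ (2 * j u) / (c.lam (u + 1) * q ^ (2 * j (u + 1))) with hr
  set s : ℝ := q ^ (2 * (π (u - 1) - π u)) with hsdef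
  set K : ℝ := (q ^ rho N (u + 1)) ^ 2 * q / (q⁻¹ - q) with hK
  have hKpos : 0 < K := by
    have : 0 < q⁻¹ - q := by
      have := one_lt_inv_iff₀.mpr ⟨hq0, hq1⟩
      linarith
    positivity
  have hrpos : 0 < r := by
    have := hlam u
    have := hlam (u + 1)
    positivity
  have hratio : dotVal N q c π (u - 1) * dotVal N q c π (u + 1) / dotVal N q c π u ^ 2
      = (s : ℂ) := by
    have hc := dotVal_ne_zero (N := N) hq0 hs.M_pos π (u + 1)
    have hqc : (q : ℂ) ≠ 0 := by exact_mod_cast hq0.ne'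
    have e1 := dotVal_pred (N := N) (c := c) (π := π) hq0 (l := u) (by omega)
    have e2 := dotVal_pred (N := N) (c := c) (π := π) hq0 (l := u + 1) h2
    rw [add_sub_cancel_right] at e2
    rw [e1, e2, hsdef, show 2 * (π (u - 1) - π u) = 2 * (π (u - 1) + 1) - 2 * (π u + 1) by ring]
    push_cast
    rw [zpow_sub₀ hqc]
    have p1 : (q : ℂ) ^ (2 * (π u + 1)) ≠ 0 := zpow_ne_zero _ hqc
    field_simp
  have hrt : ∀ t : ℤ, kVal q c (j + t • (yy (u + 1) - yy u)) u /
      kVal q c (j + t • (yy (u + 1) - yy u)) (u + 1) = ((r * q ^ (-4 * t) : ℝ) : ℂ) := by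
    intro t
    have y1 : (j + t • (yy (u + 1) - yy u)) u = j u - t := by
      simp only [Pi.add_apply, Pi.smul_apply, Pi.sub_apply, yy, if_pos (show 0 < u by omega),
        if_pos (show 0 < u + 1 by omega), Pi.single_eq_same, Pi.single_apply,
        if_neg (show u ≠ u + 1 by omega)]
      simp [sub_eq_add_neg]
    have y2 : (j + t • (yy (u + 1) - yy u)) (u + 1) = j (u + 1) + t := by
      simp only [Pi.add_apply, Pi.smul_apply, Pi.sub_apply, yy, if_pos (show 0 < u by omega),
        if_pos (show 0 < u + 1 by omega), Pi.single_eq_same, Pi.single_apply,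
        if_neg (show u + 1 ≠ u by omega)]
      simp
    unfold kVal
    rw [y1, y2, ← Complex.ofReal_div]
    congr 1
    have := hlam (u + 1)
    rw [hr, mul_sub, mul_add, zpow_sub₀ hq0.ne', zpow_add₀ hq0.ne',
      show -4 * t = -(2 * t) + -(2 * t) by ring, zpow_add₀ hq0.ne', zpow_neg]
    field_simp
  -- The only use of finite dimension: an eigenvector of $BA$ to start the ladder.
  obtain ⟨x, hx, hx0, y, hy⟩ : ∃ x ∈ F 0, x ≠ 0 ∧ ∃ y : ℂ, B (A x) = y • x := by
    rw [hF0]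
    have hmaps : ∀ x ∈ g.jointSpace N q c π j, (B * A) x ∈ g.jointSpace N q c π j := fun x hx => by
      have := hB _ _ (hA 0 x (by rwa [hF0]))
      rwa [add_sub_cancel_right, hF0] at this
    have : Nontrivial (g.jointSpace N q c π j) := Submodule.nontrivial_iff_ne_bot.mpr hne
    obtain ⟨y, hy⟩ := Module.End.exists_eigenvalue ((B * A).restrict hmaps)
    obtain ⟨x, hx⟩ := hy.exists_hasEigenvector
    refine ⟨x, x.2, fun h => hx.2 (Subtype.ext h), y, ?_⟩
    exact congrArg Subtype.val hx.apply_eq_smul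
  obtain ⟨m, hm⟩ := ladder_quantization hq0 hq1 F hA hB (κ := (q ^ 2)⁻¹) (K := K) (r := r) (s := s)
    (by positivity) hKpos hrpos (by positivity)
    (fun t x hx y hy => hs.inner_newPos h1 h2 hx hy)
    (fun t x hx => by
      rw [hs.newPos_newNeg_apply h1 h2 hx, hratio, hrt t, hK]
      unfold qp
      push_cast
      rfl) hx hx0 hy
  have hz : c.lam u = c.lam (u + 1) *
      q ^ (2 * (π (u - 1) - π u + m + j (u + 1) - j u)) := by
    have := hlam (u + 1)
    rw [hr, hsdef, div_eq_iff (by positivity)] at hm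
    have hp : q ^ (2 * j u) ≠ 0 := by positivity
    rw [← mul_left_inj' hp, hm, show 2 * (π (u - 1) - π u + m + j (u + 1) - j u)
      = 2 * (π (u - 1) - π u) + 2 * m + 2 * j (u + 1) - 2 * j u by ring, zpow_sub₀ hq0.ne',
      zpow_add₀ hq0.ne', zpow_add₀ hq0.ne']
    field_simp
  set z := π (u - 1) - π u + m + j (u + 1) - j u
  obtain ⟨l1, l2⟩ := hs.lam_mem u
  obtain ⟨m1, m2⟩ := hs.lam_mem (u + 1)
  -- Two numbers in $(q^2,1]$ cannot differ by a nonzero even power of $q$.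
  have hzz : ∀ a b : ℝ, q ^ 2 < a → b ≤ 1 → ∀ t : ℤ, 0 < t → a = b * q ^ (2 * t) → False := by
    intro a b ha hb t ht e
    have h3 : q ^ (2 * t) ≤ q ^ (2 : ℤ) := zpow_le_zpow_right_of_le_one₀ hq0 hq1.le (by omega)
    have h4 : (0 : ℝ) < q ^ (2 * t) := by positivity
    have h5 : q ^ (2 : ℤ) = q ^ 2 := by norm_cast
    have h6 := mul_le_mul_of_nonneg_right hb h4.le
    rw [h5] at h3
    linarith
  rcases lt_trichotomy z 0 with h | h | h
  · exfalso
    refine hzz _ _ m1 l2 (-z) (by omega) ?_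
    rw [hz, mul_assoc, ← zpow_add₀ hq0.ne']
    simp
  · rw [hz, h]; simp
  · exact (hzz _ _ l1 m2 z h hz).elim

lemma lam_eq_of_finite (hne : g.jointSpace N q c π j ≠ ⊥)
    (hfin : FiniteDimensional ℂ (g.jointSpace N q c π j)) {i i' : ℤ} (h1 : hh N < i)
    (h2 : i ≤ rk N) (h1' : hh N < i') (h2' : i' ≤ rk N) : c.lam i = c.lam i' := by
  have key : ∀ i, hh N + 1 ≤ i → i ≤ rk N → c.lam i = c.lam (hh N + 1) := by
    intro i hi
    induction i, hi using Int.leInduction with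
    | base => exact fun _ => rfl
    | succ k hk ih =>
      intro h
      rw [← ih (by omega)]
      exact (hs.lam_eq_succ (by omega) h hne).symm
  rw [key i (by omega) h2, key i' (by omega) h2']

end IsSpectral

end RootAction

/-! ### Action of the momenta on the kets. -/

section MomentumAction

variable {D : Type*} [NormedAddCommGroup D] [InnerProductSpace ℂ D]
variable {N : ℕ} {q : ℝ} {g : Generators D} {c : SpectralData} {π j : ℤ → ℤ}

namespace IsSpectral

variable (hs : IsSpectral N q g c) (hD : Module.rank ℂ D ≤ Cardinal.aleph0)

lemma p_ket {l : ℤ} (h1 : hh N < l) (h2 : l ≤ rk N) {α : ℕ}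
    (h : (⟨π, j, α⟩ : KetLabel) ∈ hs.ketLabels hD) :
    (⟨π + ee (l - 1), j + yy l, α⟩ : KetLabel) ∈ hs.ketLabels hD ∧
      g.p l (hs.ket hD ⟨π, j, α⟩)
        = ((c.M * √(1 - q ^ (2 * (π (l - 1) + 1))) * q ^ expSum N π l : ℝ) : ℂ) •
            hs.ket hD ⟨π + ee (l - 1), j + yy l, α⟩ := by
  have h0 := hh_nonneg N
  have hstep := hs.ket_step hD (l := l) (by omega) h2 h
  rw [mstep_of_lt h1] at hstep
  refine ⟨hstep.1, ?_⟩
  rw [hstep.2, hs.p_eq_step h2 h.1 (hs.ket_mem hD h), stepVal, stepGap, if_pos h1]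

lemma p_neg_eq_of_eq_step {l : ℤ} (h1 : 1 ≤ l) (h2 : l ≤ rk N) (h : IsPairLabel N π j) {x y : D}
    (hx : x ∈ g.jointSpace N q c π j) (hy : y = hs.step l x) :
    g.p (-l) y = ((qp q (rho N l))⁻¹ * (stepVal N q c l π : ℂ)) • x := by
  rw [hy]; exact hs.p_neg_step h1 h2 h hx

lemma p_neg_ket_eq_smul {l : ℤ} (h1 : 1 ≤ l) (h2 : l ≤ rk N) {α : ℕ}
    (h : (⟨π, j, α⟩ : KetLabel) ∈ hs.ketLabels hD)
    (hl : IsPairLabel N (π - mstep N l) (j - yy l)) :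
    g.p (-l) (hs.ket hD ⟨π, j, α⟩)
      = ((qp q (rho N l))⁻¹ * (stepVal N q c l (π - mstep N l) : ℂ)) •
          hs.ket hD ⟨π - mstep N l, j - yy l, α⟩ := by
  obtain ⟨m1, m2⟩ := hs.ket_step_sub hD h1 h2 h hl
  have hx := hs.ket_mem hD m1
  generalize hs.ket hD ⟨π - mstep N l, j - yy l, α⟩ = x at m2 hx ⊢
  generalize hs.ket hD ⟨π, j, α⟩ = y at m2 ⊢
  exact hs.p_neg_eq_of_eq_step h1 h2 hl hx m2

lemma p_neg_ket_eq_zero {l : ℤ} (h1 : hh N < l) (h2 : l ≤ rk N) {α : ℕ}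
    (h : (⟨π, j, α⟩ : KetLabel) ∈ hs.ketLabels hD) (hπ : π (l - 1) = 0) :
    g.p (-l) (hs.ket hD ⟨π, j, α⟩) = 0 := by
  have h0 := hh_nonneg N
  have e := p_neg_norm hs.rep hs.hq0 (l := l) (by omega) h2 (hs.ket_mem hD h)
  rw [stepGap, if_pos h1, mstep_of_lt h1] at e
  simpa [ee, hπ] using e

lemma p_neg_ket {l : ℤ} (h1 : hh N < l) (h2 : l ≤ rk N) {α : ℕ}
    (h : (⟨π, j, α⟩ : KetLabel) ∈ hs.ketLabels hD) (hπ : 0 < π (l - 1)) :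
    (⟨π - ee (l - 1), j - yy l, α⟩ : KetLabel) ∈ hs.ketLabels hD ∧
      g.p (-l) (hs.ket hD ⟨π, j, α⟩)
        = ((c.M * √(1 - q ^ (2 * π (l - 1))) * (q ^ (-rho N l) * q ^ expSum N π l) : ℝ) : ℂ) •
            hs.ket hD ⟨π - ee (l - 1), j - yy l, α⟩ := by
  have h0 := hh_nonneg N
  have hl0 : IsPairLabel N π j := h.1
  have hl : IsPairLabel N (π - mstep N l) (j - yy l) := by
    have hst := isPairLabel_step (N := N) (l := l) (by omega) h2
    refine ⟨⟨fun k hk => ?_, fun k hk1 hk2 => ?_⟩, fun i hi => ?_⟩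
    · rw [Pi.sub_apply, hl0.1.1 k hk, hst.1.1 k hk, sub_zero]
    · have := hl0.1.2 k hk1 hk2
      rw [mstep_of_lt h1]
      simp only [Pi.sub_apply, ee, Pi.single_apply]
      split_ifs with hk
      · subst hk; omega
      · simpa using this
    · rw [Pi.sub_apply, hl0.2 i hi, hst.2 i hi, sub_zero]
  have m1 := (hs.ket_step_sub hD (l := l) (by omega) h2 h hl).1
  have e := hs.p_neg_ket_eq_smul hD (l := l) (by omega) h2 h hl
  rw [stepVal, expSum_sub_mstep (by omega) h2, stepGap, if_pos h1] at e
  rw [mstep_of_lt h1] at m1 e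
  refine ⟨m1, ?_⟩
  rw [e]
  simp only [Pi.sub_apply, ee, Pi.single_eq_same, sub_add_cancel]
  rw [← qp_neg hs.hq0, qp]
  push_cast
  congr 1
  ring

lemma p_one_ket (hE : Even N) {α : ℕ} (h : (⟨π, j, α⟩ : KetLabel) ∈ hs.ketLabels hD) :
    (⟨π, j + yy 1, α⟩ : KetLabel) ∈ hs.ketLabels hD ∧
      g.p 1 (hs.ket hD ⟨π, j, α⟩)
        = ((c.M * q ^ expSum N π 1 : ℝ) : ℂ) • hs.ket hD ⟨π, j + yy 1, α⟩ := by
  have h2 := one_le_rk hs.hN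
  have hstep := hs.ket_step hD le_rfl h2 h
  rw [mstep_one_even hE, add_zero] at hstep
  refine ⟨hstep.1, ?_⟩
  rw [hstep.2, hs.p_eq_step h2 h.1 (hs.ket_mem hD h), stepVal, stepGap, if_neg (by simp [hh_even hE]),
    Real.sqrt_one, mul_one]

lemma p_neg_one_ket (hE : Even N) {α : ℕ} (h : (⟨π, j, α⟩ : KetLabel) ∈ hs.ketLabels hD) :
    (⟨π, j - yy 1, α⟩ : KetLabel) ∈ hs.ketLabels hD ∧
      g.p (-1) (hs.ket hD ⟨π, j, α⟩)
        = ((c.M * q ^ expSum N π 1 : ℝ) : ℂ) • hs.ket hD ⟨π, j - yy 1, α⟩ := by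
  have h2 := one_le_rk hs.hN
  have hl0 : IsPairLabel N π j := h.1
  have hl : IsPairLabel N (π - mstep N 1) (j - yy 1) := by
    rw [mstep_one_even hE, sub_zero]
    exact ⟨hl0.1, fun i hi => by
      rw [Pi.sub_apply, hl0.2 i hi, (isPairLabel_step le_rfl h2).2 i hi, sub_zero]⟩
  have m1 := (hs.ket_step_sub hD le_rfl h2 h hl).1
  have e := hs.p_neg_ket_eq_smul hD le_rfl h2 h hl
  rw [stepVal, stepGap, if_neg (by simp [hh_even hE]), qp_rho_one_even hE] at e
  rw [mstep_one_even hE, sub_zero] at m1 e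
  exact ⟨m1, by simpa using e⟩

end IsSpectral

end MomentumAction

end QEuclid

end

/-! ### Assembly of the theorem. -/

open QEuclid in
theorem theorem4 (N : ℕ) (hN : 3 ≤ N) (q : ℝ) (hq0 : 0 < q) (hq1 : q < 1)
    {D : Type*} [NormedAddCommGroup D] [InnerProductSpace ℂ D] (g : Generators D)
    (hrep : IsStarRep N q g) (hirr : IsIrreducibleRep N g)
    (hφ : ∃ φ : D, IsJointEigenvector N q g φ) :
    -- the `(p·p)_l` are invertible, so that the improved generators `L` are defined
    (∀ l, hh N ≤ l → l ≤ rk N → IsUnit (g.dot N q l)) ∧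
    ∃ (M : ℝ) (ε : ℝ) (lam : ℤ → ℝ) (S : Set KetLabel) (ket : KetLabel → D),
      0 < M ∧ (ε = 1 ∨ ε = -1) ∧
      (∀ i, 1 ≤ i → i ≤ rk N → q ^ 2 < lam i ∧ lam i ≤ 1) ∧
      -- labels: all of `ℕ^{n-h} × ℤ` occurs
      (∀ s ∈ S, IsLabel N s) ∧
      (∀ π, IsMomentumLabel N π → ∃ s ∈ S, s.π = π) ∧
      -- the kets form an orthonormal basis
      Orthonormal ℂ (fun s : S => ket s) ∧
      Submodule.span ℂ (ket '' S) = ⊤ ∧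
      (∀ (π j : ℤ → ℤ) (α : ℕ), (⟨π, j, α⟩ : KetLabel) ∈ S →
        -- meaning of the labels
        (∀ l, hh N ≤ l → l ≤ rk N →
          g.dot N q l (ket ⟨π, j, α⟩)
            = ((M ^ 2 * q ^ (2 * expSum N π l) : ℝ) : ℂ) • ket ⟨π, j, α⟩) ∧
        (∀ i, 1 ≤ i → i ≤ rk N →
          g.k i (ket ⟨π, j, α⟩) = ((lam i * q ^ (2 * j i) : ℝ) : ℂ) • ket ⟨π, j, α⟩) ∧
        -- action of `p^l` and `p^{-l}`, `l > h`
        (∀ l, hh N < l → l ≤ rk N →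
          (⟨π + ee (l - 1), j + yy l, α⟩ : KetLabel) ∈ S ∧
          g.p l (ket ⟨π, j, α⟩)
            = ((M * √(1 - q ^ (2 * (π (l - 1) + 1))) * q ^ expSum N π l : ℝ) : ℂ) •
                ket ⟨π + ee (l - 1), j + yy l, α⟩) ∧
        (∀ l, hh N < l → l ≤ rk N → π (l - 1) = 0 → g.p (-l) (ket ⟨π, j, α⟩) = 0) ∧
        (∀ l, hh N < l → l ≤ rk N → 0 < π (l - 1) →
          (⟨π - ee (l - 1), j - yy l, α⟩ : KetLabel) ∈ S ∧
          g.p (-l) (ket ⟨π, j, α⟩)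
            = ((M * √(1 - q ^ (2 * π (l - 1))) * (q ^ (-rho N l) * q ^ expSum N π l) : ℝ) : ℂ) •
                ket ⟨π - ee (l - 1), j - yy l, α⟩) ∧
        -- action of `p_0` for odd `N`
        (¬ Even N →
          g.lower N q 0 (ket ⟨π, j, α⟩)
            = ((ε * M * √(1 + q⁻¹) * q ^ expSum N π 0 : ℝ) : ℂ) • ket ⟨π, j, α⟩) ∧
        -- action of `p^{±1}` for even `N`
        (Even N →
          ((⟨π, j + yy 1, α⟩ : KetLabel) ∈ S ∧
            g.p 1 (ket ⟨π, j, α⟩)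
              = ((M * q ^ expSum N π 1 : ℝ) : ℂ) • ket ⟨π, j + yy 1, α⟩) ∧
          ((⟨π, j - yy 1, α⟩ : KetLabel) ∈ S ∧
            g.p (-1) (ket ⟨π, j, α⟩)
              = ((M * q ^ expSum N π 1 : ℝ) : ℂ) • ket ⟨π, j - yy 1, α⟩)) ∧
        -- action of the improved simple roots `L`
        (∀ u v, IsSimpleRoot N u v →
          (g.newPos N q u v (ket ⟨π, j, α⟩) ∈
            Submodule.span ℂ (ket '' {s ∈ S | s.π = π ∧ s.j = j + yy v - yy u})) ∧
          (g.newNeg N q u v (ket ⟨π, j, α⟩) ∈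
            Submodule.span ℂ (ket '' {s ∈ S | s.π = π ∧ s.j = j - yy v + yy u})))) ∧
      -- common constant in the eigenvalues of the `𝐤^i`, given a joint eigenspace of finite dimension
      ((∃ s ∈ S, {t ∈ S | t.π = s.π ∧ t.j = s.j}.Finite) →
        ∀ i i', hh N < i → i ≤ rk N → hh N < i' → i' ≤ rk N → lam i = lam i') := by
  have hD := rank_le_aleph0 hirr
  obtain ⟨φ, hφ⟩ := hφ
  obtain ⟨c, π₀, j₀, hM, hε, hlam, hmem⟩ := exists_jointSpace hN hq0 hq1 hrep hφ
  have hε2 : c.ε ^ 2 = 1 := by rcases hε with h | h <;> simp [h]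
  have hs := isSpectral_of_mem hN hq0 hq1 hrep hirr hM hε2 hlam hφ.1 hmem
  refine ⟨fun l h1 h2 => hs.isUnit_dot h1 h2, c.M, c.ε, c.lam, hs.ketLabels hD, hs.ket hD, hM, hε,
    fun i _ _ => hlam i, fun s h => h.1, fun π hπ => hs.exists_ketLabel hD hmem hφ.1 hπ,
    hs.orthonormal_ket hD, hs.span_ket_eq_top hD, fun π j α h => ?_, ?_⟩
  · have hx := hs.ket_mem hD h
    refine ⟨hx.1, hx.2.1, fun l h1 h2 => hs.p_ket hD h1 h2 h,
      fun l h1 h2 => hs.p_neg_ket_eq_zero hD h1 h2 h, fun l h1 h2 => hs.p_neg_ket hD h1 h2 h,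
      fun hodd => ?_, fun hE => ⟨hs.p_one_ket hD hE h, hs.p_neg_one_ket hD hE h⟩,
      fun u v huv => ?_⟩
    · rw [lower_zero]
      exact hx.2.2 hodd
    · obtain ⟨-, h1, h2, -, h3, -⟩ := huv.bounds hN
      have hv := (isPairLabel_step (N := N) h1 h2).2
      have hu : ∀ i, (i < 1 ∨ rk N < i) → yy u i = 0 := fun i hi => by
        unfold yy
        have := h3.1
        have := h3.2.1
        split_ifs <;> simp [Pi.single_apply] <;> omega
      have hl0 : IsPairLabel N π j := h.1
      have l1 : IsPairLabel N π (j + yy v - yy u) := ⟨hl0.1, fun i hi => by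
        simp [hl0.2 i hi, hv i hi, hu i hi]⟩
      have l2 : IsPairLabel N π (j - yy v + yy u) := ⟨hl0.1, fun i hi => by
        simp [hl0.2 i hi, hv i hi, hu i hi]⟩
      rw [hs.span_ket hD l1, hs.span_ket hD l2]
      exact ⟨hs.newPos_mem huv hx, hs.newNeg_mem huv hx⟩
  · rintro ⟨s, h, hfin⟩ i i' h1 h2 h1' h2'
    have hspan := hs.span_ket hD h.1
    -- The kets with a given $(\vec\pi,\vec j)$ span the joint eigenspace, so their finiteness
    -- bounds its dimension, and a ket in it shows that it is nonzero.
    refine hs.lam_eq_of_finite (π := s.π) (j := s.j) ?_ ?_ h1 h2 h1' h2'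
    · intro hbot
      have hx := hs.ket_mem hD h
      rw [hbot, Submodule.mem_bot] at hx
      exact (hs.orthonormal_ket hD).ne_zero ⟨s, h⟩ hx
    · rw [← hspan]
      exact FiniteDimensional.span_of_finite ℂ (hfin.image _)
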